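/- Let $C$ be a small category and $(\mathscr V,\otimes,I)$ a cocomplete symmetric monoidal closed category. For $n\ge 0$ let $C_{\mathscr V}(n)$ be the category of functors $X\colon (C^{op})^n\times C\to\mathscr V$, with the left action of the symmetric group $\sigma(X)(x_1\cdots x_n;x)=X(x_{\sigma(1)}\cdots x_{\sigma(n)};x)$. For $n\ge1$, $m\ge0$, $1\le i\le n$, $X\in C_{\mathscr V}(n)$ and $Y\in C_{\mathscr V}(m)$ let $X\otimes_iY\in C_{\mathscr V}(n+m-1)$ be the coend $$(X\otimes_iY)(x_1\cdots x_{i-1}\,y_1\cdots y_m\,x_{i+1}\cdots x_n;x)=\int^{c\in C}X(x_1\cdots x_{i-1}\,c\,x_{i+1}\cdots x_n;x)\otimes Y(y_1\cdots y_m;c).$$ Let $U\in C_{\mathscr V}(1)$ be $U(a;b)=\coprod_{C(a,b)}I$. With the canonical natural isomorphisms $(X\otimes_jY)\otimes_iZ\cong X\otimes_j(Y\otimes_{i-j+1}Z)$ (for $j\le i<j+m$), $(X\otimes_jY)\otimes_iZ\cong(X\otimes_iZ)\otimes_{j+k-1}Y$ (for $i<j$) and $(X\otimes_jY)\otimes_iZ\cong(X\otimes_{i-m+1}Z)\otimes_jY$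 (for $i\ge j+m$), where $X,Y,Z$ have arities $n,m,k$, and $\sigma(X)\otimes_{\sigma(i)}\tau(Y)\cong(\sigma\circ_i\tau)(X\otimes_iY)$, $X\otimes_iU\cong X$, $U\otimes_1Y\cong Y$, these data form the unital categorical operad $C_{\mathscr V}$. Here $\sigma\circ_i\tau$ is the permutation that arises by inserting $\tau$ at the $i$-th place in $\sigma$. An internal operad in $C_{\mathscr V}$ consists of objects $A_n\in C_{\mathscr V}(n)$, $n\ge0$, and morphisms $\bar\sigma\colon\sigma(A_n)\to A_n$ for $\sigma\in\Sigma_n$ and $\bullet_i\colon A_n\otimes_iA_m\to A_{n+m-1}$ for $1\le i\le n$, such that, up to the canonical isomorphisms, $\bar\sigma\cdot\sigma(\bar\tau)=\overline{\sigma\tau}$, $\bar 1=1$, $$\bullet_i\cdot(\bullet_j\otimes_i1)=\begin{cases}\bullet_{j+k-1}\cdot(\bullet_i\otimes_{j+k-1}1)&\text{if }1\le i<j\le n,\\ \bullet_j\cdot(1\otimes_j\bullet_{i-j+1})&\text{if }j\le i<j+m,\\ \bullet_j\cdot(\bullet_{i-m+1}\otimes_j1)&\text{if }j+m\le i\le n+m-1\end{cases}$$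 on $(A_n\otimes_jA_m)\otimes_iA_k$, and $\bullet_{\sigma(i)}\cdot(\bar\sigma\otimes_{\sigma(i)}\bar\tau)=\overline{\sigma\circ_i\tau}\cdot(\sigma\circ_i\tau)(\bullet_i)$ on $\sigma(A_n)\otimes_{\sigma(i)}\tau(A_m)$. It is unital if it is equipped with a morphism $u\colon U\to A_1$ such that $\bullet_i\cdot(1\otimes_iu)$ and $\bullet_1\cdot(u\otimes_11)$ are the canonical isomorphisms $A_n\otimes_iU\cong A_n$ and $U\otimes_1A_m\cong A_m$. Morphisms are families $A_n\to B_n$ of morphisms of $C_{\mathscr V}(n)$ that commute with all the structure (including $u$ in the unital case). Let $\mathbb SC$ be the free symmetric monoidal category on $C$: its objects are finite lists of objects of $C$, and its morphisms $(c_1\cdots c_n)\to(d_1\cdots d_n)$ are a $\sigma\in\Sigma_n$ with morphisms $c_i\to d_{\sigma(i)}$. A $C$-operad in $\mathscr V$ is a functor $P\colon(\mathbb SC)^{op}\times C\to\mathscr V$, with restrictions $P_n\in C_{\mathscr V}(n)$ and actions $(-)\sigma\colon P_n(c_1\cdots c_n;c)\to P_n(c_{\sigma(1)}\cdots c_{\sigma(n)};c)$,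 together with natural transformations $\circ_i\colon P_n\otimes_iP_m\to P_{n+m-1}$ for $n\ge1$, $m\ge0$, $1\le i\le n$, which satisfy $\circ_i\cdot((-)\sigma\otimes(-)\tau)=(-)(\sigma\circ_i\tau)\cdot\circ_{\sigma(i)}$ and the associativity equations above with $\circ$ in place of $\bullet$. It is unital if it is equipped with maps $u_f\colon I\to P(a;b)$, for all $f\colon a\to b$ in $C$, such that $P(f;h)\,u_g=u_{hgf}$, $\circ_1\cdot(u_f\otimes1)=P(1\cdots1;f)$ and $\circ_i\cdot(1\otimes u_f)=P(1\cdots f\cdots1;1)$. Morphisms are natural transformations that commute with all the $\circ_i$ (and with all the $u_f$ in the unital case). Then the category of internal operads in $C_{\mathscr V}$ is isomorphic to the category of $C$-operads in $\mathscr V$, and the category of unital internal operads in $C_{\mathscr V}$ is isomorphic to the category of unital $C$-operads in $\mathscr V$: $$\mathit{IOp}(C_{\mathscr V})\cong\mathit{Op}^C(\mathscr V),\qquad \mathit{IOp}_u(C_{\mathscr V})\cong\mathit{Op}^C_u(\mathscr V).$$ Both isomorphisms can be chosen to commute with the forgetful functors to families $(A_n)_{n\ge0}$ of objects of the categories $C_{\mathscr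 V}(n)$. -/

import Mathlib

open CategoryTheory Limits Opposite MonoidalCategory
open scoped CategoryTheory.Prod

set_option linter.unusedVariables false
set_option linter.unusedSectionVars false
universe w v u

namespace CatOperad

/-!
Operads coloured by a small category `C`, with values in a cocomplete symmetric monoidal closed
category `V`, and internal operads in the categorical operad of functors `(Cᵒᵖ)ⁿ × C ⥤ V`.

Inputs are numbered from `0`. A composition `∘ᵢ` of an operation of arity `n` with one of arity `m`
exists for `i : Fin n`; its arity is any `l` with `n + m = l + 1`, that is, `l = n + m - 1`.
-/

section Indices

theorem outerPos_lt {n m l : ℕ} (h : n + m = l + 1) (i p : Fin n) (hp : p ≠ i) :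
    (if p < i then (p : ℕ) else p + m - 1) < l := by
  have := i.2; have := p.2
  have h1 : (p : ℕ) ≠ i := fun e => hp (Fin.ext e)
  split_ifs with h2
  · have : (p : ℕ) < i := h2
    omega
  · have : ¬ (p : ℕ) < i := h2
    omega

/-- The place in `x₁ … x_{i-1} y₁ … y_m x_{i+1} … x_n` of the letter `x_p`, for `p ≠ i`. -/
def outerPos {n m l : ℕ} (h : n + m = l + 1) (i p : Fin n) (hp : p ≠ i) : Fin l :=
  ⟨if p < i then (p : ℕ) else p + m - 1, outerPos_lt h i p hp⟩

/-- The word `x₁ … x_{i-1} y₁ … y_m x_{i+1} … x_n` of length `l = n + m - 1` arises by inserting a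
word of length `m` at the `i`-th letter of a word of length `n`. `outer h i p` is `none` for `p = i`
and the place of the letter `x_p` otherwise. -/
def outer {n m l : ℕ} (h : n + m = l + 1) (i p : Fin n) : Option (Fin l) :=
  if hp : p = i then none else some (outerPos h i p hp)

/-- The place in `x₁ … x_{i-1} y₁ … y_m x_{i+1} … x_n` of the letter `y_q`. -/
def inner {n m l : ℕ} (h : n + m = l + 1) (i : Fin n) (q : Fin m) : Fin l :=
  ⟨i + q, by have := i.2; have := q.2; omega⟩

theorem insertion_bijective {n m l : ℕ} (h : n + m = l + 1) (i : Fin n) :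
    Function.Bijective (Sum.elim (fun p : {p : Fin n // p ≠ i} => outerPos h i p.1 p.2)
      (inner h i)) := by
  have hi := i.2
  constructor
  · rintro (⟨p, hp⟩ | q) (⟨p', hp'⟩ | q') e
    all_goals
      simp only [Sum.elim_inl, Sum.elim_inr, outerPos, inner, Fin.mk.injEq, Fin.lt_def] at e
    · have h1 : (p : ℕ) ≠ i := fun e => hp (Fin.ext e)
      have h2 : (p' : ℕ) ≠ i := fun e => hp' (Fin.ext e)
      have : p = p' := Fin.ext (by split_ifs at e <;> omega)
      subst this; rfl
    · have h1 : (p : ℕ) ≠ i := fun e => hp (Fin.ext e)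
      have := q'.2
      exfalso; split_ifs at e <;> omega
    · have h2 : (p' : ℕ) ≠ i := fun e => hp' (Fin.ext e)
      have := q.2
      exfalso; split_ifs at e <;> omega
    · exact congrArg Sum.inr (Fin.ext (by omega))
  · intro r
    have hr := r.2
    by_cases h1 : (r : ℕ) < i
    · refine ⟨Sum.inl ⟨⟨r, by omega⟩, fun e => ?_⟩, ?_⟩
      · have := congrArg Fin.val e; simp at this; omega
      · exact Fin.ext (if_pos (show (⟨r, _⟩ : Fin n) < i from h1))
    · by_cases h2 : (r : ℕ) < i + m
      · exact ⟨Sum.inr ⟨r - i, by omega⟩, Fin.ext (by simp [inner]; omega)⟩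
      · refine ⟨Sum.inl ⟨⟨r + 1 - m, by omega⟩, fun e => ?_⟩, ?_⟩
        · have := congrArg Fin.val e; simp at this; omega
        · refine Fin.ext ((if_neg (fun hlt => ?_)).trans ?_)
          · have : (r : ℕ) + 1 - m < i := hlt
            omega
          · simp; omega

/-- Each place of the long word is the place of exactly one `x_p` with `p ≠ i` or one `y_q`. -/
noncomputable def insertionEquiv {n m l : ℕ} (h : n + m = l + 1) (i : Fin n) :
    {p : Fin n // p ≠ i} ⊕ Fin m ≃ Fin l :=
  Equiv.ofBijective _ (insertion_bijective h i)

/-- The permutation `σ ∘ᵢ τ`: it sends the place of `x_p` in the insertion at `i` to the place of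
`x_{σ p}` in the insertion at `σ i`, and the place of `y_q` to the place of `y_{τ q}`. -/
noncomputable def permInsert {n m l : ℕ} (h : n + m = l + 1) (i : Fin n)
    (σ : Equiv.Perm (Fin n)) (τ : Equiv.Perm (Fin m)) : Equiv.Perm (Fin l) :=
  (insertionEquiv h i).symm.trans
    (((σ.subtypeEquiv (p := (· ≠ i)) (q := (· ≠ σ i)) (fun p => by simp)).sumCongr τ).trans
      (insertionEquiv h (σ i)))

theorem permInsert_outerPos {n m l : ℕ} (h : n + m = l + 1) (i : Fin n)
    (σ : Equiv.Perm (Fin n)) (τ : Equiv.Perm (Fin m)) (p : Fin n) (hp : p ≠ i) :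
    permInsert h i σ τ (outerPos h i p hp) =
      outerPos h (σ i) (σ p) (fun e => hp (σ.injective e)) := by
  have : (insertionEquiv h i).symm (outerPos h i p hp) = Sum.inl ⟨p, hp⟩ :=
    (Equiv.symm_apply_eq _).2 rfl
  simp only [permInsert, Equiv.trans_apply, this]
  rfl

theorem permInsert_inner {n m l : ℕ} (h : n + m = l + 1) (i : Fin n)
    (σ : Equiv.Perm (Fin n)) (τ : Equiv.Perm (Fin m)) (q : Fin m) :
    permInsert h i σ τ (inner h i q) = inner h (σ i) (τ q) := by
  have : (insertionEquiv h i).symm (inner h i q) = Sum.inr q :=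
    (Equiv.symm_apply_eq _).2 rfl
  simp only [permInsert, Equiv.trans_apply, this]
  rfl

end Indices

section Tensor

variable (C : Type w) [SmallCategory C] (V : Type u) [Category.{v} V]

/-- The category `(Cᵒᵖ)ᴵ × C`; for `I = Fin n` it is `(Cᵒᵖ)ⁿ × C`. -/
abbrev Prof (I : Type) := (I → Cᵒᵖ) × C

/-- The category of functors `(Cᵒᵖ)ᴵ × C ⥤ V`; for `I = Fin n` it is `C_V(n)`. -/
abbrev Coll (I : Type) := Prof C I ⥤ V

variable {C V}

/-- The letter `c` at `none`, and the letters of the word `x` elsewhere. -/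
def slot {L : Type} (c : Cᵒᵖ) (x : L → Cᵒᵖ) : Option L → Cᵒᵖ
  | none => c
  | some q => x q

/-- The action of `slot` on morphisms. -/
def slotMap {L : Type} {c c' : Cᵒᵖ} {x x' : L → Cᵒᵖ} (f : c ⟶ c') (g : ∀ q, x q ⟶ x' q) :
    ∀ o : Option L, slot c x o ⟶ slot c' x' o
  | none => f
  | some q => g q

@[simp] theorem slotMap_id {L : Type} (c : Cᵒᵖ) (x : L → Cᵒᵖ) (o : Option L) :
    slotMap (𝟙 c) (fun q => 𝟙 (x q)) o = 𝟙 (slot c x o) := by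
  cases o <;> rfl

@[simp] theorem slotMap_comp {L : Type} {c c' c'' : Cᵒᵖ} {x x' x'' : L → Cᵒᵖ} (f : c ⟶ c')
    (f' : c' ⟶ c'') (g : ∀ q, x q ⟶ x' q) (g' : ∀ q, x' q ⟶ x'' q) (o : Option L) :
    slotMap (f ≫ f') (fun q => g q ≫ g' q) o = slotMap f g o ≫ slotMap f' g' o := by
  cases o <;> rfl

/-- `(c, (x; y)) ↦ (x₁ … c … xₙ; y)`: the word `x ∘ φ`, with `c` at the places where `φ` is `none`. -/
@[simps] def plug {I L : Type} (φ : I → Option L) : Cᵒᵖ × Prof C L ⥤ Prof C I where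
  obj a := (fun p => slot a.1 a.2.1 (φ p), a.2.2)
  map f := (fun p => slotMap f.1 f.2.1 (φ p), f.2.2)
  map_id a := by
    refine Prod.ext (funext fun p => slotMap_id _ _ _) rfl
  map_comp f g := by
    refine Prod.ext (funext fun p => slotMap_comp _ _ _ _ _) rfl

/-- `(d, (x; y)) ↦ (x ∘ ψ; d)`: the letters of `x` chosen by `ψ`, with the output `d`. -/
@[simps] def select {J L : Type} (ψ : J → L) : C × Prof C L ⥤ Prof C J where
  obj a := (fun q => a.2.1 (ψ q), a.1)
  map f := (fun q => f.2.1 (ψ q), f.1)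

variable [MonoidalCategory V]

/-- The object `X(x₁ … c … xₙ; y) ⊗ Y(y₁ … y_m; d)`, for `z = (x₁ … y₁ … y_m … xₙ; y)`. -/
abbrev summandObj {I J L : Type} (φ : I → Option L) (ψ : J → L) (XY : Coll C V I × Coll C V J)
    (c : Cᵒᵖ) (d : C) (z : Prof C L) : V :=
  XY.1.obj ((plug φ).obj (c, z)) ⊗ XY.2.obj ((select ψ).obj (d, z))

/-- The functoriality of `summandObj` in all its variables. -/
def summandMap {I J L : Type} (φ : I → Option L) (ψ : J → L) {XY XY' : Coll C V I × Coll C V J}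
    (α : XY ⟶ XY') {c c' : Cᵒᵖ} (f : c ⟶ c') {d d' : C} (k : d ⟶ d')
    {z z' : Prof C L} (g : z ⟶ z') : summandObj φ ψ XY c d z ⟶ summandObj φ ψ XY' c' d' z' :=
  (XY.1.map ((plug φ).map (Prod.mkHom f g)) ≫ α.1.app _) ⊗ₘ
    (XY.2.map ((select ψ).map (Prod.mkHom k g)) ≫ α.2.app _)

theorem summandMap_id {I J L : Type} (φ : I → Option L) (ψ : J → L)
    (XY : Coll C V I × Coll C V J) (c : Cᵒᵖ) (d : C) (z : Prof C L) :
    summandMap φ ψ (𝟙 XY) (𝟙 c) (𝟙 d) (𝟙 z) = 𝟙 _ := by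
  have h1 : (plug φ).map (Prod.mkHom (𝟙 c) (𝟙 z)) = 𝟙 _ := (plug φ).map_id (c, z)
  have h2 : (select ψ).map (Prod.mkHom (𝟙 d) (𝟙 z)) = 𝟙 _ := (select ψ).map_id (d, z)
  rw [summandMap, h1, h2, CategoryTheory.Functor.map_id, CategoryTheory.Functor.map_id,
    Category.id_comp, Category.id_comp]
  exact MonoidalCategory.id_tensorHom_id _ _

theorem summandMap_comp {I J L : Type} (φ : I → Option L) (ψ : J → L)
    {XY XY' XY'' : Coll C V I × Coll C V J}
    (α : XY ⟶ XY') {c c' : Cᵒᵖ} (f : c ⟶ c') {d d' : C} (k : d ⟶ d')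
    {z z' : Prof C L} (g : z ⟶ z')
    (α' : XY' ⟶ XY'') {c'' : Cᵒᵖ} (f' : c' ⟶ c'') {d'' : C} (k' : d' ⟶ d'')
    {z'' : Prof C L} (g' : z' ⟶ z'') :
    summandMap φ ψ (α ≫ α') (f ≫ f') (k ≫ k') (g ≫ g') =
      summandMap φ ψ α f k g ≫ summandMap φ ψ α' f' k' g' := by
  have h1 : (plug φ).map (Prod.mkHom (f ≫ f') (g ≫ g')) = (plug φ).map (Prod.mkHom f g) ≫
    (plug φ).map (Prod.mkHom f' g') := (plug φ).map_comp (f ×ₘ g) (f' ×ₘ g')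
  have h2 : (select ψ).map (Prod.mkHom (k ≫ k') (g ≫ g')) = (select ψ).map (Prod.mkHom k g) ≫
    (select ψ).map (Prod.mkHom k' g') := (select ψ).map_comp (k ×ₘ g) (k' ×ₘ g')
  rw [summandMap, summandMap, summandMap, h1, h2, MonoidalCategory.tensorHom_comp_tensorHom]
  congr 1
  · rw [CategoryTheory.Functor.map_comp, Category.assoc, Category.assoc,
      ← NatTrans.naturality_assoc]; rfl
  · rw [CategoryTheory.Functor.map_comp, Category.assoc, Category.assoc,
      ← NatTrans.naturality_assoc]; rfl

/-- The functor `Xⁱ_c ⊗ ᵈY` in `Coll C V L`. -/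
def summandFunctor {I J L : Type} (φ : I → Option L) (ψ : J → L) (XY : Coll C V I × Coll C V J)
    (c : Cᵒᵖ) (d : C) : Coll C V L where
  obj z := summandObj φ ψ XY c d z
  map g := summandMap φ ψ (𝟙 XY) (𝟙 c) (𝟙 d) g
  map_id z := summandMap_id φ ψ XY c d z
  map_comp g g' := by
    rw [← summandMap_comp, Category.id_comp, Category.id_comp, Category.id_comp]

/-- The functoriality of `Xⁱ_c ⊗ ᵈY` in `X`, `Y`, `c` and `d`. -/
def summandNat {I J L : Type} (φ : I → Option L) (ψ : J → L) {XY XY' : Coll C V I × Coll C V J}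
    (α : XY ⟶ XY') {c c' : Cᵒᵖ} (f : c ⟶ c') {d d' : C} (k : d ⟶ d') :
    summandFunctor φ ψ XY c d ⟶ summandFunctor φ ψ XY' c' d' where
  app z := summandMap φ ψ α f k (𝟙 z)
  naturality z z' g := by
    dsimp only [summandFunctor]
    rw [← summandMap_comp, ← summandMap_comp]
    simp only [Category.id_comp, Category.comp_id]

theorem map_summandNat_app {I J L : Type} (φ : I → Option L) (ψ : J → L)
    {XY XY' : Coll C V I × Coll C V J} (α : XY ⟶ XY') {c c' : Cᵒᵖ} (f : c ⟶ c') {d d' : C}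
    (k : d ⟶ d') {z z' : Prof C L} (g : z ⟶ z') :
    (summandFunctor φ ψ XY c d).map g ≫ (summandNat φ ψ α f k).app z' =
      summandMap φ ψ α f k g := by
  show summandMap φ ψ _ _ _ _ ≫ summandMap φ ψ _ _ _ _ = _
  rw [← summandMap_comp]
  simp only [Category.id_comp, Category.comp_id]

theorem summandNat_id {I J L : Type} (φ : I → Option L) (ψ : J → L)
    (XY : Coll C V I × Coll C V J) (c : Cᵒᵖ) (d : C) :
    summandNat φ ψ (𝟙 XY) (𝟙 c) (𝟙 d) = 𝟙 _ :=
  NatTrans.ext (funext fun z => summandMap_id φ ψ XY c d z)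

theorem summandNat_comp {I J L : Type} (φ : I → Option L) (ψ : J → L)
    {XY XY' XY'' : Coll C V I × Coll C V J}
    (α : XY ⟶ XY') (α' : XY' ⟶ XY'') {c c' c'' : Cᵒᵖ} (f : c ⟶ c') (f' : c' ⟶ c'')
    {d d' d'' : C} (k : d ⟶ d') (k' : d' ⟶ d'') :
    summandNat φ ψ α f k ≫ summandNat φ ψ α' f' k' =
      summandNat φ ψ (α ≫ α') (f ≫ f') (k ≫ k') := by
  refine NatTrans.ext (funext fun z => ?_)
  have := summandMap_comp φ ψ α f k (𝟙 z) α' f' k' (𝟙 z)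
  rw [Category.id_comp] at this
  exact this.symm

theorem summandNat_comp_assoc {I J L : Type} (φ : I → Option L) (ψ : J → L)
    {XY XY' XY'' : Coll C V I × Coll C V J}
    (α : XY ⟶ XY') (α' : XY' ⟶ XY'') {c c' c'' : Cᵒᵖ} (f : c ⟶ c') (f' : c' ⟶ c'')
    {d d' d'' : C} (k : d ⟶ d') (k' : d' ⟶ d'') {T : Coll C V L}
    (t : summandFunctor φ ψ XY'' c'' d'' ⟶ T) :
    summandNat φ ψ α f k ≫ summandNat φ ψ α' f' k' ≫ t =
      summandNat φ ψ (α ≫ α') (f ≫ f') (k ≫ k') ≫ t := by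
  rw [← Category.assoc, summandNat_comp]

theorem summandNat_exchange {I J L : Type} (φ : I → Option L) (ψ : J → L)
    {XY XY' : Coll C V I × Coll C V J} (α : XY ⟶ XY') {c c' : Cᵒᵖ} (f : c ⟶ c')
    {d d' : C} (k : d ⟶ d') {T : Coll C V L} (t : summandFunctor φ ψ XY' c' d' ⟶ T) :
    summandNat φ ψ α (𝟙 c) (𝟙 d) ≫ summandNat φ ψ (𝟙 XY') f k ≫ t =
      summandNat φ ψ (𝟙 XY) f k ≫ summandNat φ ψ α (𝟙 c') (𝟙 d') ≫ t := by
  simp only [summandNat_comp_assoc, Category.comp_id, Category.id_comp]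

theorem summandNat_id_left {I J L K : Type} (φ : I → Option L) (ψ : J → L) (X : Coll C V I)
    (Y : Coll C V J) (Z : Coll C V K) (c : Cᵒᵖ) (d : C) :
    𝟙 (summandFunctor φ ψ (X, Y) c d, Z) =
      (summandNat φ ψ (𝟙 X ×ₘ 𝟙 Y) (𝟙 c) (𝟙 d) ×ₘ 𝟙 Z) := by
  have := summandNat_id φ ψ (X, Y) c d
  exact Prod.ext this.symm rfl

theorem summandNat_id_right {I J L K : Type} (φ : I → Option L) (ψ : J → L) (X : Coll C V I)
    (Y : Coll C V J) (Z : Coll C V K) (c : Cᵒᵖ) (d : C) :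
    𝟙 (Z, summandFunctor φ ψ (X, Y) c d) =
      (𝟙 Z ×ₘ summandNat φ ψ (𝟙 X ×ₘ 𝟙 Y) (𝟙 c) (𝟙 d)) := by
  have := summandNat_id φ ψ (X, Y) c d
  exact Prod.ext rfl this.symm

/-- `Xⁱ_c ⊗ ᵈY` as a functor of `(X, Y)` with values in functors of `(c, d) ∈ Cᵒᵖ × C`. -/
def summand {I J L : Type} (φ : I → Option L) (ψ : J → L) :
    Coll C V I × Coll C V J ⥤ Cᵒᵖ ⥤ C ⥤ Coll C V L where
  obj XY :=
    { obj c :=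
      { obj d := summandFunctor φ ψ XY c d
        map k := summandNat φ ψ (𝟙 XY) (𝟙 c) k
        map_id d := summandNat_id φ ψ XY c d
        map_comp k k' := by rw [summandNat_comp]; simp only [Category.id_comp] }
      map f :=
      { app d := summandNat φ ψ (𝟙 XY) f (𝟙 d)
        naturality d d' k := by
          dsimp only
          rw [summandNat_comp, summandNat_comp]; simp only [Category.id_comp, Category.comp_id] }
      map_id c := NatTrans.ext (funext fun d => summandNat_id φ ψ XY c d)
      map_comp f f' := NatTrans.ext (funext fun d => by
        dsimp only [NatTrans.comp_app]
        rw [summandNat_comp]; simp only [Category.id_comp]) }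
  map α :=
    { app c :=
      { app d := summandNat φ ψ α (𝟙 c) (𝟙 d)
        naturality d d' k := by
          dsimp only
          rw [summandNat_comp, summandNat_comp]; simp only [Category.id_comp, Category.comp_id] }
      naturality c c' f := NatTrans.ext (funext fun d => by
        dsimp only [NatTrans.comp_app]
        rw [summandNat_comp, summandNat_comp]; simp only [Category.id_comp, Category.comp_id]) }
  map_id XY := NatTrans.ext (funext fun c => NatTrans.ext (funext fun d =>
    summandNat_id φ ψ XY c d))
  map_comp α α' := NatTrans.ext (funext fun c => NatTrans.ext (funext fun d => by
    dsimp only [NatTrans.comp_app]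
    rw [summandNat_comp]; simp only [Category.id_comp]))

variable [HasColimitsOfSize.{w, w} V]

/-- The coend `∫^c Xⁱ_c ⊗ ᶜY` in `Coll C V L`, as a functor of `(X, Y)`. -/
noncomputable def tensorAlong {I J L : Type} (φ : I → Option L) (ψ : J → L) :
    Coll C V I × Coll C V J ⥤ Coll C V L :=
  summand φ ψ ⋙ coendFunctor C (Coll C V L)

/-- The structure morphism `Xⁱ_c ⊗ ᶜY ⟶ ∫^c Xⁱ_c ⊗ ᶜY` of the coend. -/
noncomputable def inj {I J L : Type} (φ : I → Option L) (ψ : J → L)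
    (XY : Coll C V I × Coll C V J) (c : C) :
    summandFunctor φ ψ XY (op c) c ⟶ (tensorAlong φ ψ).obj XY :=
  coend.ι ((summand φ ψ).obj XY) c

theorem inj_dinatural {I J L : Type} (φ : I → Option L) (ψ : J → L)
    (XY : Coll C V I × Coll C V J) {c c' : C} (f : c ⟶ c') :
    summandNat φ ψ (𝟙 XY) f.op (𝟙 c) ≫ inj φ ψ XY c =
      summandNat φ ψ (𝟙 XY) (𝟙 (op c')) f ≫ inj φ ψ XY c' :=
  coend.condition ((summand φ ψ).obj XY) f

theorem inj_dinatural_map {I J L : Type} (φ : I → Option L) (ψ : J → L)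
    {XY XY' : Coll C V I × Coll C V J} (α : XY ⟶ XY') {c c' : C} (f : c ⟶ c') :
    summandNat φ ψ α f.op (𝟙 c) ≫ inj φ ψ XY' c =
      summandNat φ ψ α (𝟙 (op c')) f ≫ inj φ ψ XY' c' := by
  have := congrArg (summandNat φ ψ α (𝟙 (op c')) (𝟙 c) ≫ ·) (inj_dinatural φ ψ XY' f)
  simpa only [summandNat_comp_assoc, Category.comp_id, Category.id_comp] using this

theorem inj_map {I J L : Type} (φ : I → Option L) (ψ : J → L)
    {XY XY' : Coll C V I × Coll C V J} (α : XY ⟶ XY') (c : C) :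
    inj φ ψ XY c ≫ (tensorAlong φ ψ).map α =
      summandNat φ ψ α (𝟙 (op c)) (𝟙 c) ≫ inj φ ψ XY' c :=
  coend.ι_map ((summand φ ψ).map α) c

theorem inj_map_assoc {I J L : Type} (φ : I → Option L) (ψ : J → L)
    {XY XY' : Coll C V I × Coll C V J} (α : XY ⟶ XY') (c : C) {T : Coll C V L}
    (t : (tensorAlong φ ψ).obj XY' ⟶ T) :
    inj φ ψ XY c ≫ (tensorAlong φ ψ).map α ≫ t =
      summandNat φ ψ α (𝟙 (op c)) (𝟙 c) ≫ inj φ ψ XY' c ≫ t := by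
  rw [← Category.assoc, inj_map, Category.assoc]

/-- The morphism out of the coend given by a dinatural family. -/
noncomputable def tensorDesc {I J L : Type} (φ : I → Option L) (ψ : J → L)
    (XY : Coll C V I × Coll C V J) {T : Coll C V L}
    (g : ∀ c : C, summandFunctor φ ψ XY (op c) c ⟶ T)
    (hg : ∀ (c c' : C) (f : c ⟶ c'), summandNat φ ψ (𝟙 XY) f.op (𝟙 c) ≫ g c =
      summandNat φ ψ (𝟙 XY) (𝟙 (op c')) f ≫ g c') : (tensorAlong φ ψ).obj XY ⟶ T :=
  coend.desc (F := (summand φ ψ).obj XY) g (fun _ _ f => hg _ _ f)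

theorem inj_tensorDesc {I J L : Type} (φ : I → Option L) (ψ : J → L)
    (XY : Coll C V I × Coll C V J) {T : Coll C V L}
    (g : ∀ c : C, summandFunctor φ ψ XY (op c) c ⟶ T)
    (hg : ∀ (c c' : C) (f : c ⟶ c'), summandNat φ ψ (𝟙 XY) f.op (𝟙 c) ≫ g c =
      summandNat φ ψ (𝟙 XY) (𝟙 (op c')) f ≫ g c') (c : C) :
    inj φ ψ XY c ≫ tensorDesc φ ψ XY g hg = g c :=
  coend.ι_desc _ _ c

theorem tensor_hom_ext {I J L : Type} (φ : I → Option L) (ψ : J → L)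
    {XY : Coll C V I × Coll C V J} {T : Coll C V L} {f g : (tensorAlong φ ψ).obj XY ⟶ T}
    (h : ∀ c, inj φ ψ XY c ≫ f = inj φ ψ XY c ≫ g) : f = g :=
  coend.hom_ext (F := (summand φ ψ).obj XY) h

section Preserve

variable {A : Type*} [Category* A] {B : Type*} [Category* B] (G : A ⥤ B)
  (F : Cᵒᵖ ⥤ C ⥤ A) [HasCoend F] [PreservesColimit (multispanIndexCoend F).multispan G]

/-- The morphism out of `G (∫^c F)` given by a dinatural family, if `G` preserves the coend. -/
noncomputable def coendDescOf {T : B} (g : ∀ c, G.obj ((F.obj (op c)).obj c) ⟶ T)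
    (hg : ∀ (c c' : C) (f : c ⟶ c'), G.map ((F.map f.op).app c) ≫ g c =
      G.map ((F.obj (op c')).map f) ≫ g c') : G.obj (coend F) ⟶ T :=
  (isColimitOfPreserves G (colimit.isColimit (multispanIndexCoend F).multispan)).desc
    { pt := T
      ι :=
      { app x := match x with
          | .left a => G.map ((F.map a.hom.op).app a.left) ≫ g a.left
          | .right c => g c
        naturality := by
          rintro _ _ (_ | a | a)
          · simp
          · dsimp
            simp
            rfl
          · dsimp
            simp
            exact (hg _ _ a.hom).symm } }

theorem map_ι_coendDescOf {T : B} (g : ∀ c, G.obj ((F.obj (op c)).obj c) ⟶ T)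
    (hg : ∀ (c c' : C) (f : c ⟶ c'), G.map ((F.map f.op).app c) ≫ g c =
      G.map ((F.obj (op c')).map f) ≫ g c') (c : C) :
    G.map (coend.ι F c) ≫ coendDescOf G F g hg = g c :=
  (isColimitOfPreserves G (colimit.isColimit (multispanIndexCoend F).multispan)).fac _ (.right c)

theorem coend_map_hom_ext {T : B} {f g : G.obj (coend F) ⟶ T}
    (h : ∀ c, G.map (coend.ι F c) ≫ f = G.map (coend.ι F c) ≫ g) : f = g := by
  refine (isColimitOfPreserves G
    (colimit.isColimit (multispanIndexCoend F).multispan)).hom_ext fun x => ?_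
  rcases x with a | c
  · have e := (G.mapCocone (colimit.cocone (multispanIndexCoend F).multispan)).w
      (WalkingMultispan.Hom.fst a)
    rw [← e]
    exact (Category.assoc _ _ _).trans ((congrArg _ (h _)).trans (Category.assoc _ _ _).symm)
  · exact h c

end Preserve

theorem comp_eqToHom_of_heq {D : Type*} [Category* D] {a b a' b' : D} (ha : a = a') (hb : b = b')
    (f : a ⟶ b) (f' : a' ⟶ b') (h : f ≍ f') : f ≫ eqToHom hb = eqToHom ha ≫ f' := by
  subst ha hb
  simp [eq_of_heq h]

/-- The identification of two equal profiles. -/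
def profIso {I : Type} {a b : Prof C I} (h : ∀ p, a.1 p = b.1 p) (h' : a.2 = b.2) : a ≅ b where
  hom := (fun p => eqToHom (h p), eqToHom h')
  inv := (fun p => eqToHom (h p).symm, eqToHom h'.symm)
  hom_inv_id := Prod.ext (funext fun p => by simp) (by simp)
  inv_hom_id := Prod.ext (funext fun p => by simp) (by simp)

theorem profIso_natural {I : Type} {a b a' b' : Prof C I} (ha : ∀ p, a.1 p = a'.1 p)
    (ha' : a.2 = a'.2) (hb : ∀ p, b.1 p = b'.1 p) (hb' : b.2 = b'.2) (f : a ⟶ b) (f' : a' ⟶ b')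
    (h : ∀ p, f.1 p ≍ f'.1 p) (h' : f.2 ≍ f'.2) :
    f ≫ (profIso hb hb').hom = (profIso ha ha').hom ≫ f' :=
  Prod.ext (funext fun p => comp_eqToHom_of_heq (ha p) (hb p) _ _ (h p))
    (comp_eqToHom_of_heq ha' hb' _ _ h')

theorem map_profIso_natural {I : Type} {X X' : Coll C V I} (α : X ⟶ X')
    {a b a' b' : Prof C I} {ha : ∀ p, a.1 p = a'.1 p}
    {ha' : a.2 = a'.2} {hb : ∀ p, b.1 p = b'.1 p} {hb' : b.2 = b'.2} {f : a ⟶ b} {f' : a' ⟶ b'}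
    (h : ∀ p, f.1 p ≍ f'.1 p) (h' : f.2 ≍ f'.2) :
    (X.map f ≫ α.app b) ≫ X'.map (profIso hb hb').hom =
      X.map (profIso ha ha').hom ≫ X.map f' ≫ α.app b' := by
  rw [Category.assoc, ← α.naturality, ← Category.assoc, ← Category.assoc,
    ← CategoryTheory.Functor.map_comp, ← CategoryTheory.Functor.map_comp,
    profIso_natural ha ha' hb hb' f f' h h']

theorem associator_square {A₁ A₂ A₃ B₁ B₂ B₃ A₁' A₂' A₃' B₁' B₂' B₃' : V}
    {x₁ : A₁ ⟶ B₁} {x₂ : A₂ ⟶ B₂} {x₃ : A₃ ⟶ B₃}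
    {y₁ : A₁' ⟶ B₁'} {y₂ : A₂' ⟶ B₂'} {y₃ : A₃' ⟶ B₃'}
    {s₁ : A₁ ⟶ A₁'} {s₂ : A₂ ⟶ A₂'} {s₃ : A₃ ⟶ A₃'} {t₁ : B₁ ⟶ B₁'} {t₂ : B₂ ⟶ B₂'}
    {t₃ : B₃ ⟶ B₃'} (h₁ : x₁ ≫ t₁ = s₁ ≫ y₁) (h₂ : x₂ ≫ t₂ = s₂ ≫ y₂)
    (h₃ : x₃ ≫ t₃ = s₃ ≫ y₃) :
    ((x₁ ⊗ₘ x₂) ⊗ₘ x₃) ≫ (α_ B₁ B₂ B₃).hom ≫ (t₁ ⊗ₘ (t₂ ⊗ₘ t₃)) =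
      ((α_ A₁ A₂ A₃).hom ≫ (s₁ ⊗ₘ (s₂ ⊗ₘ s₃))) ≫ (y₁ ⊗ₘ (y₂ ⊗ₘ y₃)) := by
  rw [associator_naturality_assoc, tensorHom_comp_tensorHom, tensorHom_comp_tensorHom,
    h₁, h₂, h₃, ← tensorHom_comp_tensorHom, ← tensorHom_comp_tensorHom, Category.assoc]

section PreserveSummands

variable [SymmetricCategory V] [MonoidalClosed V]

/-- The functor `X ↦ X^i_c ⊗ ^dY`. -/
def summandLeft {I J L : Type} (φ : I → Option L) (ψ : J → L) (Y : Coll C V J) (c : Cᵒᵖ) (d : C) :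
    Coll C V I ⥤ Coll C V L where
  obj X := summandFunctor φ ψ (X, Y) c d
  map α := summandNat φ ψ (α ×ₘ 𝟙 Y) (𝟙 c) (𝟙 d)
  map_id X := summandNat_id φ ψ (X, Y) c d
  map_comp α α' := by
    rw [summandNat_comp, prod_comp]
    simp only [Category.id_comp]

/-- The functor `Y ↦ X^i_c ⊗ ^dY`. -/
def summandRight {I J L : Type} (φ : I → Option L) (ψ : J → L) (X : Coll C V I) (c : Cᵒᵖ) (d : C) :
    Coll C V J ⥤ Coll C V L where
  obj Y := summandFunctor φ ψ (X, Y) c d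
  map α := summandNat φ ψ (𝟙 X ×ₘ α) (𝟙 c) (𝟙 d)
  map_id Y := summandNat_id φ ψ (X, Y) c d
  map_comp α α' := by
    rw [summandNat_comp, prod_comp]
    simp only [Category.id_comp]

instance tensorLeft_preserves (A : V) : PreservesColimitsOfSize.{w, w} (tensorLeft A) :=
  (ihom.adjunction A).leftAdjoint_preservesColimits

instance tensorRight_preserves (A : V) : PreservesColimitsOfSize.{w, w} (tensorRight A) :=
  preservesColimits_of_natIso (BraidedCategory.tensorLeftIsoTensorRight A)

instance evaluation_preserves {I : Type} (z : Prof C I) :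
    PreservesColimitsOfSize.{w, w} ((evaluation (Prof C I) V).obj z) :=
  ⟨fun {_} _ => inferInstance⟩

instance summandLeft_preserves {I J L : Type} (φ : I → Option L) (ψ : J → L) (Y : Coll C V J)
    (c : Cᵒᵖ) (d : C) : PreservesColimitsOfSize.{w, w} (summandLeft φ ψ Y c d) := by
  refine preservesColimits_of_evaluation _ fun z => ?_
  have := comp_preservesColimits ((evaluation (Prof C I) V).obj ((plug φ).obj (c, z)))
    (tensorRight (Y.obj ((select ψ).obj (d, z))))
  refine preservesColimits_of_natIso (F := (evaluation _ _).obj ((plug φ).obj (c, z)) ⋙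
    tensorRight (Y.obj ((select ψ).obj (d, z)))) (NatIso.ofComponents (fun X => Iso.refl _) ?_)
  intro X X' α
  have h1 : (plug φ).map (Prod.mkHom (𝟙 c) (𝟙 z)) = 𝟙 _ := (plug φ).map_id (c, z)
  have h2 : (select ψ).map (Prod.mkHom (𝟙 d) (𝟙 z)) = 𝟙 _ := (select ψ).map_id (d, z)
  have e : summandMap φ ψ (XY := (X, Y)) (XY' := (X', Y)) (α ×ₘ 𝟙 Y) (𝟙 c) (𝟙 d) (𝟙 z) =
      α.app _ ▷ Y.obj ((select ψ).obj (d, z)) := by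
    rw [summandMap, h1, h2, CategoryTheory.Functor.map_id, CategoryTheory.Functor.map_id,
      Category.id_comp]
    exact (congrArg _ (Category.id_comp _)).trans (tensorHom_id _ _)
  exact (Category.comp_id _).trans (e.symm.trans (Category.id_comp _).symm)

instance summandRight_preserves {I J L : Type} (φ : I → Option L) (ψ : J → L) (X : Coll C V I)
    (c : Cᵒᵖ) (d : C) : PreservesColimitsOfSize.{w, w} (summandRight φ ψ X c d) := by
  refine preservesColimits_of_evaluation _ fun z => ?_
  have := comp_preservesColimits ((evaluation (Prof C J) V).obj ((select ψ).obj (d, z)))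
    (tensorLeft (X.obj ((plug φ).obj (c, z))))
  refine preservesColimits_of_natIso (F := (evaluation _ _).obj ((select ψ).obj (d, z)) ⋙
    tensorLeft (X.obj ((plug φ).obj (c, z)))) (NatIso.ofComponents (fun X => Iso.refl _) ?_)
  intro Y Y' α
  have h1 : (plug φ).map (Prod.mkHom (𝟙 c) (𝟙 z)) = 𝟙 _ := (plug φ).map_id (c, z)
  have h2 : (select ψ).map (Prod.mkHom (𝟙 d) (𝟙 z)) = 𝟙 _ := (select ψ).map_id (d, z)
  have e : summandMap φ ψ (XY := (X, Y)) (XY' := (X, Y')) (𝟙 X ×ₘ α) (𝟙 c) (𝟙 d) (𝟙 z) =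
      X.obj ((plug φ).obj (c, z)) ◁ α.app _ := by
    rw [summandMap, h1, h2, CategoryTheory.Functor.map_id, CategoryTheory.Functor.map_id,
      Category.id_comp]
    exact (congrArg (fun t => 𝟙 (X.obj ((plug φ).obj (c, z))) ⊗ₘ t) (Category.id_comp _)).trans
      (id_tensorHom _ _)
  exact (Category.comp_id _).trans (e.symm.trans (Category.id_comp _).symm)

variable {I J K L R : Type} (φ₁ : I → Option L) (ψ₁ : J → L) (φ₂ : L → Option R) (ψ₂ : K → R)
  (φ₄ : K → Option R) (ψ₄ : L → R)

/-- The morphism out of `(∫^c Xⁱ_c ⊗ ᶜY)ʲ_d ⊗ ᵏZ` given by a family that is dinatural in `c`. -/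
noncomputable def leftDesc (XY : Coll C V I × Coll C V J) (Z : Coll C V K) (d : Cᵒᵖ) (k : C)
    {T : Coll C V R}
    (g : ∀ c : C, summandFunctor φ₂ ψ₂ (summandFunctor φ₁ ψ₁ XY (op c) c, Z) d k ⟶ T)
    (hg : ∀ (c c' : C) (f : c ⟶ c'),
      summandNat φ₂ ψ₂ (summandNat φ₁ ψ₁ (𝟙 XY) f.op (𝟙 c) ×ₘ 𝟙 Z) (𝟙 d) (𝟙 k) ≫ g c =
      summandNat φ₂ ψ₂ (summandNat φ₁ ψ₁ (𝟙 XY) (𝟙 (op c')) f ×ₘ 𝟙 Z) (𝟙 d) (𝟙 k) ≫ g c') :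
    summandFunctor φ₂ ψ₂ ((tensorAlong φ₁ ψ₁).obj XY, Z) d k ⟶ T :=
  coendDescOf (summandLeft φ₂ ψ₂ Z d k) ((summand φ₁ ψ₁).obj XY) g hg

theorem inj_leftDesc (XY : Coll C V I × Coll C V J) (Z : Coll C V K) (d : Cᵒᵖ) (k : C)
    {T : Coll C V R}
    (g : ∀ c : C, summandFunctor φ₂ ψ₂ (summandFunctor φ₁ ψ₁ XY (op c) c, Z) d k ⟶ T)
    (hg : ∀ (c c' : C) (f : c ⟶ c'),
      summandNat φ₂ ψ₂ (summandNat φ₁ ψ₁ (𝟙 XY) f.op (𝟙 c) ×ₘ 𝟙 Z) (𝟙 d) (𝟙 k) ≫ g c =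
      summandNat φ₂ ψ₂ (summandNat φ₁ ψ₁ (𝟙 XY) (𝟙 (op c')) f ×ₘ 𝟙 Z) (𝟙 d) (𝟙 k) ≫ g c')
    (c : C) :
    summandNat φ₂ ψ₂ (inj φ₁ ψ₁ XY c ×ₘ 𝟙 Z) (𝟙 d) (𝟙 k) ≫
      leftDesc φ₁ ψ₁ φ₂ ψ₂ XY Z d k g hg = g c :=
  map_ι_coendDescOf (summandLeft φ₂ ψ₂ Z d k) ((summand φ₁ ψ₁).obj XY) g hg c

theorem left_hom_ext {XY : Coll C V I × Coll C V J} {Z : Coll C V K} {d : Cᵒᵖ} {k : C}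
    {T : Coll C V R} {f g : summandFunctor φ₂ ψ₂ ((tensorAlong φ₁ ψ₁).obj XY, Z) d k ⟶ T}
    (h : ∀ c, summandNat φ₂ ψ₂ (inj φ₁ ψ₁ XY c ×ₘ 𝟙 Z) (𝟙 d) (𝟙 k) ≫ f =
      summandNat φ₂ ψ₂ (inj φ₁ ψ₁ XY c ×ₘ 𝟙 Z) (𝟙 d) (𝟙 k) ≫ g) : f = g :=
  coend_map_hom_ext (summandLeft φ₂ ψ₂ Z d k) ((summand φ₁ ψ₁).obj XY) h

/-- The morphism out of `Zʲ_d ⊗ ᵏ(∫^c Xⁱ_c ⊗ ᶜY)` given by a family that is dinatural in `c`. -/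
noncomputable def rightDesc (XY : Coll C V I × Coll C V J) (Z : Coll C V K) (d : Cᵒᵖ) (k : C)
    {T : Coll C V R}
    (g : ∀ c : C, summandFunctor φ₄ ψ₄ (Z, summandFunctor φ₁ ψ₁ XY (op c) c) d k ⟶ T)
    (hg : ∀ (c c' : C) (f : c ⟶ c'),
      summandNat φ₄ ψ₄ (𝟙 Z ×ₘ summandNat φ₁ ψ₁ (𝟙 XY) f.op (𝟙 c)) (𝟙 d) (𝟙 k) ≫ g c =
      summandNat φ₄ ψ₄ (𝟙 Z ×ₘ summandNat φ₁ ψ₁ (𝟙 XY) (𝟙 (op c')) f) (𝟙 d) (𝟙 k) ≫ g c') :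
    summandFunctor φ₄ ψ₄ (Z, (tensorAlong φ₁ ψ₁).obj XY) d k ⟶ T :=
  coendDescOf (summandRight φ₄ ψ₄ Z d k) ((summand φ₁ ψ₁).obj XY) g hg

theorem inj_rightDesc (XY : Coll C V I × Coll C V J) (Z : Coll C V K) (d : Cᵒᵖ) (k : C)
    {T : Coll C V R}
    (g : ∀ c : C, summandFunctor φ₄ ψ₄ (Z, summandFunctor φ₁ ψ₁ XY (op c) c) d k ⟶ T)
    (hg : ∀ (c c' : C) (f : c ⟶ c'),
      summandNat φ₄ ψ₄ (𝟙 Z ×ₘ summandNat φ₁ ψ₁ (𝟙 XY) f.op (𝟙 c)) (𝟙 d) (𝟙 k) ≫ g c =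
      summandNat φ₄ ψ₄ (𝟙 Z ×ₘ summandNat φ₁ ψ₁ (𝟙 XY) (𝟙 (op c')) f) (𝟙 d) (𝟙 k) ≫ g c')
    (c : C) :
    summandNat φ₄ ψ₄ (𝟙 Z ×ₘ inj φ₁ ψ₁ XY c) (𝟙 d) (𝟙 k) ≫
      rightDesc φ₁ ψ₁ φ₄ ψ₄ XY Z d k g hg = g c :=
  map_ι_coendDescOf (summandRight φ₄ ψ₄ Z d k) ((summand φ₁ ψ₁).obj XY) g hg c

theorem right_hom_ext {XY : Coll C V I × Coll C V J} {Z : Coll C V K} {d : Cᵒᵖ} {k : C}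
    {T : Coll C V R} {f g : summandFunctor φ₄ ψ₄ (Z, (tensorAlong φ₁ ψ₁).obj XY) d k ⟶ T}
    (h : ∀ c, summandNat φ₄ ψ₄ (𝟙 Z ×ₘ inj φ₁ ψ₁ XY c) (𝟙 d) (𝟙 k) ≫ f =
      summandNat φ₄ ψ₄ (𝟙 Z ×ₘ inj φ₁ ψ₁ XY c) (𝟙 d) (𝟙 k) ≫ g) : f = g :=
  coend_map_hom_ext (summandRight φ₄ ψ₄ Z d k) ((summand φ₁ ψ₁).obj XY) h

end PreserveSummands

section Sequential

/-- The relation between the index maps of the two sides of `(X ⊗ Y) ⊗ Z ≅ X ⊗ (Y ⊗ Z)`. -/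
structure SeqIndices {I J K L M R : Type} (φ₁ : I → Option L) (ψ₁ : J → L) (φ₂ : L → Option R)
    (ψ₂ : K → R) (φ₃ : J → Option M) (ψ₃ : K → M) (φ₄ : I → Option R) (ψ₄ : M → R) : Prop where
  fst (p : I) : (φ₁ p = none ∧ φ₄ p = none) ∨
    ∃ t r, φ₁ p = some t ∧ φ₂ t = some r ∧ φ₄ p = some r
  snd (q : J) : φ₂ (ψ₁ q) = (φ₃ q).map ψ₄
  trd (k : K) : ψ₂ k = ψ₄ (ψ₃ k)

variable {I J K L M R : Type} {φ₁ : I → Option L} {ψ₁ : J → L} {φ₂ : L → Option R}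
    {ψ₂ : K → R} {φ₃ : J → Option M} {ψ₃ : K → M} {φ₄ : I → Option R} {ψ₄ : M → R}

theorem SeqIndices.slot_fst (H : SeqIndices φ₁ ψ₁ φ₂ ψ₂ φ₃ ψ₃ φ₄ ψ₄) (c d : Cᵒᵖ) (x : R → Cᵒᵖ)
    (p : I) : slot c (fun q => slot d x (φ₂ q)) (φ₁ p) = slot c x (φ₄ p) := by
  rcases H.fst p with ⟨h1, h2⟩ | ⟨t, r, h1, h2, h3⟩
  · rw [h1, h2]; rfl
  · rw [h1, h3]
    show slot d x (φ₂ t) = _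
    rw [h2]; rfl

theorem SeqIndices.slot_snd (H : SeqIndices φ₁ ψ₁ φ₂ ψ₂ φ₃ ψ₃ φ₄ ψ₄) (d : Cᵒᵖ) (x : R → Cᵒᵖ)
    (q : J) : slot d x (φ₂ (ψ₁ q)) = slot d (fun t => x (ψ₄ t)) (φ₃ q) := by
  rw [H.snd q]; cases φ₃ q <;> rfl

theorem SeqIndices.slotMap_fst (H : SeqIndices φ₁ ψ₁ φ₂ ψ₂ φ₃ ψ₃ φ₄ ψ₄) {c c' d d' : Cᵒᵖ}
    {x x' : R → Cᵒᵖ} (f : c ⟶ c') (g : d ⟶ d') (r : x ⟶ x') (p : I) :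
    slotMap f (fun q => slotMap g r (φ₂ q)) (φ₁ p) ≍ slotMap f r (φ₄ p) := by
  rcases H.fst p with ⟨h1, h2⟩ | ⟨t, r, h1, h2, h3⟩
  · rw [h1, h2]; rfl
  · rw [h1, h3]
    show slotMap g _ (φ₂ t) ≍ _
    rw [h2]; rfl

theorem SeqIndices.slotMap_snd (H : SeqIndices φ₁ ψ₁ φ₂ ψ₂ φ₃ ψ₃ φ₄ ψ₄) {d d' : Cᵒᵖ}
    {x x' : R → Cᵒᵖ} (g : d ⟶ d') (r : x ⟶ x') (q : J) :
    slotMap g r (φ₂ (ψ₁ q)) ≍ slotMap g (fun t => r (ψ₄ t)) (φ₃ q) := by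
  rw [H.snd q]; cases φ₃ q <;> rfl

/-- The associator `(X(…) ⊗ Y(…)) ⊗ Z(…) ≅ X(…) ⊗ (Y(…) ⊗ Z(…))` of `V`. -/
def seqSummandApp (H : SeqIndices φ₁ ψ₁ φ₂ ψ₂ φ₃ ψ₃ φ₄ ψ₄) (X : Coll C V I) (Y : Coll C V J)
    (Z : Coll C V K) (c : Cᵒᵖ) (e : C) (d : Cᵒᵖ) (k : C) (z : Prof C R) :
    summandObj φ₂ ψ₂ (summandFunctor φ₁ ψ₁ (X, Y) c e, Z) d k z ≅
      summandObj φ₄ ψ₄ (X, summandFunctor φ₃ ψ₃ (Y, Z) d k) c e z :=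
  α_ _ _ _ ≪≫
    (X.mapIso (profIso (a := (plug φ₁).obj (c, (plug φ₂).obj (d, z))) (b := (plug φ₄).obj (c, z))
        (fun p => H.slot_fst c d z.1 p) rfl) ⊗ᵢ
      (Y.mapIso (profIso (a := (select ψ₁).obj (e, (plug φ₂).obj (d, z)))
          (b := (plug φ₃).obj (d, (select ψ₄).obj (e, z))) (fun q => H.slot_snd d z.1 q) rfl) ⊗ᵢ
        Z.mapIso (profIso (a := (select ψ₂).obj (k, z))
          (b := (select ψ₃).obj (k, (select ψ₄).obj (e, z)))
          (fun q => congrArg z.1 (H.trd q)) rfl)))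

theorem seqSummandApp_natural (H : SeqIndices φ₁ ψ₁ φ₂ ψ₂ φ₃ ψ₃ φ₄ ψ₄) {X X' : Coll C V I}
    {Y Y' : Coll C V J} {Z Z' : Coll C V K} (α : X ⟶ X') (β : Y ⟶ Y') (γ : Z ⟶ Z')
    {c c' : Cᵒᵖ} (f : c ⟶ c') {e e' : C} (j : e ⟶ e') {d d' : Cᵒᵖ} (g : d ⟶ d') {k k' : C}
    (i : k ⟶ k') {z z' : Prof C R} (r : z ⟶ z') :
    summandMap φ₂ ψ₂ (XY := (summandFunctor φ₁ ψ₁ (X, Y) c e, Z))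
        (XY' := (summandFunctor φ₁ ψ₁ (X', Y') c' e', Z'))
        (summandNat φ₁ ψ₁ (α ×ₘ β) f j ×ₘ γ) g i r ≫
          (seqSummandApp H X' Y' Z' c' e' d' k' z').hom =
      (seqSummandApp H X Y Z c e d k z).hom ≫
        summandMap φ₄ ψ₄ (XY := (X, summandFunctor φ₃ ψ₃ (Y, Z) d k))
        (XY' := (X', summandFunctor φ₃ ψ₃ (Y', Z') d' k'))
        (α ×ₘ summandNat φ₃ ψ₃ (β ×ₘ γ) g i) f j r := by
  have hX := map_profIso_natural α (a := (plug φ₁).obj (c, (plug φ₂).obj (d, z)))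
    (b := (plug φ₁).obj (c', (plug φ₂).obj (d', z')))
    (a' := (plug φ₄).obj (c, z)) (b' := (plug φ₄).obj (c', z'))
    (ha := fun p => H.slot_fst c d z.1 p) (ha' := rfl)
    (hb := fun p => H.slot_fst c' d' z'.1 p) (hb' := rfl)
    (f := (plug φ₁).map (Prod.mkHom f ((plug φ₂).map (Prod.mkHom g r))))
    (f' := (plug φ₄).map (Prod.mkHom f r)) (fun p => H.slotMap_fst f g r.1 p) HEq.rfl
  have hY := map_profIso_natural β (a := (select ψ₁).obj (e, (plug φ₂).obj (d, z)))
    (b := (select ψ₁).obj (e', (plug φ₂).obj (d', z')))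
    (a' := (plug φ₃).obj (d, (select ψ₄).obj (e, z)))
    (b' := (plug φ₃).obj (d', (select ψ₄).obj (e', z')))
    (ha := fun q => H.slot_snd d z.1 q) (ha' := rfl)
    (hb := fun q => H.slot_snd d' z'.1 q) (hb' := rfl)
    (f := (select ψ₁).map (Prod.mkHom j ((plug φ₂).map (Prod.mkHom g r))))
    (f' := (plug φ₃).map (Prod.mkHom g ((select ψ₄).map (Prod.mkHom j r))))
    (fun q => H.slotMap_snd g r.1 q) HEq.rfl
  have hZ := map_profIso_natural γ (a := (select ψ₂).obj (k, z))
    (b := (select ψ₂).obj (k', z'))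
    (a' := (select ψ₃).obj (k, (select ψ₄).obj (e, z)))
    (b' := (select ψ₃).obj (k', (select ψ₄).obj (e', z')))
    (ha := fun q => congrArg z.1 (H.trd q)) (ha' := rfl)
    (hb := fun q => congrArg z'.1 (H.trd q)) (hb' := rfl)
    (f := (select ψ₂).map (Prod.mkHom i r))
    (f' := (select ψ₃).map (Prod.mkHom i ((select ψ₄).map (Prod.mkHom j r))))
    (fun q => by
      show r.1 (ψ₂ q) ≍ r.1 (ψ₄ (ψ₃ q))
      rw [H.trd q]) HEq.rfl
  have e1 := map_summandNat_app φ₁ ψ₁ (XY := (X, Y)) (XY' := (X', Y')) (α ×ₘ β) f j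
    ((plug φ₂).map (Prod.mkHom g r))
  have e2 := map_summandNat_app φ₃ ψ₃ (XY := (Y, Z)) (XY' := (Y', Z')) (β ×ₘ γ) g i
    ((select ψ₄).map (Prod.mkHom j r))
  exact (congrArg (· ≫ (seqSummandApp H X' Y' Z' c' e' d' k' z').hom)
    (congrArg (· ⊗ₘ (Z.map ((select ψ₂).map (Prod.mkHom i r)) ≫ γ.app _)) e1)).trans
    ((associator_square hX hY hZ).trans (congrArg ((seqSummandApp H X Y Z c e d k z).hom ≫ ·)
      (congrArg ((X.map ((plug φ₄).map (Prod.mkHom f r)) ≫ α.app _) ⊗ₘ ·) e2.symm)))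


/-- The previous isomorphism as an isomorphism of functors. -/
def seqSummandIso (H : SeqIndices φ₁ ψ₁ φ₂ ψ₂ φ₃ ψ₃ φ₄ ψ₄) (X : Coll C V I) (Y : Coll C V J)
    (Z : Coll C V K) (c : Cᵒᵖ) (e : C) (d : Cᵒᵖ) (k : C) :
    summandFunctor φ₂ ψ₂ (summandFunctor φ₁ ψ₁ (X, Y) c e, Z) d k ≅
      summandFunctor φ₄ ψ₄ (X, summandFunctor φ₃ ψ₃ (Y, Z) d k) c e :=
  NatIso.ofComponents (fun z => seqSummandApp H X Y Z c e d k z) (fun {z z'} r => by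
    have := seqSummandApp_natural H (𝟙 X) (𝟙 Y) (𝟙 Z) (𝟙 c) (𝟙 e) (𝟙 d) (𝟙 k) r
    have e1 : summandNat φ₁ ψ₁ (𝟙 X ×ₘ 𝟙 Y) (𝟙 c) (𝟙 e) = 𝟙 _ := summandNat_id φ₁ ψ₁ (X, Y) c e
    have e2 : summandNat φ₃ ψ₃ (𝟙 Y ×ₘ 𝟙 Z) (𝟙 d) (𝟙 k) = 𝟙 _ := summandNat_id φ₃ ψ₃ (Y, Z) d k
    rw [e1, e2] at this
    exact this)

theorem seqSummandIso_natural (H : SeqIndices φ₁ ψ₁ φ₂ ψ₂ φ₃ ψ₃ φ₄ ψ₄) {X X' : Coll C V I}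
    {Y Y' : Coll C V J} {Z Z' : Coll C V K} (α : X ⟶ X') (β : Y ⟶ Y') (γ : Z ⟶ Z')
    {c c' : Cᵒᵖ} (f : c ⟶ c') {e e' : C} (j : e ⟶ e') {d d' : Cᵒᵖ} (g : d ⟶ d') {k k' : C}
    (i : k ⟶ k') :
    summandNat φ₂ ψ₂ (summandNat φ₁ ψ₁ (α ×ₘ β) f j ×ₘ γ) g i ≫
        (seqSummandIso H X' Y' Z' c' e' d' k').hom =
      (seqSummandIso H X Y Z c e d k).hom ≫
        summandNat φ₄ ψ₄ (α ×ₘ summandNat φ₃ ψ₃ (β ×ₘ γ) g i) f j :=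
  NatTrans.ext (funext fun z => seqSummandApp_natural H α β γ f j g i (𝟙 z))

theorem seqSummandIso_natural_assoc (H : SeqIndices φ₁ ψ₁ φ₂ ψ₂ φ₃ ψ₃ φ₄ ψ₄) {X X' : Coll C V I}
    {Y Y' : Coll C V J} {Z Z' : Coll C V K} (α : X ⟶ X') (β : Y ⟶ Y') (γ : Z ⟶ Z')
    {c c' : Cᵒᵖ} (f : c ⟶ c') {e e' : C} (j : e ⟶ e') {d d' : Cᵒᵖ} (g : d ⟶ d') {k k' : C}
    (i : k ⟶ k') {T : Coll C V R}
    (t : summandFunctor φ₄ ψ₄ (X', summandFunctor φ₃ ψ₃ (Y', Z') d' k') c' e' ⟶ T) :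
    summandNat φ₂ ψ₂ (summandNat φ₁ ψ₁ (α ×ₘ β) f j ×ₘ γ) g i ≫
        (seqSummandIso H X' Y' Z' c' e' d' k').hom ≫ t =
      (seqSummandIso H X Y Z c e d k).hom ≫
        summandNat φ₄ ψ₄ (α ×ₘ summandNat φ₃ ψ₃ (β ×ₘ γ) g i) f j ≫ t := by
  rw [← Category.assoc, seqSummandIso_natural, Category.assoc]

theorem seqSummandIso_inv_natural_assoc (H : SeqIndices φ₁ ψ₁ φ₂ ψ₂ φ₃ ψ₃ φ₄ ψ₄)
    {X X' : Coll C V I}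
    {Y Y' : Coll C V J} {Z Z' : Coll C V K} (α : X ⟶ X') (β : Y ⟶ Y') (γ : Z ⟶ Z')
    {c c' : Cᵒᵖ} (f : c ⟶ c') {e e' : C} (j : e ⟶ e') {d d' : Cᵒᵖ} (g : d ⟶ d') {k k' : C}
    (i : k ⟶ k') {T : Coll C V R}
    (t : summandFunctor φ₂ ψ₂ (summandFunctor φ₁ ψ₁ (X', Y') c' e', Z') d' k' ⟶ T) :
    summandNat φ₄ ψ₄ (α ×ₘ summandNat φ₃ ψ₃ (β ×ₘ γ) g i) f j ≫
        (seqSummandIso H X' Y' Z' c' e' d' k').inv ≫ t =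
      (seqSummandIso H X Y Z c e d k).inv ≫
        summandNat φ₂ ψ₂ (summandNat φ₁ ψ₁ (α ×ₘ β) f j ×ₘ γ) g i ≫ t := by
  rw [Iso.eq_inv_comp, ← seqSummandIso_natural_assoc, Iso.hom_inv_id_assoc]

variable [SymmetricCategory V] [MonoidalClosed V]

theorem prod_id_eq {A : Type*} [Category* A] {B : Type*} [Category* B] (X : A) (Y : B) :
    (𝟙 X ×ₘ 𝟙 Y) = 𝟙 (X, Y) := rfl

/-- The morphism of iterated coends that is the associator of `V` on the summands. -/
noncomputable def seqHom (H : SeqIndices φ₁ ψ₁ φ₂ ψ₂ φ₃ ψ₃ φ₄ ψ₄) (X : Coll C V I)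
    (Y : Coll C V J) (Z : Coll C V K) :
    (tensorAlong φ₂ ψ₂).obj ((tensorAlong φ₁ ψ₁).obj (X, Y), Z) ⟶
      (tensorAlong φ₄ ψ₄).obj (X, (tensorAlong φ₃ ψ₃).obj (Y, Z)) :=
  tensorDesc φ₂ ψ₂ _ (fun d => leftDesc φ₁ ψ₁ φ₂ ψ₂ (X, Y) Z (op d) d
    (fun c => (seqSummandIso H X Y Z (op c) c (op d) d).hom ≫
      summandNat φ₄ ψ₄ (𝟙 X ×ₘ inj φ₃ ψ₃ (Y, Z) d) (𝟙 (op c)) (𝟙 c) ≫ inj φ₄ ψ₄ _ c)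
    (fun c c' f => by
      rw [← prod_id_eq X Y, seqSummandIso_natural_assoc, seqSummandIso_natural_assoc]
      rw [summandNat_comp_assoc, summandNat_comp_assoc]
      simp only [Category.comp_id, inj_dinatural_map]))
    (fun d d' f => by
      refine left_hom_ext _ _ _ _ fun c => ?_
      rw [summandNat_exchange, summandNat_exchange, inj_leftDesc, inj_leftDesc,
        summandNat_id_left φ₁ ψ₁ X Y Z, seqSummandIso_natural_assoc, seqSummandIso_natural_assoc,
        summandNat_comp_assoc, summandNat_comp_assoc]
      simp only [prod_comp, prod_id_eq Y, Category.comp_id, inj_dinatural_map])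

theorem inj_seqHom (H : SeqIndices φ₁ ψ₁ φ₂ ψ₂ φ₃ ψ₃ φ₄ ψ₄) (X : Coll C V I)
    (Y : Coll C V J) (Z : Coll C V K) (c d : C) :
    summandNat φ₂ ψ₂ (inj φ₁ ψ₁ (X, Y) c ×ₘ 𝟙 Z) (𝟙 (op d)) (𝟙 d) ≫ inj φ₂ ψ₂ _ d ≫
      seqHom H X Y Z = (seqSummandIso H X Y Z (op c) c (op d) d).hom ≫
      summandNat φ₄ ψ₄ (𝟙 X ×ₘ inj φ₃ ψ₃ (Y, Z) d) (𝟙 (op c)) (𝟙 c) ≫ inj φ₄ ψ₄ _ c := by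
  exact (congrArg (_ ≫ ·) (inj_tensorDesc φ₂ ψ₂ _ _ _ d)).trans
    (inj_leftDesc φ₁ ψ₁ φ₂ ψ₂ _ _ _ _ _ _ c)

/-- Its inverse. -/
noncomputable def seqInv (H : SeqIndices φ₁ ψ₁ φ₂ ψ₂ φ₃ ψ₃ φ₄ ψ₄) (X : Coll C V I)
    (Y : Coll C V J) (Z : Coll C V K) :
    (tensorAlong φ₄ ψ₄).obj (X, (tensorAlong φ₃ ψ₃).obj (Y, Z)) ⟶
    (tensorAlong φ₂ ψ₂).obj ((tensorAlong φ₁ ψ₁).obj (X, Y), Z) :=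
  tensorDesc φ₄ ψ₄ _ (fun c => rightDesc φ₃ ψ₃ φ₄ ψ₄ (Y, Z) X (op c) c
    (fun d => (seqSummandIso H X Y Z (op c) c (op d) d).inv ≫
      summandNat φ₂ ψ₂ (inj φ₁ ψ₁ (X, Y) c ×ₘ 𝟙 Z) (𝟙 (op d)) (𝟙 d) ≫ inj φ₂ ψ₂ _ d)
    (fun d d' f => by
      rw [← prod_id_eq Y Z, seqSummandIso_inv_natural_assoc, seqSummandIso_inv_natural_assoc]
      rw [summandNat_comp_assoc, summandNat_comp_assoc]
      simp only [Category.comp_id, inj_dinatural_map]))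
    (fun c c' f => by
      refine right_hom_ext _ _ _ _ fun d => ?_
      rw [summandNat_exchange, summandNat_exchange, inj_rightDesc, inj_rightDesc,
        summandNat_id_right φ₃ ψ₃ Y Z X, seqSummandIso_inv_natural_assoc,
        seqSummandIso_inv_natural_assoc, summandNat_comp_assoc, summandNat_comp_assoc]
      simp only [prod_comp, prod_id_eq X, Category.comp_id, inj_dinatural_map])

theorem inj_seqInv (H : SeqIndices φ₁ ψ₁ φ₂ ψ₂ φ₃ ψ₃ φ₄ ψ₄) (X : Coll C V I)
    (Y : Coll C V J) (Z : Coll C V K) (c d : C) :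
    summandNat φ₄ ψ₄ (𝟙 X ×ₘ inj φ₃ ψ₃ (Y, Z) d) (𝟙 (op c)) (𝟙 c) ≫ inj φ₄ ψ₄ _ c ≫
      seqInv H X Y Z = (seqSummandIso H X Y Z (op c) c (op d) d).inv ≫
      summandNat φ₂ ψ₂ (inj φ₁ ψ₁ (X, Y) c ×ₘ 𝟙 Z) (𝟙 (op d)) (𝟙 d) ≫ inj φ₂ ψ₂ _ d := by
  exact (congrArg (_ ≫ ·) (inj_tensorDesc φ₄ ψ₄ _ _ _ c)).trans
    (inj_rightDesc φ₃ ψ₃ φ₄ ψ₄ _ _ _ _ _ _ d)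

theorem left_tensor_hom_ext {X : Coll C V I} {Y : Coll C V J} {Z : Coll C V K} {T : Coll C V R}
    {f g : (tensorAlong φ₂ ψ₂).obj ((tensorAlong φ₁ ψ₁).obj (X, Y), Z) ⟶ T}
    (h : ∀ c d, summandNat φ₂ ψ₂ (inj φ₁ ψ₁ (X, Y) c ×ₘ 𝟙 Z) (𝟙 (op d)) (𝟙 d) ≫
      inj φ₂ ψ₂ _ d ≫ f = summandNat φ₂ ψ₂ (inj φ₁ ψ₁ (X, Y) c ×ₘ 𝟙 Z) (𝟙 (op d)) (𝟙 d) ≫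
      inj φ₂ ψ₂ _ d ≫ g) : f = g :=
  tensor_hom_ext _ _ fun d => left_hom_ext _ _ _ _ fun c => h c d

theorem right_tensor_hom_ext {X : Coll C V I} {Y : Coll C V J} {Z : Coll C V K} {T : Coll C V R}
    {f g : (tensorAlong φ₄ ψ₄).obj (X, (tensorAlong φ₃ ψ₃).obj (Y, Z)) ⟶ T}
    (h : ∀ c d, summandNat φ₄ ψ₄ (𝟙 X ×ₘ inj φ₃ ψ₃ (Y, Z) d) (𝟙 (op c)) (𝟙 c) ≫
      inj φ₄ ψ₄ _ c ≫ f = summandNat φ₄ ψ₄ (𝟙 X ×ₘ inj φ₃ ψ₃ (Y, Z) d) (𝟙 (op c)) (𝟙 c) ≫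
      inj φ₄ ψ₄ _ c ≫ g) : f = g :=
  tensor_hom_ext _ _ fun c => right_hom_ext _ _ _ _ fun d => h c d

/-- The canonical isomorphism `(X ⊗_j Y) ⊗_i Z ≅ X ⊗_j (Y ⊗_{i-j+1} Z)`. -/
noncomputable def seqIso (H : SeqIndices φ₁ ψ₁ φ₂ ψ₂ φ₃ ψ₃ φ₄ ψ₄) (X : Coll C V I)
    (Y : Coll C V J) (Z : Coll C V K) :
    (tensorAlong φ₂ ψ₂).obj ((tensorAlong φ₁ ψ₁).obj (X, Y), Z) ≅
      (tensorAlong φ₄ ψ₄).obj (X, (tensorAlong φ₃ ψ₃).obj (Y, Z)) where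
  hom := seqHom H X Y Z
  inv := seqInv H X Y Z
  hom_inv_id := left_tensor_hom_ext fun c d => by
    have h1 := congrArg (· ≫ seqInv H X Y Z) (inj_seqHom H X Y Z c d)
    simp only [Category.assoc] at h1
    rw [h1, inj_seqInv, Iso.hom_inv_id_assoc, Category.comp_id]
  inv_hom_id := right_tensor_hom_ext fun c d => by
    have h1 := congrArg (· ≫ seqHom H X Y Z) (inj_seqInv H X Y Z c d)
    simp only [Category.assoc] at h1
    rw [h1, inj_seqHom, Iso.inv_hom_id_assoc, Category.comp_id]

theorem seqIso_natural (H : SeqIndices φ₁ ψ₁ φ₂ ψ₂ φ₃ ψ₃ φ₄ ψ₄) {X X' : Coll C V I}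
    {Y Y' : Coll C V J} {Z Z' : Coll C V K} (α : X ⟶ X') (β : Y ⟶ Y') (γ : Z ⟶ Z') :
    (tensorAlong φ₂ ψ₂).map ((tensorAlong φ₁ ψ₁).map (α ×ₘ β) ×ₘ γ) ≫ (seqIso H X' Y' Z').hom =
      (seqIso H X Y Z).hom ≫
        (tensorAlong φ₄ ψ₄).map (α ×ₘ (tensorAlong φ₃ ψ₃).map (β ×ₘ γ)) :=
  left_tensor_hom_ext fun c d => by
    have h1 := congrArg (· ≫ (tensorAlong φ₄ ψ₄).map (α ×ₘ (tensorAlong φ₃ ψ₃).map (β ×ₘ γ)))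
      (inj_seqHom H X Y Z c d)
    simp only [Category.assoc] at h1
    show _ ≫ _ ≫ _ ≫ seqHom H X' Y' Z' = _ ≫ _ ≫ seqHom H X Y Z ≫ _
    have e1 : (summandNat φ₁ ψ₁ (α ×ₘ β) (𝟙 (op c)) (𝟙 c) ≫ inj φ₁ ψ₁ (X', Y') c ×ₘ γ) =
      (summandNat φ₁ ψ₁ (α ×ₘ β) (𝟙 (op c)) (𝟙 c) ×ₘ γ) ≫ (inj φ₁ ψ₁ (X', Y') c ×ₘ 𝟙 Z') :=
      Prod.ext rfl (Category.comp_id _).symm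
    have e2 : (α ×ₘ summandNat φ₃ ψ₃ (β ×ₘ γ) (𝟙 (op d)) (𝟙 d) ≫ inj φ₃ ψ₃ (Y', Z') d) =
      (α ×ₘ summandNat φ₃ ψ₃ (β ×ₘ γ) (𝟙 (op d)) (𝟙 d)) ≫ (𝟙 X' ×ₘ inj φ₃ ψ₃ (Y', Z') d) :=
      Prod.ext (Category.comp_id _).symm rfl
    rw [h1, inj_map_assoc, inj_map, summandNat_comp_assoc, summandNat_comp_assoc]
    simp only [prod_comp, Category.comp_id, Category.id_comp, inj_map]
    rw [e1, e2]
    have e3 := summandNat_comp_assoc φ₂ ψ₂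
      (summandNat φ₁ ψ₁ (α ×ₘ β) (𝟙 (op c)) (𝟙 c) ×ₘ γ) (inj φ₁ ψ₁ (X', Y') c ×ₘ 𝟙 Z')
      (𝟙 (op d)) (𝟙 (op d)) (𝟙 d) (𝟙 d) (inj φ₂ ψ₂ _ d ≫ seqHom H X' Y' Z')
    have e4 := summandNat_comp_assoc φ₄ ψ₄
      (α ×ₘ summandNat φ₃ ψ₃ (β ×ₘ γ) (𝟙 (op d)) (𝟙 d)) (𝟙 X' ×ₘ inj φ₃ ψ₃ (Y', Z') d)
      (𝟙 (op c)) (𝟙 (op c)) (𝟙 c) (𝟙 c) (inj φ₄ ψ₄ _ c)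
    simp only [Category.comp_id] at e3 e4
    rw [← e3, ← e4, inj_seqHom, seqSummandIso_natural_assoc]

end Sequential

section Parallel

/-- The relation between the index maps of the two sides of `(X ⊗ Y) ⊗ Z ≅ (X ⊗ Z) ⊗ Y`. -/
structure ParIndices {I J K L M R : Type} (φ₁ : I → Option L) (ψ₁ : J → L) (φ₂ : L → Option R)
    (ψ₂ : K → R) (φ₃ : I → Option M) (ψ₃ : K → M) (φ₄ : M → Option R) (ψ₄ : J → R) : Prop where
  fst (p : I) : (φ₁ p = none ∧ ∃ t, φ₃ p = some t ∧ φ₄ t = none) ∨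
    (φ₃ p = none ∧ ∃ t, φ₁ p = some t ∧ φ₂ t = none) ∨
    ∃ t s r, φ₁ p = some t ∧ φ₂ t = some r ∧ φ₃ p = some s ∧ φ₄ s = some r
  snd (q : J) : φ₂ (ψ₁ q) = some (ψ₄ q)
  trd (k : K) : φ₄ (ψ₃ k) = some (ψ₂ k)

variable {I J K L M R : Type} {φ₁ : I → Option L} {ψ₁ : J → L} {φ₂ : L → Option R}
    {ψ₂ : K → R} {φ₃ : I → Option M} {ψ₃ : K → M} {φ₄ : M → Option R} {ψ₄ : J → R}

theorem ParIndices.slot_fst (H : ParIndices φ₁ ψ₁ φ₂ ψ₂ φ₃ ψ₃ φ₄ ψ₄) (c d : Cᵒᵖ) (x : R → Cᵒᵖ)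
    (p : I) : slot c (fun q => slot d x (φ₂ q)) (φ₁ p) =
      slot d (fun q => slot c x (φ₄ q)) (φ₃ p) := by
  rcases H.fst p with ⟨h1, t, h2, h3⟩ | ⟨h1, t, h2, h3⟩ | ⟨t, s, r, h1, h2, h3, h4⟩
  · rw [h1, h2]
    show _ = slot c x (φ₄ t)
    rw [h3]; rfl
  · rw [h1, h2]
    show slot d x (φ₂ t) = _
    rw [h3]; rfl
  · rw [h1, h3]
    show slot d x (φ₂ t) = slot c x (φ₄ s)
    rw [h2, h4]; rfl

theorem ParIndices.slotMap_fst (H : ParIndices φ₁ ψ₁ φ₂ ψ₂ φ₃ ψ₃ φ₄ ψ₄) {c c' d d' : Cᵒᵖ}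
    {x x' : R → Cᵒᵖ} (f : c ⟶ c') (g : d ⟶ d') (r : x ⟶ x') (p : I) :
    slotMap f (fun q => slotMap g r (φ₂ q)) (φ₁ p) ≍
      slotMap g (fun q => slotMap f r (φ₄ q)) (φ₃ p) := by
  rcases H.fst p with ⟨h1, t, h2, h3⟩ | ⟨h1, t, h2, h3⟩ | ⟨t, s, r, h1, h2, h3, h4⟩
  · rw [h1, h2]
    show _ ≍ slotMap f _ (φ₄ t)
    rw [h3]; rfl
  · rw [h1, h2]
    show slotMap g _ (φ₂ t) ≍ _
    rw [h3]; rfl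
  · rw [h1, h3]
    show slotMap g _ (φ₂ t) ≍ slotMap f _ (φ₄ s)
    rw [h2, h4]; rfl

theorem slot_of_some {L : Type} (c : Cᵒᵖ) (x : L → Cᵒᵖ) {o : Option L} {q : L} (h : o = some q) :
    slot c x o = x q := by
  subst h; rfl

theorem slotMap_of_some {L : Type} {c c' : Cᵒᵖ} {x x' : L → Cᵒᵖ} (f : c ⟶ c')
    (g : ∀ q, x q ⟶ x' q) {o : Option L} {q : L} (h : o = some q) : slotMap f g o ≍ g q := by
  subst h; rfl

variable [SymmetricCategory V]

/-- The symmetry `(A₁ ⊗ A₂) ⊗ A₃ ≅ (A₁ ⊗ A₃) ⊗ A₂`. -/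
def swapIso (A₁ A₂ A₃ : V) : (A₁ ⊗ A₂) ⊗ A₃ ≅ (A₁ ⊗ A₃) ⊗ A₂ :=
  α_ A₁ A₂ A₃ ≪≫ whiskerLeftIso A₁ (β_ A₂ A₃) ≪≫ (α_ A₁ A₃ A₂).symm

theorem swap_square {A₁ A₂ A₃ B₁ B₂ B₃ A₁' A₂' A₃' B₁' B₂' B₃' : V}
    {x₁ : A₁ ⟶ B₁} {x₂ : A₂ ⟶ B₂} {x₃ : A₃ ⟶ B₃}
    {y₁ : A₁' ⟶ B₁'} {y₂ : A₂' ⟶ B₂'} {y₃ : A₃' ⟶ B₃'}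
    {s₁ : A₁ ⟶ A₁'} {s₂ : A₂ ⟶ A₂'} {s₃ : A₃ ⟶ A₃'} {t₁ : B₁ ⟶ B₁'} {t₂ : B₂ ⟶ B₂'}
    {t₃ : B₃ ⟶ B₃'} (h₁ : x₁ ≫ t₁ = s₁ ≫ y₁) (h₂ : x₂ ≫ t₂ = s₂ ≫ y₂)
    (h₃ : x₃ ≫ t₃ = s₃ ≫ y₃) :
    ((x₁ ⊗ₘ x₂) ⊗ₘ x₃) ≫ (swapIso B₁ B₂ B₃).hom ≫ ((t₁ ⊗ₘ t₃) ⊗ₘ t₂) =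
      ((swapIso A₁ A₂ A₃).hom ≫ ((s₁ ⊗ₘ s₃) ⊗ₘ s₂)) ≫ ((y₁ ⊗ₘ y₃) ⊗ₘ y₂) := by
  have e : ((x₁ ⊗ₘ x₂) ⊗ₘ x₃) ≫ (swapIso B₁ B₂ B₃).hom =
      (swapIso A₁ A₂ A₃).hom ≫ ((x₁ ⊗ₘ x₃) ⊗ₘ x₂) := by
    simp only [swapIso, Iso.trans_hom, whiskerLeftIso_hom, Iso.symm_hom, Category.assoc]
    rw [associator_naturality_assoc, ← id_tensorHom, tensorHom_comp_tensorHom_assoc,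
      BraidedCategory.braiding_naturality, Category.comp_id, ← associator_inv_naturality,
      ← id_tensorHom, tensorHom_comp_tensorHom_assoc, Category.id_comp]
  rw [← Category.assoc, e, Category.assoc, Category.assoc, tensorHom_comp_tensorHom,
    tensorHom_comp_tensorHom, tensorHom_comp_tensorHom, tensorHom_comp_tensorHom, h₁, h₂, h₃]

/-- The symmetry `(X(…) ⊗ Y(…)) ⊗ Z(…) ≅ (X(…) ⊗ Z(…)) ⊗ Y(…)` of `V`. -/
def parSummandApp (H : ParIndices φ₁ ψ₁ φ₂ ψ₂ φ₃ ψ₃ φ₄ ψ₄) (X : Coll C V I) (Y : Coll C V J)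
    (Z : Coll C V K) (c : Cᵒᵖ) (e : C) (d : Cᵒᵖ) (k : C) (z : Prof C R) :
    summandObj φ₂ ψ₂ (summandFunctor φ₁ ψ₁ (X, Y) c e, Z) d k z ≅
      summandObj φ₄ ψ₄ (summandFunctor φ₃ ψ₃ (X, Z) d k, Y) c e z :=
  swapIso _ _ _ ≪≫
    ((X.mapIso (profIso (a := (plug φ₁).obj (c, (plug φ₂).obj (d, z)))
        (b := (plug φ₃).obj (d, (plug φ₄).obj (c, z))) (fun p => H.slot_fst c d z.1 p) rfl) ⊗ᵢ
      Z.mapIso (profIso (a := (select ψ₂).obj (k, z))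
          (b := (select ψ₃).obj (k, (plug φ₄).obj (c, z)))
          (fun q => (slot_of_some c z.1 (H.trd q)).symm) rfl)) ⊗ᵢ
      Y.mapIso (profIso (a := (select ψ₁).obj (e, (plug φ₂).obj (d, z)))
          (b := (select ψ₄).obj (e, z)) (fun q => slot_of_some d z.1 (H.snd q)) rfl))

theorem parSummandApp_natural (H : ParIndices φ₁ ψ₁ φ₂ ψ₂ φ₃ ψ₃ φ₄ ψ₄) {X X' : Coll C V I}
    {Y Y' : Coll C V J} {Z Z' : Coll C V K} (α : X ⟶ X') (β : Y ⟶ Y') (γ : Z ⟶ Z')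
    {c c' : Cᵒᵖ} (f : c ⟶ c') {e e' : C} (j : e ⟶ e') {d d' : Cᵒᵖ} (g : d ⟶ d') {k k' : C}
    (i : k ⟶ k') {z z' : Prof C R} (r : z ⟶ z') :
    summandMap φ₂ ψ₂ (XY := (summandFunctor φ₁ ψ₁ (X, Y) c e, Z))
        (XY' := (summandFunctor φ₁ ψ₁ (X', Y') c' e', Z'))
        (summandNat φ₁ ψ₁ (α ×ₘ β) f j ×ₘ γ) g i r ≫
          (parSummandApp H X' Y' Z' c' e' d' k' z').hom =
      (parSummandApp H X Y Z c e d k z).hom ≫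
        summandMap φ₄ ψ₄ (XY := (summandFunctor φ₃ ψ₃ (X, Z) d k, Y))
        (XY' := (summandFunctor φ₃ ψ₃ (X', Z') d' k', Y'))
        (summandNat φ₃ ψ₃ (α ×ₘ γ) g i ×ₘ β) f j r := by
  have hX := map_profIso_natural α (a := (plug φ₁).obj (c, (plug φ₂).obj (d, z)))
    (b := (plug φ₁).obj (c', (plug φ₂).obj (d', z')))
    (a' := (plug φ₃).obj (d, (plug φ₄).obj (c, z)))
    (b' := (plug φ₃).obj (d', (plug φ₄).obj (c', z')))
    (ha := fun p => H.slot_fst c d z.1 p) (ha' := rfl)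
    (hb := fun p => H.slot_fst c' d' z'.1 p) (hb' := rfl)
    (f := (plug φ₁).map (Prod.mkHom f ((plug φ₂).map (Prod.mkHom g r))))
    (f' := (plug φ₃).map (Prod.mkHom g ((plug φ₄).map (Prod.mkHom f r))))
    (fun p => H.slotMap_fst f g r.1 p) HEq.rfl
  have hY := map_profIso_natural β (a := (select ψ₁).obj (e, (plug φ₂).obj (d, z)))
    (b := (select ψ₁).obj (e', (plug φ₂).obj (d', z')))
    (a' := (select ψ₄).obj (e, z)) (b' := (select ψ₄).obj (e', z'))
    (ha := fun q => slot_of_some d z.1 (H.snd q)) (ha' := rfl)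
    (hb := fun q => slot_of_some d' z'.1 (H.snd q)) (hb' := rfl)
    (f := (select ψ₁).map (Prod.mkHom j ((plug φ₂).map (Prod.mkHom g r))))
    (f' := (select ψ₄).map (Prod.mkHom j r))
    (fun q => slotMap_of_some g r.1 (H.snd q)) HEq.rfl
  have hZ := map_profIso_natural γ (a := (select ψ₂).obj (k, z))
    (b := (select ψ₂).obj (k', z'))
    (a' := (select ψ₃).obj (k, (plug φ₄).obj (c, z)))
    (b' := (select ψ₃).obj (k', (plug φ₄).obj (c', z')))
    (ha := fun q => (slot_of_some c z.1 (H.trd q)).symm) (ha' := rfl)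
    (hb := fun q => (slot_of_some c' z'.1 (H.trd q)).symm) (hb' := rfl)
    (f := (select ψ₂).map (Prod.mkHom i r))
    (f' := (select ψ₃).map (Prod.mkHom i ((plug φ₄).map (Prod.mkHom f r))))
    (fun q => (slotMap_of_some f r.1 (H.trd q)).symm) HEq.rfl
  have e1 := map_summandNat_app φ₁ ψ₁ (XY := (X, Y)) (XY' := (X', Y')) (α ×ₘ β) f j
    ((plug φ₂).map (Prod.mkHom g r))
  have e2 := map_summandNat_app φ₃ ψ₃ (XY := (X, Z)) (XY' := (X', Z')) (α ×ₘ γ) g i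
    ((plug φ₄).map (Prod.mkHom f r))
  exact (congrArg (· ≫ (parSummandApp H X' Y' Z' c' e' d' k' z').hom)
    (congrArg (· ⊗ₘ (Z.map ((select ψ₂).map (Prod.mkHom i r)) ≫ γ.app _)) e1)).trans
    ((swap_square hX hY hZ).trans (congrArg ((parSummandApp H X Y Z c e d k z).hom ≫ ·)
      (congrArg (· ⊗ₘ (Y.map ((select ψ₄).map (Prod.mkHom j r)) ≫ β.app _)) e2.symm)))

/-- The previous isomorphism as an isomorphism of functors. -/
def parSummandIso (H : ParIndices φ₁ ψ₁ φ₂ ψ₂ φ₃ ψ₃ φ₄ ψ₄) (X : Coll C V I) (Y : Coll C V J)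
    (Z : Coll C V K) (c : Cᵒᵖ) (e : C) (d : Cᵒᵖ) (k : C) :
    summandFunctor φ₂ ψ₂ (summandFunctor φ₁ ψ₁ (X, Y) c e, Z) d k ≅
      summandFunctor φ₄ ψ₄ (summandFunctor φ₃ ψ₃ (X, Z) d k, Y) c e :=
  NatIso.ofComponents (fun z => parSummandApp H X Y Z c e d k z) (fun {z z'} r => by
    have := parSummandApp_natural H (𝟙 X) (𝟙 Y) (𝟙 Z) (𝟙 c) (𝟙 e) (𝟙 d) (𝟙 k) r
    have e1 : summandNat φ₁ ψ₁ (𝟙 X ×ₘ 𝟙 Y) (𝟙 c) (𝟙 e) = 𝟙 _ := summandNat_id φ₁ ψ₁ (X, Y) c e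
    have e2 : summandNat φ₃ ψ₃ (𝟙 X ×ₘ 𝟙 Z) (𝟙 d) (𝟙 k) = 𝟙 _ := summandNat_id φ₃ ψ₃ (X, Z) d k
    rw [e1, e2] at this
    exact this)

theorem parSummandIso_natural_assoc (H : ParIndices φ₁ ψ₁ φ₂ ψ₂ φ₃ ψ₃ φ₄ ψ₄) {X X' : Coll C V I}
    {Y Y' : Coll C V J} {Z Z' : Coll C V K} (α : X ⟶ X') (β : Y ⟶ Y') (γ : Z ⟶ Z')
    {c c' : Cᵒᵖ} (f : c ⟶ c') {e e' : C} (j : e ⟶ e') {d d' : Cᵒᵖ} (g : d ⟶ d') {k k' : C}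
    (i : k ⟶ k') {T : Coll C V R}
    (t : summandFunctor φ₄ ψ₄ (summandFunctor φ₃ ψ₃ (X', Z') d' k', Y') c' e' ⟶ T) :
    summandNat φ₂ ψ₂ (summandNat φ₁ ψ₁ (α ×ₘ β) f j ×ₘ γ) g i ≫
        (parSummandIso H X' Y' Z' c' e' d' k').hom ≫ t =
      (parSummandIso H X Y Z c e d k).hom ≫
        summandNat φ₄ ψ₄ (summandNat φ₃ ψ₃ (α ×ₘ γ) g i ×ₘ β) f j ≫ t := by
  have : summandNat φ₂ ψ₂ (summandNat φ₁ ψ₁ (α ×ₘ β) f j ×ₘ γ) g i ≫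
        (parSummandIso H X' Y' Z' c' e' d' k').hom =
      (parSummandIso H X Y Z c e d k).hom ≫
        summandNat φ₄ ψ₄ (summandNat φ₃ ψ₃ (α ×ₘ γ) g i ×ₘ β) f j :=
    NatTrans.ext (funext fun z => parSummandApp_natural H α β γ f j g i (𝟙 z))
  rw [← Category.assoc, this, Category.assoc]

theorem parSummandIso_inv_natural_assoc (H : ParIndices φ₁ ψ₁ φ₂ ψ₂ φ₃ ψ₃ φ₄ ψ₄)
    {X X' : Coll C V I}
    {Y Y' : Coll C V J} {Z Z' : Coll C V K} (α : X ⟶ X') (β : Y ⟶ Y') (γ : Z ⟶ Z')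
    {c c' : Cᵒᵖ} (f : c ⟶ c') {e e' : C} (j : e ⟶ e') {d d' : Cᵒᵖ} (g : d ⟶ d') {k k' : C}
    (i : k ⟶ k') {T : Coll C V R}
    (t : summandFunctor φ₂ ψ₂ (summandFunctor φ₁ ψ₁ (X', Y') c' e', Z') d' k' ⟶ T) :
    summandNat φ₄ ψ₄ (summandNat φ₃ ψ₃ (α ×ₘ γ) g i ×ₘ β) f j ≫
        (parSummandIso H X' Y' Z' c' e' d' k').inv ≫ t =
      (parSummandIso H X Y Z c e d k).inv ≫
        summandNat φ₂ ψ₂ (summandNat φ₁ ψ₁ (α ×ₘ β) f j ×ₘ γ) g i ≫ t := by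
  rw [Iso.eq_inv_comp, ← parSummandIso_natural_assoc, Iso.hom_inv_id_assoc]

variable [MonoidalClosed V]

/-- The morphism of iterated coends that is the symmetry of `V` on the summands. -/
noncomputable def parHom (H : ParIndices φ₁ ψ₁ φ₂ ψ₂ φ₃ ψ₃ φ₄ ψ₄) (X : Coll C V I)
    (Y : Coll C V J) (Z : Coll C V K) :
    (tensorAlong φ₂ ψ₂).obj ((tensorAlong φ₁ ψ₁).obj (X, Y), Z) ⟶
      (tensorAlong φ₄ ψ₄).obj ((tensorAlong φ₃ ψ₃).obj (X, Z), Y) :=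
  tensorDesc φ₂ ψ₂ _ (fun d => leftDesc φ₁ ψ₁ φ₂ ψ₂ (X, Y) Z (op d) d
    (fun c => (parSummandIso H X Y Z (op c) c (op d) d).hom ≫
      summandNat φ₄ ψ₄ (inj φ₃ ψ₃ (X, Z) d ×ₘ 𝟙 Y) (𝟙 (op c)) (𝟙 c) ≫ inj φ₄ ψ₄ _ c)
    (fun c c' f => by
      rw [← prod_id_eq X Y, parSummandIso_natural_assoc, parSummandIso_natural_assoc]
      rw [summandNat_comp_assoc, summandNat_comp_assoc]
      simp only [Category.comp_id, inj_dinatural_map]))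
    (fun d d' f => by
      refine left_hom_ext _ _ _ _ fun c => ?_
      rw [summandNat_exchange, summandNat_exchange, inj_leftDesc, inj_leftDesc,
        summandNat_id_left φ₁ ψ₁ X Y Z, parSummandIso_natural_assoc, parSummandIso_natural_assoc,
        summandNat_comp_assoc, summandNat_comp_assoc]
      simp only [prod_comp, prod_id_eq X, Category.comp_id, inj_dinatural_map])

theorem inj_parHom (H : ParIndices φ₁ ψ₁ φ₂ ψ₂ φ₃ ψ₃ φ₄ ψ₄) (X : Coll C V I)
    (Y : Coll C V J) (Z : Coll C V K) (c d : C) :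
    summandNat φ₂ ψ₂ (inj φ₁ ψ₁ (X, Y) c ×ₘ 𝟙 Z) (𝟙 (op d)) (𝟙 d) ≫ inj φ₂ ψ₂ _ d ≫
      parHom H X Y Z = (parSummandIso H X Y Z (op c) c (op d) d).hom ≫
      summandNat φ₄ ψ₄ (inj φ₃ ψ₃ (X, Z) d ×ₘ 𝟙 Y) (𝟙 (op c)) (𝟙 c) ≫ inj φ₄ ψ₄ _ c :=
  (congrArg (_ ≫ ·) (inj_tensorDesc φ₂ ψ₂ _ _ _ d)).trans
    (inj_leftDesc φ₁ ψ₁ φ₂ ψ₂ _ _ _ _ _ _ c)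

/-- Its inverse. -/
noncomputable def parInv (H : ParIndices φ₁ ψ₁ φ₂ ψ₂ φ₃ ψ₃ φ₄ ψ₄) (X : Coll C V I)
    (Y : Coll C V J) (Z : Coll C V K) :
    (tensorAlong φ₄ ψ₄).obj ((tensorAlong φ₃ ψ₃).obj (X, Z), Y) ⟶
      (tensorAlong φ₂ ψ₂).obj ((tensorAlong φ₁ ψ₁).obj (X, Y), Z) :=
  tensorDesc φ₄ ψ₄ _ (fun c => leftDesc φ₃ ψ₃ φ₄ ψ₄ (X, Z) Y (op c) c
    (fun d => (parSummandIso H X Y Z (op c) c (op d) d).inv ≫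
      summandNat φ₂ ψ₂ (inj φ₁ ψ₁ (X, Y) c ×ₘ 𝟙 Z) (𝟙 (op d)) (𝟙 d) ≫ inj φ₂ ψ₂ _ d)
    (fun d d' f => by
      rw [← prod_id_eq X Z, parSummandIso_inv_natural_assoc, parSummandIso_inv_natural_assoc]
      rw [summandNat_comp_assoc, summandNat_comp_assoc]
      simp only [Category.comp_id, inj_dinatural_map]))
    (fun c c' f => by
      refine left_hom_ext _ _ _ _ fun d => ?_
      rw [summandNat_exchange, summandNat_exchange, inj_leftDesc, inj_leftDesc,
        summandNat_id_left φ₃ ψ₃ X Z Y, parSummandIso_inv_natural_assoc,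
        parSummandIso_inv_natural_assoc, summandNat_comp_assoc, summandNat_comp_assoc]
      simp only [prod_comp, prod_id_eq X, Category.comp_id, inj_dinatural_map])

theorem inj_parInv (H : ParIndices φ₁ ψ₁ φ₂ ψ₂ φ₃ ψ₃ φ₄ ψ₄) (X : Coll C V I)
    (Y : Coll C V J) (Z : Coll C V K) (c d : C) :
    summandNat φ₄ ψ₄ (inj φ₃ ψ₃ (X, Z) d ×ₘ 𝟙 Y) (𝟙 (op c)) (𝟙 c) ≫ inj φ₄ ψ₄ _ c ≫
      parInv H X Y Z = (parSummandIso H X Y Z (op c) c (op d) d).inv ≫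
      summandNat φ₂ ψ₂ (inj φ₁ ψ₁ (X, Y) c ×ₘ 𝟙 Z) (𝟙 (op d)) (𝟙 d) ≫ inj φ₂ ψ₂ _ d :=
  (congrArg (_ ≫ ·) (inj_tensorDesc φ₄ ψ₄ _ _ _ c)).trans
    (inj_leftDesc φ₃ ψ₃ φ₄ ψ₄ _ _ _ _ _ _ d)

/-- The canonical isomorphism `(X ⊗ Y) ⊗ Z ≅ (X ⊗ Z) ⊗ Y` for `Y` and `Z` at different inputs of
`X`. -/
noncomputable def parIso (H : ParIndices φ₁ ψ₁ φ₂ ψ₂ φ₃ ψ₃ φ₄ ψ₄) (X : Coll C V I)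
    (Y : Coll C V J) (Z : Coll C V K) :
    (tensorAlong φ₂ ψ₂).obj ((tensorAlong φ₁ ψ₁).obj (X, Y), Z) ≅
      (tensorAlong φ₄ ψ₄).obj ((tensorAlong φ₃ ψ₃).obj (X, Z), Y) where
  hom := parHom H X Y Z
  inv := parInv H X Y Z
  hom_inv_id := left_tensor_hom_ext fun c d => by
    have h1 := congrArg (· ≫ parInv H X Y Z) (inj_parHom H X Y Z c d)
    simp only [Category.assoc] at h1
    rw [h1, inj_parInv, Iso.hom_inv_id_assoc, Category.comp_id]
  inv_hom_id := left_tensor_hom_ext fun d c => by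
    have h1 := congrArg (· ≫ parHom H X Y Z) (inj_parInv H X Y Z c d)
    simp only [Category.assoc] at h1
    rw [h1, inj_parHom, Iso.inv_hom_id_assoc, Category.comp_id]

theorem parIso_natural (H : ParIndices φ₁ ψ₁ φ₂ ψ₂ φ₃ ψ₃ φ₄ ψ₄) {X X' : Coll C V I}
    {Y Y' : Coll C V J} {Z Z' : Coll C V K} (α : X ⟶ X') (β : Y ⟶ Y') (γ : Z ⟶ Z') :
    (tensorAlong φ₂ ψ₂).map ((tensorAlong φ₁ ψ₁).map (α ×ₘ β) ×ₘ γ) ≫ (parIso H X' Y' Z').hom =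
      (parIso H X Y Z).hom ≫
        (tensorAlong φ₄ ψ₄).map ((tensorAlong φ₃ ψ₃).map (α ×ₘ γ) ×ₘ β) :=
  left_tensor_hom_ext fun c d => by
    have h1 := congrArg (· ≫ (tensorAlong φ₄ ψ₄).map ((tensorAlong φ₃ ψ₃).map (α ×ₘ γ) ×ₘ β))
      (inj_parHom H X Y Z c d)
    simp only [Category.assoc] at h1
    show _ ≫ _ ≫ _ ≫ parHom H X' Y' Z' = _ ≫ _ ≫ parHom H X Y Z ≫ _
    have e1 : (summandNat φ₁ ψ₁ (α ×ₘ β) (𝟙 (op c)) (𝟙 c) ≫ inj φ₁ ψ₁ (X', Y') c ×ₘ γ) =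
      (summandNat φ₁ ψ₁ (α ×ₘ β) (𝟙 (op c)) (𝟙 c) ×ₘ γ) ≫ (inj φ₁ ψ₁ (X', Y') c ×ₘ 𝟙 Z') :=
      Prod.ext rfl (Category.comp_id _).symm
    have e2 : (summandNat φ₃ ψ₃ (α ×ₘ γ) (𝟙 (op d)) (𝟙 d) ≫ inj φ₃ ψ₃ (X', Z') d ×ₘ β) =
      (summandNat φ₃ ψ₃ (α ×ₘ γ) (𝟙 (op d)) (𝟙 d) ×ₘ β) ≫ (inj φ₃ ψ₃ (X', Z') d ×ₘ 𝟙 Y') :=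
      Prod.ext rfl (Category.comp_id _).symm
    rw [h1, inj_map_assoc, inj_map, summandNat_comp_assoc, summandNat_comp_assoc]
    simp only [prod_comp, Category.comp_id, Category.id_comp, inj_map]
    rw [e1, e2]
    have e3 := summandNat_comp_assoc φ₂ ψ₂
      (summandNat φ₁ ψ₁ (α ×ₘ β) (𝟙 (op c)) (𝟙 c) ×ₘ γ) (inj φ₁ ψ₁ (X', Y') c ×ₘ 𝟙 Z')
      (𝟙 (op d)) (𝟙 (op d)) (𝟙 d) (𝟙 d) (inj φ₂ ψ₂ _ d ≫ parHom H X' Y' Z')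
    have e4 := summandNat_comp_assoc φ₄ ψ₄
      (summandNat φ₃ ψ₃ (α ×ₘ γ) (𝟙 (op d)) (𝟙 d) ×ₘ β) (inj φ₃ ψ₃ (X', Z') d ×ₘ 𝟙 Y')
      (𝟙 (op c)) (𝟙 (op c)) (𝟙 c) (𝟙 c) (inj φ₄ ψ₄ _ c)
    simp only [Category.comp_id] at e3 e4
    rw [← e3, ← e4, inj_parHom, parSummandIso_natural_assoc]

end Parallel

section Equivariance

/-- `(x; y) ↦ (x ∘ s; y)` -/
def reindex {I J : Type} (s : I → J) : Prof C J ⥤ Prof C I where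
  obj z := (fun p => z.1 (s p), z.2)
  map f := (fun p => f.1 (s p), f.2)

/-- `X ↦ ((x; y) ↦ X(x ∘ s; y))`; for a permutation `σ` of `Fin n` this is
`σ(X)(x₁ … xₙ; y) = X(x_{σ(1)} … x_{σ(n)}; y)`. -/
def actAlong {I J : Type} (s : I → J) : Coll C V I ⥤ Coll C V J :=
  (Functor.whiskeringLeft _ _ V).obj (reindex s)

/-- The relation between the index maps of the two sides of `s(X) ⊗ t(Y) ≅ π(X ⊗ Y)`. -/
structure EqvIndices {I J L : Type} (s : I → I) (t : J → J) (π : L → L) (φ : I → Option L)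
    (ψ : J → L) (φ' : I → Option L) (ψ' : J → L) : Prop where
  fst (p : I) : φ' (s p) = (φ p).map π
  snd (q : J) : ψ' (t q) = π (ψ q)

variable {I J L : Type} {s : I → I} {t : J → J} {π : L → L} {φ : I → Option L}
    {ψ : J → L} {φ' : I → Option L} {ψ' : J → L}

theorem EqvIndices.slot_fst (H : EqvIndices s t π φ ψ φ' ψ') (c : Cᵒᵖ) (x : L → Cᵒᵖ) (p : I) :
    slot c x (φ' (s p)) = slot c (fun q => x (π q)) (φ p) := by
  rw [H.fst p]; cases φ p <;> rfl

theorem EqvIndices.slotMap_fst (H : EqvIndices s t π φ ψ φ' ψ') {c c' : Cᵒᵖ} {x x' : L → Cᵒᵖ}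
    (f : c ⟶ c') (r : x ⟶ x') (p : I) :
    slotMap f r (φ' (s p)) ≍ slotMap f (fun q => r (π q)) (φ p) := by
  rw [H.fst p]; cases φ p <;> rfl

/-- Both sides are `X(…) ⊗ Y(…)` with equal arguments. -/
def eqvSummandApp (H : EqvIndices s t π φ ψ φ' ψ') (X : Coll C V I) (Y : Coll C V J)
    (c : Cᵒᵖ) (e : C) (z : Prof C L) :
    summandObj φ' ψ' ((actAlong s).obj X, (actAlong t).obj Y) c e z ≅
      summandObj φ ψ (X, Y) c e ((reindex π).obj z) :=
  X.mapIso (profIso (a := (reindex s).obj ((plug φ').obj (c, z)))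
      (b := (plug φ).obj (c, (reindex π).obj z)) (fun p => H.slot_fst c z.1 p) rfl) ⊗ᵢ
    Y.mapIso (profIso (a := (reindex t).obj ((select ψ').obj (e, z)))
      (b := (select ψ).obj (e, (reindex π).obj z)) (fun q => congrArg z.1 (H.snd q)) rfl)

theorem tensor_square {A₁ A₂ B₁ B₂ A₁' A₂' B₁' B₂' : V} {x₁ : A₁ ⟶ B₁} {x₂ : A₂ ⟶ B₂}
    {y₁ : A₁' ⟶ B₁'} {y₂ : A₂' ⟶ B₂'} {s₁ : A₁ ⟶ A₁'} {s₂ : A₂ ⟶ A₂'} {t₁ : B₁ ⟶ B₁'}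
    {t₂ : B₂ ⟶ B₂'} (h₁ : x₁ ≫ t₁ = s₁ ≫ y₁) (h₂ : x₂ ≫ t₂ = s₂ ≫ y₂) :
    (x₁ ⊗ₘ x₂) ≫ (t₁ ⊗ₘ t₂) = (s₁ ⊗ₘ s₂) ≫ (y₁ ⊗ₘ y₂) := by
  rw [tensorHom_comp_tensorHom, tensorHom_comp_tensorHom, h₁, h₂]

theorem eqvSummandApp_natural (H : EqvIndices s t π φ ψ φ' ψ') {X X' : Coll C V I}
    {Y Y' : Coll C V J} (α : X ⟶ X') (β : Y ⟶ Y') {c c' : Cᵒᵖ} (f : c ⟶ c') {e e' : C}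
    (j : e ⟶ e') {z z' : Prof C L} (r : z ⟶ z') :
    summandMap φ' ψ' ((actAlong s).map α ×ₘ (actAlong t).map β) f j r ≫
        (eqvSummandApp H X' Y' c' e' z').hom =
      (eqvSummandApp H X Y c e z).hom ≫ summandMap φ ψ (α ×ₘ β) f j ((reindex π).map r) :=
  tensor_square
    (map_profIso_natural α (a := (reindex s).obj ((plug φ').obj (c, z)))
      (b := (reindex s).obj ((plug φ').obj (c', z')))
      (a' := (plug φ).obj (c, (reindex π).obj z)) (b' := (plug φ).obj (c', (reindex π).obj z'))
      (ha := fun p => H.slot_fst c z.1 p) (ha' := rfl)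
      (hb := fun p => H.slot_fst c' z'.1 p) (hb' := rfl)
      (f := (reindex s).map ((plug φ').map (Prod.mkHom f r)))
      (f' := (plug φ).map (Prod.mkHom f ((reindex π).map r)))
      (fun p => H.slotMap_fst f r.1 p) HEq.rfl)
    (map_profIso_natural β (a := (reindex t).obj ((select ψ').obj (e, z)))
      (b := (reindex t).obj ((select ψ').obj (e', z')))
      (a' := (select ψ).obj (e, (reindex π).obj z))
      (b' := (select ψ).obj (e', (reindex π).obj z'))
      (ha := fun q => congrArg z.1 (H.snd q)) (ha' := rfl)
      (hb := fun q => congrArg z'.1 (H.snd q)) (hb' := rfl)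
      (f := (reindex t).map ((select ψ').map (Prod.mkHom j r)))
      (f' := (select ψ).map (Prod.mkHom j ((reindex π).map r)))
      (fun q => by
        show r.1 (ψ' (t q)) ≍ r.1 (π (ψ q))
        rw [H.snd q]) HEq.rfl)

/-- The previous isomorphism as an isomorphism of functors. -/
def eqvSummandIso (H : EqvIndices s t π φ ψ φ' ψ') (X : Coll C V I) (Y : Coll C V J)
    (c : Cᵒᵖ) (e : C) :
    summandFunctor φ' ψ' ((actAlong s).obj X, (actAlong t).obj Y) c e ≅
      (actAlong π).obj (summandFunctor φ ψ (X, Y) c e) :=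
  NatIso.ofComponents (fun z => eqvSummandApp H X Y c e z)
    (fun r => eqvSummandApp_natural H (𝟙 X) (𝟙 Y) (𝟙 c) (𝟙 e) r)

theorem eqvSummandIso_natural_assoc (H : EqvIndices s t π φ ψ φ' ψ') {X X' : Coll C V I}
    {Y Y' : Coll C V J} (α : X ⟶ X') (β : Y ⟶ Y') {c c' : Cᵒᵖ} (f : c ⟶ c') {e e' : C}
    (j : e ⟶ e') {T : Coll C V L}
    (a : (actAlong π).obj (summandFunctor φ ψ (X', Y') c' e') ⟶ T) :
    summandNat φ' ψ' ((actAlong s).map α ×ₘ (actAlong t).map β) f j ≫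
        (eqvSummandIso H X' Y' c' e').hom ≫ a =
      (eqvSummandIso H X Y c e).hom ≫ (actAlong π).map (summandNat φ ψ (α ×ₘ β) f j) ≫ a := by
  have : summandNat φ' ψ' ((actAlong s).map α ×ₘ (actAlong t).map β) f j ≫
        (eqvSummandIso H X' Y' c' e').hom =
      (eqvSummandIso H X Y c e).hom ≫ (actAlong π).map (summandNat φ ψ (α ×ₘ β) f j) :=
    NatTrans.ext (funext fun z => eqvSummandApp_natural H α β f j (𝟙 z))
  rw [← Category.assoc, this, Category.assoc]

theorem eqvSummandIso_inv_natural_assoc (H : EqvIndices s t π φ ψ φ' ψ') {X X' : Coll C V I}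
    {Y Y' : Coll C V J} (α : X ⟶ X') (β : Y ⟶ Y') {c c' : Cᵒᵖ} (f : c ⟶ c') {e e' : C}
    (j : e ⟶ e') {T : Coll C V L}
    (a : summandFunctor φ' ψ' ((actAlong s).obj X', (actAlong t).obj Y') c' e' ⟶ T) :
    (actAlong π).map (summandNat φ ψ (α ×ₘ β) f j) ≫ (eqvSummandIso H X' Y' c' e').inv ≫ a =
      (eqvSummandIso H X Y c e).inv ≫
        summandNat φ' ψ' ((actAlong s).map α ×ₘ (actAlong t).map β) f j ≫ a := by
  rw [Iso.eq_inv_comp, ← eqvSummandIso_natural_assoc, Iso.hom_inv_id_assoc]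

instance actAlong_preserves (π : L → L) :
    PreservesColimitsOfSize.{w, w} (actAlong (C := C) (V := V) π) := by
  refine preservesColimits_of_evaluation _ fun z => ?_
  have : PreservesColimitsOfSize.{w, w} ((evaluation (Prof C L) V).obj ((reindex π).obj z)) :=
    ⟨fun {_} _ => inferInstance⟩
  exact this

/-- The morphism of coends that is the previous isomorphism on the summands. -/
noncomputable def eqvHom (H : EqvIndices s t π φ ψ φ' ψ') (X : Coll C V I) (Y : Coll C V J) :
    (tensorAlong φ' ψ').obj ((actAlong s).obj X, (actAlong t).obj Y) ⟶
      (actAlong π).obj ((tensorAlong φ ψ).obj (X, Y)) :=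
  tensorDesc φ' ψ' _
    (fun c => (eqvSummandIso H X Y (op c) c).hom ≫ (actAlong π).map (inj φ ψ (X, Y) c))
    (fun c c' f => by
      have e : 𝟙 ((actAlong s).obj X, (actAlong t).obj Y) =
        ((actAlong s).map (𝟙 X) ×ₘ (actAlong t).map (𝟙 Y)) := rfl
      rw [e, eqvSummandIso_natural_assoc, eqvSummandIso_natural_assoc,
        ← CategoryTheory.Functor.map_comp, ← CategoryTheory.Functor.map_comp, inj_dinatural_map])

theorem inj_eqvHom (H : EqvIndices s t π φ ψ φ' ψ') (X : Coll C V I) (Y : Coll C V J) (c : C) :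
    inj φ' ψ' _ c ≫ eqvHom H X Y =
      (eqvSummandIso H X Y (op c) c).hom ≫ (actAlong π).map (inj φ ψ (X, Y) c) :=
  inj_tensorDesc φ' ψ' _ _ _ c

/-- Its inverse. -/
noncomputable def eqvInv (H : EqvIndices s t π φ ψ φ' ψ') (X : Coll C V I) (Y : Coll C V J) :
    (actAlong π).obj ((tensorAlong φ ψ).obj (X, Y)) ⟶
      (tensorAlong φ' ψ').obj ((actAlong s).obj X, (actAlong t).obj Y) :=
  coendDescOf (actAlong π) ((summand φ ψ).obj (X, Y))
    (fun c => (eqvSummandIso H X Y (op c) c).inv ≫ inj φ' ψ' _ c)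
    (fun c c' f => by
      refine (eqvSummandIso_inv_natural_assoc H (𝟙 X) (𝟙 Y) f.op (𝟙 c) _).trans (Eq.trans ?_
        (eqvSummandIso_inv_natural_assoc H (𝟙 X) (𝟙 Y) (𝟙 (op c')) f _).symm)
      rw [inj_dinatural_map])

theorem inj_eqvInv (H : EqvIndices s t π φ ψ φ' ψ') (X : Coll C V I) (Y : Coll C V J) (c : C) :
    (actAlong π).map (inj φ ψ (X, Y) c) ≫ eqvInv H X Y =
      (eqvSummandIso H X Y (op c) c).inv ≫ inj φ' ψ' _ c :=
  map_ι_coendDescOf (actAlong π) ((summand φ ψ).obj (X, Y)) _ _ c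

/-- The canonical isomorphism `σ(X) ⊗_{σ(i)} τ(Y) ≅ (σ ∘_i τ)(X ⊗_i Y)`. -/
noncomputable def eqvIso (H : EqvIndices s t π φ ψ φ' ψ') (X : Coll C V I) (Y : Coll C V J) :
    (tensorAlong φ' ψ').obj ((actAlong s).obj X, (actAlong t).obj Y) ≅
      (actAlong π).obj ((tensorAlong φ ψ).obj (X, Y)) where
  hom := eqvHom H X Y
  inv := eqvInv H X Y
  hom_inv_id := tensor_hom_ext _ _ fun c => by
    rw [← Category.assoc, inj_eqvHom, Category.assoc, inj_eqvInv, Iso.hom_inv_id_assoc,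
      Category.comp_id]
  inv_hom_id := coend_map_hom_ext (actAlong π) ((summand φ ψ).obj (X, Y)) fun c => by
    refine (Category.assoc _ _ _).symm.trans ?_
    refine (congrArg (· ≫ eqvHom H X Y) (inj_eqvInv H X Y c)).trans ?_
    refine Eq.trans ?_ (Category.comp_id _).symm
    rw [Category.assoc, inj_eqvHom, Iso.inv_hom_id_assoc]
    rfl

theorem eqvIso_natural (H : EqvIndices s t π φ ψ φ' ψ') {X X' : Coll C V I}
    {Y Y' : Coll C V J} (α : X ⟶ X') (β : Y ⟶ Y') :
    (tensorAlong φ' ψ').map ((actAlong s).map α ×ₘ (actAlong t).map β) ≫ (eqvIso H X' Y').hom =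
      (eqvIso H X Y).hom ≫ (actAlong π).map ((tensorAlong φ ψ).map (α ×ₘ β)) :=
  tensor_hom_ext _ _ fun c => by
    show _ ≫ _ ≫ eqvHom H X' Y' = _ ≫ eqvHom H X Y ≫ _
    have h := congrArg (· ≫ (actAlong π).map ((tensorAlong φ ψ).map (α ×ₘ β)))
      (inj_eqvHom H X Y c)
    simp only [Category.assoc] at h
    rw [h, inj_map_assoc, inj_eqvHom, eqvSummandIso_natural_assoc,
      ← CategoryTheory.Functor.map_comp, ← CategoryTheory.Functor.map_comp, inj_map]

end Equivariance

section Units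

variable (C V) in
/-- The unit `U`, with `U(a; b) = C(a, b) · I`, the coproduct of copies of the unit object of `V`
indexed by the set of morphisms `a ⟶ b`. -/
noncomputable def unitColl : Coll C V (Fin 1) where
  obj z := ∐ fun _ : ((z.1 0).unop ⟶ z.2) => 𝟙_ V
  map {z z'} r := Sigma.desc fun f : ((z.1 0).unop ⟶ z.2) =>
    Sigma.ι (fun _ : ((z'.1 0).unop ⟶ z'.2) => 𝟙_ V) ((r.1 0).unop ≫ f ≫ r.2)
  map_id z := by
    refine Sigma.hom_ext _ _ fun f => ?_
    rw [Sigma.ι_desc]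
    simp
  map_comp r r' := by
    refine Sigma.hom_ext _ _ fun f => ?_
    rw [Sigma.ι_desc, Sigma.ι_desc_assoc, Sigma.ι_desc]
    simp

theorem unitColl_ι_map {z z' : Prof C (Fin 1)} (r : z ⟶ z') (f : (z.1 0).unop ⟶ z.2) :
    Sigma.ι (fun _ : ((z.1 0).unop ⟶ z.2) => 𝟙_ V) f ≫ (unitColl C V).map r =
      Sigma.ι (fun _ : ((z'.1 0).unop ⟶ z'.2) => 𝟙_ V) ((r.1 0).unop ≫ f ≫ r.2) :=
  Sigma.ι_desc _ _

section Copower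

variable [SymmetricCategory V] [MonoidalClosed V] {B : Type w} {A T : V}

/-- The morphism from `A ⊗ (B · I)`, a coproduct of copies of `A`, with given components. -/
noncomputable def copowerDesc (g : B → (A ⟶ T)) : A ⊗ (∐ fun _ : B => 𝟙_ V) ⟶ T :=
  MonoidalClosed.uncurry (Sigma.desc fun b => MonoidalClosed.curry ((ρ_ A).hom ≫ g b))

theorem ι_copowerDesc (g : B → (A ⟶ T)) (b : B) :
    A ◁ Sigma.ι (fun _ : B => 𝟙_ V) b ≫ copowerDesc g = (ρ_ A).hom ≫ g b := by
  rw [copowerDesc, ← MonoidalClosed.uncurry_natural_left, Sigma.ι_desc,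
    MonoidalClosed.uncurry_curry]

theorem copower_hom_ext {f g : A ⊗ (∐ fun _ : B => 𝟙_ V) ⟶ T}
    (h : ∀ b, A ◁ Sigma.ι (fun _ : B => 𝟙_ V) b ≫ f = A ◁ Sigma.ι (fun _ : B => 𝟙_ V) b ≫ g) :
    f = g := by
  apply MonoidalClosed.curry_injective
  refine Sigma.hom_ext _ _ fun b => ?_
  rw [← MonoidalClosed.curry_natural_left, ← MonoidalClosed.curry_natural_left, h b]

/-- The same for `(B · I) ⊗ A`. -/
noncomputable def copowerDescLeft (g : B → (A ⟶ T)) : (∐ fun _ : B => 𝟙_ V) ⊗ A ⟶ T :=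
  (β_ _ A).hom ≫ copowerDesc g

theorem ι_copowerDescLeft (g : B → (A ⟶ T)) (b : B) :
    Sigma.ι (fun _ : B => 𝟙_ V) b ▷ A ≫ copowerDescLeft g = (λ_ A).hom ≫ g b := by
  rw [copowerDescLeft, BraidedCategory.braiding_naturality_left_assoc, ι_copowerDesc,
    braiding_rightUnitor_assoc]

theorem copower_hom_ext_left {f g : (∐ fun _ : B => 𝟙_ V) ⊗ A ⟶ T}
    (h : ∀ b, Sigma.ι (fun _ : B => 𝟙_ V) b ▷ A ≫ f = Sigma.ι (fun _ : B => 𝟙_ V) b ▷ A ≫ g) :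
    f = g := by
  rw [← cancel_epi (β_ A _).hom]
  refine copower_hom_ext fun b => ?_
  rw [BraidedCategory.braiding_naturality_right_assoc,
    BraidedCategory.braiding_naturality_right_assoc, h b]

end Copower

/-- The structure morphism of the coend `X ⊗_i Y` at `c`, in the component at `z`. -/
noncomputable def injApp {I J L : Type} (φ : I → Option L) (ψ : J → L)
    (XY : Coll C V I × Coll C V J) (c : C) (z : Prof C L) :
    summandObj φ ψ XY (op c) c z ⟶ ((tensorAlong φ ψ).obj XY).obj z :=
  (inj φ ψ XY c).app z

theorem tensor_app_hom_ext {I J L : Type} (φ : I → Option L) (ψ : J → L)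
    {XY : Coll C V I × Coll C V J} {z : Prof C L} {T : V}
    {f g : ((tensorAlong φ ψ).obj XY).obj z ⟶ T}
    (h : ∀ c, injApp φ ψ XY c z ≫ f = injApp φ ψ XY c z ≫ g) : f = g := by
  have : PreservesColimitsOfSize.{w, w} ((evaluation (Prof C L) V).obj z) :=
    ⟨fun {_} _ => inferInstance⟩
  exact coend_map_hom_ext ((evaluation (Prof C L) V).obj z) ((summand φ ψ).obj XY) h

theorem injApp_dinatural {I J L : Type} (φ : I → Option L) (ψ : J → L)
    (XY : Coll C V I × Coll C V J) {c c' : C} (f : c ⟶ c') (z : Prof C L) :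
    summandMap φ ψ (𝟙 XY) f.op (𝟙 c) (𝟙 z) ≫ injApp φ ψ XY c z =
      summandMap φ ψ (𝟙 XY) (𝟙 (op c')) f (𝟙 z) ≫ injApp φ ψ XY c' z :=
  congrArg (fun t => t.app z) (inj_dinatural φ ψ XY f)

theorem injApp_map {I J L : Type} (φ : I → Option L) (ψ : J → L)
    {XY XY' : Coll C V I × Coll C V J} (α : XY ⟶ XY') (c : C) (z : Prof C L) :
    injApp φ ψ XY c z ≫ ((tensorAlong φ ψ).map α).app z =
      summandMap φ ψ α (𝟙 (op c)) (𝟙 c) (𝟙 z) ≫ injApp φ ψ XY' c z :=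
  congrArg (fun t => t.app z) (inj_map φ ψ α c)

theorem injApp_tensorDesc {I J L : Type} (φ : I → Option L) (ψ : J → L)
    (XY : Coll C V I × Coll C V J) {T : Coll C V L}
    (g : ∀ c : C, summandFunctor φ ψ XY (op c) c ⟶ T)
    (hg : ∀ (c c' : C) (f : c ⟶ c'), summandNat φ ψ (𝟙 XY) f.op (𝟙 c) ≫ g c =
      summandNat φ ψ (𝟙 XY) (𝟙 (op c')) f ≫ g c') (c : C) (z : Prof C L) :
    injApp φ ψ XY c z ≫ (tensorDesc φ ψ XY g hg).app z = (g c).app z :=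
  congrArg (fun t => t.app z) (inj_tensorDesc φ ψ XY g hg c)

/-- A morphism `b ⟶ x_i` applied at the place `none`, and identities at the other places. -/
def fillSlot {L : Type} {b : Cᵒᵖ} {x : L → Cᵒᵖ} {i : L} (f : b ⟶ x i) :
    ∀ (o : Option L) (p : L), (o = none ∧ i = p) ∨ o = some p → (slot b x o ⟶ x p)
  | none, p, h => f ≫ eqToHom (by
      rcases h with h | h
      · rw [h.2]
      · cases h)
  | some q, p, h => eqToHom (by
      rcases h with h | h
      · cases h.1
      · cases h; rfl)

theorem slotMap_fillSlot {L : Type} {b b' : Cᵒᵖ} {x x' : L → Cᵒᵖ} {i : L} (f : b ⟶ x i)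
    (f' : b' ⟶ x' i) (g : b ⟶ b') (r : ∀ q, x q ⟶ x' q) (e : g ≫ f' = f ≫ r i)
    (o : Option L) (p : L) (h : (o = none ∧ i = p) ∨ o = some p) :
    slotMap g r o ≫ fillSlot f' o p h = fillSlot f o p h ≫ r p := by
  cases o with
  | none =>
    have : i = p := by
      rcases h with h | h
      · exact h.2
      · cases h
    subst this
    show g ≫ f' ≫ 𝟙 _ = (f ≫ 𝟙 _) ≫ r i
    rw [Category.comp_id, Category.comp_id, e]
  | some q =>
    have : q = p := by
      rcases h with h | h
      · cases h.1
      · cases h; rfl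
    subst this
    exact (Category.comp_id _).trans (Category.id_comp _).symm

theorem fillSlot_eq {L : Type} {x : L → Cᵒᵖ} {i : L} (o : Option L) (p : L)
    (h : (o = none ∧ i = p) ∨ o = some p) (h' : slot (x i) x o = x p) :
    fillSlot (𝟙 (x i)) o p h = eqToHom h' := by
  cases o with
  | none => exact Category.id_comp _
  | some q => rfl

theorem rightUnitor_square {A A' B B' : V} (s : A ⟶ A') {i : 𝟙_ V ⟶ B} {i' : 𝟙_ V ⟶ B'}
    {t : B ⟶ B'} (h : i ≫ t = i') :
    ((ρ_ A).inv ≫ A ◁ i) ≫ (s ⊗ₘ t) = s ≫ (ρ_ A').inv ≫ A' ◁ i' := by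
  subst h
  rw [Category.assoc, ← id_tensorHom, tensorHom_comp_tensorHom, Category.id_comp,
    rightUnitor_inv_naturality_assoc, ← tensorHom_id, ← id_tensorHom, tensorHom_comp_tensorHom,
    Category.comp_id, Category.id_comp]

theorem rightUnitor_cancel {A B T : V} {i : 𝟙_ V ⟶ B} {a b : A ⊗ B ⟶ T}
    (h : ((ρ_ A).inv ≫ A ◁ i) ≫ a = ((ρ_ A).inv ≫ A ◁ i) ≫ b) : A ◁ i ≫ a = A ◁ i ≫ b := by
  rw [Category.assoc, Category.assoc] at h
  exact (cancel_epi _).1 h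

theorem leftUnitor_square {A A' B B' : V} (s : A ⟶ A') {i : 𝟙_ V ⟶ B} {i' : 𝟙_ V ⟶ B'}
    {t : B ⟶ B'} (h : i ≫ t = i') :
    ((λ_ A).inv ≫ i ▷ A) ≫ (t ⊗ₘ s) = s ≫ (λ_ A').inv ≫ i' ▷ A' := by
  subst h
  rw [Category.assoc, ← tensorHom_id, tensorHom_comp_tensorHom, Category.id_comp,
    leftUnitor_inv_naturality_assoc, ← tensorHom_id, ← id_tensorHom, tensorHom_comp_tensorHom,
    Category.id_comp, Category.comp_id]

theorem leftUnitor_cancel {A B T : V} {i : 𝟙_ V ⟶ B} {a b : B ⊗ A ⟶ T}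
    (h : ((λ_ A).inv ≫ i ▷ A) ≫ a = ((λ_ A).inv ≫ i ▷ A) ≫ b) : i ▷ A ≫ a = i ▷ A ≫ b := by
  rw [Category.assoc, Category.assoc] at h
  exact (cancel_epi _).1 h

section Right

variable {L : Type} {φ : L → Option L} {ψ : Fin 1 → L}

/-- The index maps of `X ⊗ᵢ U`. -/
def RightUnitIndices {L : Type} (φ : L → Option L) (ψ : Fin 1 → L) : Prop :=
  ∀ p, (φ p = none ∧ ψ 0 = p) ∨ φ p = some p

/-- `(x₁ … b … xₙ; y) ⟶ (x₁ … xₙ; y)` induced by `b ⟶ x_i`. -/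
def rightFill (H : RightUnitIndices φ ψ) {b : Cᵒᵖ} {z : Prof C L} (f : b ⟶ z.1 (ψ 0)) :
    (plug φ).obj (b, z) ⟶ z :=
  (fun p => fillSlot f (φ p) p (H p), 𝟙 z.2)

theorem plug_map_rightFill (H : RightUnitIndices φ ψ) {b b' : Cᵒᵖ} {z z' : Prof C L}
    (f : b ⟶ z.1 (ψ 0)) (f' : b' ⟶ z'.1 (ψ 0)) (g : b ⟶ b') (r : z ⟶ z')
    (e : g ≫ f' = f ≫ r.1 (ψ 0)) :
    (plug φ).map (Prod.mkHom g r) ≫ rightFill H f' = rightFill H f ≫ r :=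
  Prod.ext (funext fun p => slotMap_fillSlot f f' g r.1 e (φ p) p (H p))
    ((Category.comp_id r.2).trans (Category.id_comp r.2).symm)

theorem RightUnitIndices.slot_eq (H : RightUnitIndices φ ψ) (x : L → Cᵒᵖ) (p : L) :
    slot (x (ψ 0)) x (φ p) = x p := by
  rcases H p with ⟨h, h'⟩ | h
  · rw [h, ← h']; rfl
  · rw [h]; rfl

theorem rightFill_id (H : RightUnitIndices φ ψ) (z : Prof C L) :
    rightFill H (𝟙 (z.1 (ψ 0))) =
      (profIso (a := (plug φ).obj (z.1 (ψ 0), z)) (b := z) (H.slot_eq z.1) rfl).hom :=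
  Prod.ext (funext fun p => fillSlot_eq _ _ _ (H.slot_eq z.1 p)) rfl

/-- The coproduct injection into `X(… c …; y) ⊗ (C(x_i, d) · I)` at `f : x_i ⟶ d`. -/
noncomputable def rightPoint (φ : L → Option L) (ψ : Fin 1 → L) (X : Coll C V L) (c : Cᵒᵖ)
    (d : C) (z : Prof C L) (f : (z.1 (ψ 0)).unop ⟶ d) :
    X.obj ((plug φ).obj (c, z)) ⟶ summandObj φ ψ (X, unitColl C V) c d z :=
  (ρ_ _).inv ≫ _ ◁ Sigma.ι (fun _ : ((z.1 (ψ 0)).unop ⟶ d) => 𝟙_ V) f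

theorem rightPoint_map {X X' : Coll C V L} (α : X ⟶ X') {c c' : Cᵒᵖ} (g : c ⟶ c') {d d' : C}
    (k : d ⟶ d') {z z' : Prof C L} (r : z ⟶ z') (f : (z.1 (ψ 0)).unop ⟶ d) :
    rightPoint φ ψ X c d z f ≫ summandMap φ ψ (XY := (X, unitColl C V))
        (XY' := (X', unitColl C V)) (α ×ₘ 𝟙 (unitColl C V)) g k r =
    (X.map ((plug φ).map (Prod.mkHom g r)) ≫ α.app _) ≫
      rightPoint φ ψ X' c' d' z' ((r.1 (ψ 0)).unop ≫ f ≫ k) := by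
  have e := unitColl_ι_map (V := V) ((select ψ).map (Prod.mkHom k r)) f
  have e' : Sigma.ι (fun _ : ((z.1 (ψ 0)).unop ⟶ d) => 𝟙_ V) f ≫
    (unitColl C V).map ((select ψ).map (Prod.mkHom k r)) ≫ (𝟙 (unitColl C V) : _ ⟶ _).app _ =
      Sigma.ι (fun _ : ((z'.1 (ψ 0)).unop ⟶ d') => 𝟙_ V) ((r.1 (ψ 0)).unop ≫ f ≫ k) :=
    (congrArg _ (Category.comp_id _)).trans e
  exact rightUnitor_square _ e'

theorem rightPoint_dinatural (X : Coll C V L) {b c : C} (f : b ⟶ c) (z : Prof C L)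
    (j : (z.1 (ψ 0)).unop ⟶ b) :
    X.map ((plug φ).map (Prod.mkHom f.op (𝟙 z))) ≫ rightPoint φ ψ X (op b) b z j ≫
        injApp φ ψ (X, unitColl C V) b z =
      rightPoint φ ψ X (op c) c z (j ≫ f) ≫ injApp φ ψ (X, unitColl C V) c z := by
  have e1 := rightPoint_map (φ := φ) (𝟙 X) f.op (𝟙 b) (𝟙 z) j
  have e2 := rightPoint_map (φ := φ) (𝟙 X) (𝟙 (op c)) f (𝟙 z) j
  have e4 : (plug φ).map (Prod.mkHom (𝟙 (op c)) (𝟙 z)) = 𝟙 _ := (plug φ).map_id (op c, z)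
  have e5 : ((𝟙 z : z ⟶ z).1 (ψ 0)).unop ≫ j ≫ 𝟙 b = j :=
    (Category.id_comp _).trans (Category.comp_id _)
  have e6 : ((𝟙 z : z ⟶ z).1 (ψ 0)).unop ≫ j ≫ f = j ≫ f := Category.id_comp _
  rw [e5, NatTrans.id_app, Category.comp_id] at e1
  rw [e4, e6, NatTrans.id_app, Category.comp_id, CategoryTheory.Functor.map_id,
    Category.id_comp] at e2
  rw [← Category.assoc, ← e1, ← e2, Category.assoc, Category.assoc]
  exact congrArg (rightPoint φ ψ X (op c) b z j ≫ ·) (injApp_dinatural φ ψ (X, unitColl C V) f z)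

variable [SymmetricCategory V] [MonoidalClosed V]

theorem rightPoint_hom_ext {X : Coll C V L} {c : Cᵒᵖ} {d : C} {z : Prof C L} {T : V}
    {a b : summandObj φ ψ (X, unitColl C V) c d z ⟶ T}
    (h : ∀ f, rightPoint φ ψ X c d z f ≫ a = rightPoint φ ψ X c d z f ≫ b) : a = b :=
  copower_hom_ext fun f => rightUnitor_cancel (h f)

/-- `X(x₁ … c … xₙ; y) ⊗ (C(x_i, c) · I) ⟶ X(x₁ … xₙ; y)`, which is `X(𝟙 … f … 𝟙; 𝟙)` on the
copy of `I` with index `f : x_i ⟶ c`. -/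
noncomputable def rightUnitSummandApp (H : RightUnitIndices φ ψ) (X : Coll C V L) (c : C)
    (z : Prof C L) : summandObj φ ψ (X, unitColl C V) (op c) c z ⟶ X.obj z :=
  copowerDesc fun f : ((z.1 (ψ 0)).unop ⟶ c) => X.map (rightFill H (b := op c) f.op)

theorem rightPoint_unit (H : RightUnitIndices φ ψ) (X : Coll C V L) (c : C)
    (z : Prof C L) (f : (z.1 (ψ 0)).unop ⟶ c) :
    rightPoint φ ψ X (op c) c z f ≫ rightUnitSummandApp H X c z =
      X.map (rightFill H (b := op c) f.op) :=
  (Category.assoc _ _ _).trans ((congrArg ((ρ_ _).inv ≫ ·) (ι_copowerDesc _ f)).trans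
    (Iso.inv_hom_id_assoc _ _))

theorem rightUnit_square (H : RightUnitIndices φ ψ) {X X' : Coll C V L} (α : X ⟶ X')
    {c : Cᵒᵖ} {d d' : C} (g : c ⟶ op d') (k : d ⟶ d') {z z' : Prof C L} (r : z ⟶ z')
    (f : (z.1 (ψ 0)).unop ⟶ d) :
    rightPoint φ ψ X c d z f ≫
      summandMap φ ψ (XY := (X, unitColl C V)) (XY' := (X', unitColl C V))
        (α ×ₘ 𝟙 (unitColl C V)) g k r ≫ rightUnitSummandApp H X' d' z' =
    X.map (rightFill H (g ≫ k.op ≫ f.op)) ≫ X.map r ≫ α.app z' := by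
  rw [← Category.assoc, rightPoint_map, Category.assoc, rightPoint_unit,
    Category.assoc, ← α.naturality, ← Category.assoc (X.map _),
    ← CategoryTheory.Functor.map_comp, plug_map_rightFill H (g ≫ k.op ≫ f.op) _ g r (by
      simp), CategoryTheory.Functor.map_comp, Category.assoc]

/-- The morphism `X ⊗ᵢ U ⟶ X` that these maps induce. -/
noncomputable def rightUnitHom (H : RightUnitIndices φ ψ) (X : Coll C V L) :
    (tensorAlong φ ψ).obj (X, unitColl C V) ⟶ X :=
  tensorDesc φ ψ _
    (fun c =>
      { app := rightUnitSummandApp H X c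
        naturality := fun z z' r => rightPoint_hom_ext fun f => by
          refine (rightUnit_square H (𝟙 X) (𝟙 (op c)) (𝟙 c) r f).trans ?_
          refine Eq.trans ?_ (Category.assoc _ _ _)
          rw [rightPoint_unit]
          refine (congrArg (_ ≫ ·) (Category.comp_id _)).trans ?_
          simp })
    (fun c c' f => NatTrans.ext (funext fun z => rightPoint_hom_ext fun j => by
      refine (rightUnit_square H (𝟙 X) f.op (𝟙 c) (𝟙 z) j).trans ?_
      refine Eq.trans ?_ (rightUnit_square H (𝟙 X) (𝟙 (op c')) f (𝟙 z) j).symm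
      simp))

theorem inj_rightUnitHom (H : RightUnitIndices φ ψ) (X : Coll C V L) (c : C) (z : Prof C L) :
    injApp φ ψ (X, unitColl C V) c z ≫ (rightUnitHom H X).app z =
      rightUnitSummandApp H X c z :=
  injApp_tensorDesc φ ψ (X, unitColl C V) _ _ c z

/-- The inverse, at `z`: the summand `c = x_i` and the copy of `I` with index `𝟙`. -/
noncomputable def rightUnitInvApp (H : RightUnitIndices φ ψ) (X : Coll C V L) (z : Prof C L) :
    X.obj z ⟶ ((tensorAlong φ ψ).obj (X, unitColl C V)).obj z :=
  X.map (profIso (a := (plug φ).obj (z.1 (ψ 0), z)) (b := z) (H.slot_eq z.1) rfl).inv ≫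
    rightPoint φ ψ X (z.1 (ψ 0)) (z.1 (ψ 0)).unop z (𝟙 _) ≫
    injApp φ ψ (X, unitColl C V) (z.1 (ψ 0)).unop z

/-- The canonical isomorphism `X ⊗ᵢ U ≅ X`. -/
noncomputable def rightUnitIso (H : RightUnitIndices φ ψ) (X : Coll C V L) :
    (tensorAlong φ ψ).obj (X, unitColl C V) ≅ X :=
  NatIso.ofComponents (fun z =>
    { hom := (rightUnitHom H X).app z
      inv := rightUnitInvApp H X z
      hom_inv_id := tensor_app_hom_ext φ ψ fun c => rightPoint_hom_ext fun f => by
        have e := plug_map_rightFill H (z := z) (f.op : op c ⟶ z.1 (ψ 0)) (𝟙 _) f.op (𝟙 z)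
          (by simp)
        rw [rightFill_id, Category.comp_id] at e
        have e1 := rightPoint_dinatural (φ := φ) X f z (𝟙 (z.1 (ψ 0)).unop)
        rw [Category.id_comp] at e1
        rw [← Category.assoc (injApp _ _ _ _ _), inj_rightUnitHom, ← Category.assoc,
          rightPoint_unit, Category.comp_id, ← e1]
        refine (Category.assoc _ _ _).symm.trans (congrArg (· ≫ rightPoint φ ψ X _ _ z (𝟙 _) ≫
          injApp φ ψ (X, unitColl C V) _ z) ?_)
        rw [← CategoryTheory.Functor.map_comp, ← e]
        refine congrArg X.map ?_
        rw [Category.assoc, Iso.hom_inv_id]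
        exact Category.comp_id _
      inv_hom_id := by
        rw [rightUnitInvApp, Category.assoc, Category.assoc, inj_rightUnitHom, rightPoint_unit,
          ← CategoryTheory.Functor.map_comp]
        refine (congrArg (fun t => X.map (_ ≫ t)) (rightFill_id H z)).trans ?_
        rw [Iso.inv_hom_id, CategoryTheory.Functor.map_id] })
    (fun r => (rightUnitHom H X).naturality r)

theorem rightUnitIso_natural (H : RightUnitIndices φ ψ) {X X' : Coll C V L} (α : X ⟶ X') :
    (tensorAlong φ ψ).map (α ×ₘ 𝟙 (unitColl C V)) ≫ (rightUnitIso H X').hom =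
      (rightUnitIso H X).hom ≫ α :=
  NatTrans.ext (funext fun z => tensor_app_hom_ext φ ψ fun c => rightPoint_hom_ext fun f => by
    have e := rightUnit_square H α (𝟙 (op c)) (𝟙 c) (𝟙 z) f
    show _ ≫ _ ≫ _ ≫ (rightUnitHom H X').app z = _ ≫ _ ≫ (rightUnitHom H X).app z ≫ α.app z
    rw [← Category.assoc (injApp _ _ _ _ _), ← Category.assoc (injApp _ _ _ _ _), injApp_map,
      Category.assoc, inj_rightUnitHom, inj_rightUnitHom, e]
    refine Eq.trans ?_ (Category.assoc _ _ _)
    rw [rightPoint_unit]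
    simp)

end Right

section Left

variable {L M : Type} {φ : Fin 1 → Option L} {ψ : L → L}

/-- The index maps of `U ⊗₁ Y`. -/
structure LeftUnitIndices {L : Type} (φ : Fin 1 → Option L) (ψ : L → L) : Prop where
  fst : φ 0 = none
  snd (q : L) : ψ q = q

theorem LeftUnitIndices.slot_eq (H : LeftUnitIndices φ ψ) (c : Cᵒᵖ) (x : L → Cᵒᵖ) :
    slot c x (φ 0) = c := by
  rw [H.fst]; rfl

theorem LeftUnitIndices.slotMap_eq (H : LeftUnitIndices φ ψ) {c c' : Cᵒᵖ} {x x' : L → Cᵒᵖ}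
    (f : c ⟶ c') (r : x ⟶ x') :
    slotMap f r (φ 0) ≫ eqToHom (H.slot_eq c' x') = eqToHom (H.slot_eq c x) ≫ f :=
  comp_eqToHom_of_heq _ _ _ _ (by rw [H.fst]; rfl)

/-- `(x₁ … xₙ; d) ⟶ (x₁ … xₙ; y)` induced by `d ⟶ y`. -/
def leftFill (H : LeftUnitIndices φ ψ) {d : C} {z : Prof C L} (f : d ⟶ z.2) :
    (select ψ).obj (d, z) ⟶ z :=
  (fun q => eqToHom (congrArg z.1 (H.snd q)), f)

theorem select_map_leftFill (H : LeftUnitIndices φ ψ) {d d' : C} {z z' : Prof C L}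
    (f : d ⟶ z.2) (f' : d' ⟶ z'.2) (k : d ⟶ d') (r : z ⟶ z') (e : k ≫ f' = f ≫ r.2) :
    (select ψ).map (Prod.mkHom k r) ≫ leftFill H f' = leftFill H f ≫ r :=
  Prod.ext (funext fun q => comp_eqToHom_of_heq (congrArg z.1 (H.snd q))
    (congrArg z'.1 (H.snd q)) _ _ (by
    show r.1 (ψ q) ≍ r.1 q
    rw [H.snd q])) e

theorem leftFill_id (H : LeftUnitIndices φ ψ) (z : Prof C L) :
    leftFill H (𝟙 z.2) = (profIso (a := (select ψ).obj (z.2, z)) (b := z)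
      (fun q => congrArg z.1 (H.snd q)) rfl).hom :=
  rfl

/-- The coproduct injection into `(C(c, y) · I) ⊗ Y(…; d)` at `f : c ⟶ y`. -/
noncomputable def leftPoint (H : LeftUnitIndices φ ψ) (Y : Coll C V L) (c : Cᵒᵖ)
    (d : C) (z : Prof C L) (f : c.unop ⟶ z.2) :
    Y.obj ((select ψ).obj (d, z)) ⟶ summandObj φ ψ (unitColl C V, Y) c d z :=
  (λ_ _).inv ≫ Sigma.ι (fun _ : ((slot c z.1 (φ 0)).unop ⟶ z.2) => 𝟙_ V)
    ((eqToHom (H.slot_eq c z.1).symm).unop ≫ f) ▷ _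

theorem leftPoint_map (H : LeftUnitIndices φ ψ) {Y Y' : Coll C V L} (β : Y ⟶ Y') {c c' : Cᵒᵖ}
    (g : c ⟶ c') {d d' : C} (k : d ⟶ d') {z z' : Prof C L} (r : z ⟶ z') (f : c.unop ⟶ z.2) :
    leftPoint H Y c d z f ≫ summandMap φ ψ (XY := (unitColl C V, Y))
        (XY' := (unitColl C V, Y')) (𝟙 (unitColl C V) ×ₘ β) g k r =
    (Y.map ((select ψ).map (Prod.mkHom k r)) ≫ β.app _) ≫
      leftPoint H Y' c' d' z' (g.unop ≫ f ≫ r.2) := by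
  have e := unitColl_ι_map (V := V) ((plug φ).map (Prod.mkHom g r))
    ((eqToHom (H.slot_eq c z.1).symm).unop ≫ f)
  have e0 : (slotMap g r.1 (φ 0)).unop ≫ ((eqToHom (H.slot_eq c z.1).symm).unop ≫ f) ≫ r.2 =
      (eqToHom (H.slot_eq c' z'.1).symm).unop ≫ g.unop ≫ f ≫ r.2 := by
    have h := H.slotMap_eq g r.1
    have h' : eqToHom (H.slot_eq c z.1).symm ≫ slotMap g r.1 (φ 0) =
        g ≫ eqToHom (H.slot_eq c' z'.1).symm := by
      rw [← cancel_mono (eqToHom (H.slot_eq c' z'.1)), Category.assoc, h]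
      simp
    have h'' := congrArg Quiver.Hom.unop h'
    rw [unop_comp, unop_comp] at h''
    rw [Category.assoc, ← Category.assoc, h'', Category.assoc]
  have e' : Sigma.ι (fun _ : ((slot c z.1 (φ 0)).unop ⟶ z.2) => 𝟙_ V)
      ((eqToHom (H.slot_eq c z.1).symm).unop ≫ f) ≫
    (unitColl C V).map ((plug φ).map (Prod.mkHom g r)) ≫ (𝟙 (unitColl C V) : _ ⟶ _).app _ =
      Sigma.ι (fun _ : ((slot c' z'.1 (φ 0)).unop ⟶ z'.2) => 𝟙_ V)
        ((eqToHom (H.slot_eq c' z'.1).symm).unop ≫ g.unop ≫ f ≫ r.2) :=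
    (congrArg _ (Category.comp_id _)).trans (e.trans (congrArg
      (Sigma.ι (fun _ : ((slot c' z'.1 (φ 0)).unop ⟶ z'.2) => 𝟙_ V)) e0))
  exact leftUnitor_square _ e'

theorem leftPoint_dinatural (H : LeftUnitIndices φ ψ) (Y : Coll C V L) {b c : C} (f : b ⟶ c)
    (z : Prof C L) (j : c ⟶ z.2) :
    Y.map ((select ψ).map (Prod.mkHom f (𝟙 z))) ≫ leftPoint H Y (op c) c z j ≫
        injApp φ ψ (unitColl C V, Y) c z =
      leftPoint H Y (op b) b z (f ≫ j) ≫ injApp φ ψ (unitColl C V, Y) b z := by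
  have e1 := leftPoint_map H (𝟙 Y) f.op (𝟙 b) (𝟙 z) j
  have e2 := leftPoint_map H (𝟙 Y) (𝟙 (op c)) f (𝟙 z) j
  have e4 : (select ψ).map (Prod.mkHom (𝟙 b) (𝟙 z)) = 𝟙 _ := (select ψ).map_id (b, z)
  have e5 : (𝟙 (op c)).unop ≫ j ≫ (𝟙 z : z ⟶ z).2 = j :=
    (Category.id_comp _).trans (Category.comp_id _)
  have e6 : f.op.unop ≫ j ≫ (𝟙 z : z ⟶ z).2 = f ≫ j := congrArg (f ≫ ·) (Category.comp_id _)
  rw [e5, NatTrans.id_app, Category.comp_id] at e2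
  rw [e4, e6, NatTrans.id_app, Category.comp_id, CategoryTheory.Functor.map_id,
    Category.id_comp] at e1
  rw [← Category.assoc, ← e1, ← e2, Category.assoc, Category.assoc]
  exact congrArg (leftPoint H Y (op c) b z j ≫ ·) (injApp_dinatural φ ψ (unitColl C V, Y) f z).symm

variable [SymmetricCategory V] [MonoidalClosed V]

theorem leftPoint_hom_ext (H : LeftUnitIndices φ ψ) {Y : Coll C V L} {c : Cᵒᵖ} {d : C}
    {z : Prof C L} {T : V} {a b : summandObj φ ψ (unitColl C V, Y) c d z ⟶ T}
    (h : ∀ f, leftPoint H Y c d z f ≫ a = leftPoint H Y c d z f ≫ b) : a = b :=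
  copower_hom_ext_left fun (f : (slot c z.1 (φ 0)).unop ⟶ z.2) => by
    have h' := h ((eqToHom (H.slot_eq c z.1)).unop ≫ f)
    have e : (eqToHom (H.slot_eq c z.1).symm).unop ≫ (eqToHom (H.slot_eq c z.1)).unop ≫ f = f := by
      rw [← Category.assoc, ← unop_comp, eqToHom_trans]
      simp
    unfold leftPoint at h'
    rw [e] at h'
    exact leftUnitor_cancel h'

/-- `(C(c, y) · I) ⊗ Y(x₁ … xₙ; c) ⟶ Y(x₁ … xₙ; y)`, which is `Y(𝟙 … 𝟙; f)` on the copy of `I`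
with index `f : c ⟶ y`. -/
noncomputable def leftUnitSummandApp (H : LeftUnitIndices φ ψ) (Y : Coll C V L) (c : C)
    (z : Prof C L) : summandObj φ ψ (unitColl C V, Y) (op c) c z ⟶ Y.obj z :=
  copowerDescLeft fun f : ((slot (op c) z.1 (φ 0)).unop ⟶ z.2) =>
    Y.map (leftFill H (d := c) ((eqToHom (H.slot_eq (op c) z.1)).unop ≫ f))

theorem leftPoint_unit (H : LeftUnitIndices φ ψ) (Y : Coll C V L) (c : C)
    (z : Prof C L) (f : c ⟶ z.2) :
    leftPoint H Y (op c) c z f ≫ leftUnitSummandApp H Y c z = Y.map (leftFill H f) := by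
  have e : (eqToHom (H.slot_eq (op c) z.1)).unop ≫
      (eqToHom (H.slot_eq (op c) z.1).symm).unop ≫ f = f := by
    rw [← Category.assoc, ← unop_comp, eqToHom_trans]
    simp
  refine (Category.assoc _ _ _).trans ((congrArg ((λ_ _).inv ≫ ·) (ι_copowerDescLeft _ _)).trans
    ((Iso.inv_hom_id_assoc _ _).trans ?_))
  exact congrArg (fun t => Y.map (leftFill H t)) e

theorem leftUnit_square (H : LeftUnitIndices φ ψ) {Y Y' : Coll C V L} (β : Y ⟶ Y')
    {c : Cᵒᵖ} {d d' : C} (g : c ⟶ op d') (k : d ⟶ d') {z z' : Prof C L} (r : z ⟶ z')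
    (f : c.unop ⟶ z.2) :
    leftPoint H Y c d z f ≫ summandMap φ ψ (XY := (unitColl C V, Y))
        (XY' := (unitColl C V, Y')) (𝟙 (unitColl C V) ×ₘ β) g k r ≫ leftUnitSummandApp H Y' d' z' =
    Y.map (leftFill H (k ≫ g.unop ≫ f)) ≫ Y.map r ≫ β.app z' := by
  rw [← Category.assoc, leftPoint_map, Category.assoc, leftPoint_unit,
    Category.assoc, ← β.naturality, ← Category.assoc (Y.map _),
    ← CategoryTheory.Functor.map_comp, select_map_leftFill H (k ≫ g.unop ≫ f) _ k r (by
      simp), CategoryTheory.Functor.map_comp, Category.assoc]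

/-- The morphism `U ⊗₁ Y ⟶ Y` that these maps induce. -/
noncomputable def leftUnitHom (H : LeftUnitIndices φ ψ) (Y : Coll C V L) :
    (tensorAlong φ ψ).obj (unitColl C V, Y) ⟶ Y :=
  tensorDesc φ ψ _
    (fun c =>
      { app := leftUnitSummandApp H Y c
        naturality := fun z z' r => leftPoint_hom_ext H fun f => by
          refine (leftUnit_square H (𝟙 Y) (𝟙 (op c)) (𝟙 c) r f).trans ?_
          refine Eq.trans ?_ (Category.assoc _ _ _)
          rw [leftPoint_unit]
          refine (congrArg (_ ≫ ·) (Category.comp_id _)).trans ?_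
          simp })
    (fun c c' f => NatTrans.ext (funext fun z => leftPoint_hom_ext H fun j => by
      refine (leftUnit_square H (𝟙 Y) f.op (𝟙 c) (𝟙 z) j).trans ?_
      refine Eq.trans ?_ (leftUnit_square H (𝟙 Y) (𝟙 (op c')) f (𝟙 z) j).symm
      simp))

theorem inj_leftUnitHom (H : LeftUnitIndices φ ψ) (Y : Coll C V L) (c : C) (z : Prof C L) :
    injApp φ ψ (unitColl C V, Y) c z ≫ (leftUnitHom H Y).app z =
      leftUnitSummandApp H Y c z :=
  injApp_tensorDesc φ ψ (unitColl C V, Y) _ _ c z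

/-- The inverse, at `z`: the summand `c = y` and the copy of `I` with index `𝟙`. -/
noncomputable def leftUnitInvApp (H : LeftUnitIndices φ ψ) (Y : Coll C V L) (z : Prof C L) :
    Y.obj z ⟶ ((tensorAlong φ ψ).obj (unitColl C V, Y)).obj z :=
  Y.map (profIso (a := (select ψ).obj (z.2, z)) (b := z)
      (fun q => congrArg z.1 (H.snd q)) rfl).inv ≫
    leftPoint H Y (op z.2) z.2 z (𝟙 _) ≫ injApp φ ψ (unitColl C V, Y) z.2 z

/-- The canonical isomorphism `U ⊗_1 Y ≅ Y`. -/
noncomputable def leftUnitIso (H : LeftUnitIndices φ ψ) (Y : Coll C V L) :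
    (tensorAlong φ ψ).obj (unitColl C V, Y) ≅ Y :=
  NatIso.ofComponents (fun z =>
    { hom := (leftUnitHom H Y).app z
      inv := leftUnitInvApp H Y z
      hom_inv_id := tensor_app_hom_ext φ ψ fun c => leftPoint_hom_ext H fun f => by
        have e := select_map_leftFill H (z := z) (z' := z) f (𝟙 _) f (𝟙 z) rfl
        rw [leftFill_id, Category.comp_id] at e
        have e1 := leftPoint_dinatural H Y f z (𝟙 z.2)
        rw [Category.comp_id] at e1
        rw [← Category.assoc (injApp _ _ _ _ _), inj_leftUnitHom, ← Category.assoc,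
          leftPoint_unit, Category.comp_id, ← e1]
        refine (Category.assoc _ _ _).symm.trans (congrArg (· ≫ leftPoint H Y _ _ z (𝟙 _) ≫
          injApp φ ψ (unitColl C V, Y) _ z) ?_)
        rw [← CategoryTheory.Functor.map_comp, ← e]
        refine congrArg Y.map ?_
        rw [Category.assoc, Iso.hom_inv_id]
        exact Category.comp_id _
      inv_hom_id := by
        rw [leftUnitInvApp, Category.assoc, Category.assoc, inj_leftUnitHom, leftPoint_unit,
          ← CategoryTheory.Functor.map_comp]
        refine (congrArg (fun t => Y.map (_ ≫ t)) (leftFill_id H z)).trans ?_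
        rw [Iso.inv_hom_id, CategoryTheory.Functor.map_id] })
    (fun r => (leftUnitHom H Y).naturality r)

theorem leftUnitIso_natural (H : LeftUnitIndices φ ψ) {Y Y' : Coll C V L} (β : Y ⟶ Y') :
    (tensorAlong φ ψ).map (𝟙 (unitColl C V) ×ₘ β) ≫ (leftUnitIso H Y').hom =
      (leftUnitIso H Y).hom ≫ β :=
  NatTrans.ext (funext fun z => tensor_app_hom_ext φ ψ fun c => leftPoint_hom_ext H fun f => by
    have e := leftUnit_square H β (𝟙 (op c)) (𝟙 c) (𝟙 z) f
    show _ ≫ _ ≫ _ ≫ (leftUnitHom H Y').app z = _ ≫ _ ≫ (leftUnitHom H Y).app z ≫ β.app z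
    rw [← Category.assoc (injApp _ _ _ _ _), ← Category.assoc (injApp _ _ _ _ _), injApp_map,
      Category.assoc, inj_leftUnitHom, inj_leftUnitHom, e]
    refine Eq.trans ?_ (Category.assoc _ _ _)
    rw [leftPoint_unit]
    simp)

end Left

end Units

section FinIndices

theorem outer_self {n m l : ℕ} (h : n + m = l + 1) (i : Fin n) : outer h i i = none :=
  dif_pos rfl

theorem outer_of_ne {n m l : ℕ} (h : n + m = l + 1) {i p : Fin n} (hp : p ≠ i) :
    outer h i p = some (outerPos h i p hp) :=
  dif_neg hp

theorem outer_eq_some {n m l : ℕ} (h : n + m = l + 1) {i p : Fin n} {r : Fin l} (hp : p ≠ i)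
    (e : (if p < i then (p : ℕ) else p + m - 1) = r) : outer h i p = some r :=
  (outer_of_ne h hp).trans (congrArg some (Fin.ext e))

theorem seqIndices {n m k l l' r : ℕ} (h₁ : n + m = l + 1) (h₂ : l + k = r + 1)
    (h₃ : m + k = l' + 1) (h₄ : n + l' = r + 1) (j : Fin n) (q : Fin m) :
    SeqIndices (outer h₁ j) (inner h₁ j) (outer h₂ (inner h₁ j q)) (inner h₂ (inner h₁ j q))
      (outer h₃ q) (inner h₃ q) (outer h₄ j) (inner h₄ j) where
  fst p := by
    by_cases hp : p = j
    · subst hp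
      exact Or.inl ⟨outer_self h₁ p, outer_self h₄ p⟩
    · refine Or.inr ⟨_, outerPos h₄ j p hp, outer_of_ne h₁ hp, outer_eq_some h₂ ?_ ?_,
        outer_of_ne h₄ hp⟩
      · intro e
        have := congrArg Fin.val e
        simp only [outerPos, inner, Fin.lt_def] at this
        have := q.2; have := p.2; have : (p : ℕ) ≠ j := fun e => hp (Fin.ext e)
        split_ifs at * <;> omega
      · simp only [outerPos, inner, Fin.lt_def]
        have := q.2; have := p.2; have : (p : ℕ) ≠ j := fun e => hp (Fin.ext e)
        split_ifs at * <;> omega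
  snd p := by
    by_cases hp : p = q
    · subst hp
      rw [outer_self, outer_self]; rfl
    · rw [outer_of_ne h₃ hp]
      refine outer_eq_some h₂ ?_ ?_
      · intro e
        have := congrArg Fin.val e
        simp only [inner] at this
        exact hp (Fin.ext (by omega))
      · simp only [outerPos, inner, Fin.lt_def]
        have := q.2; have := p.2; have : (p : ℕ) ≠ q := fun e => hp (Fin.ext e)
        split_ifs at * <;> omega
  trd p := Fin.ext (by simp only [inner]; omega)

theorem parIndices {n m k l l' r : ℕ} (h₁ : n + m = l + 1) (h₂ : l + k = r + 1)
    (h₃ : n + k = l' + 1) (h₄ : l' + m = r + 1) (a b : Fin n) (hab : b ≠ a) :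
    ParIndices (outer h₁ a) (inner h₁ a) (outer h₂ (outerPos h₁ a b hab))
      (inner h₂ (outerPos h₁ a b hab)) (outer h₃ b) (inner h₃ b)
      (outer h₄ (outerPos h₃ b a hab.symm)) (inner h₄ (outerPos h₃ b a hab.symm)) where
  fst p := by
    have hab' : (b : ℕ) ≠ a := fun e => hab (Fin.ext e)
    by_cases hp : p = a
    · subst hp
      exact Or.inl ⟨outer_self h₁ p, _, outer_of_ne h₃ hab.symm, outer_self h₄ _⟩
    · by_cases hp' : p = b
      · subst hp'
        exact Or.inr (Or.inl ⟨outer_self h₃ p, _, outer_of_ne h₁ hab, outer_self h₂ _⟩)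
      · have e1 : (p : ℕ) ≠ a := fun e => hp (Fin.ext e)
        have e2 : (p : ℕ) ≠ b := fun e => hp' (Fin.ext e)
        have hpa := p.2; have hb := b.2; have ha := a.2
        have n1 : outerPos h₁ a p hp ≠ outerPos h₁ a b hab := fun e => by
          have := congrArg Fin.val e
          simp only [outerPos, Fin.lt_def] at this
          split_ifs at this <;> omega
        refine Or.inr (Or.inr ⟨_, _, outerPos h₂ (outerPos h₁ a b hab) (outerPos h₁ a p hp) n1,
          outer_of_ne h₁ hp, outer_of_ne h₂ n1, outer_of_ne h₃ hp', outer_eq_some h₄ ?_ ?_⟩)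
        · intro e
          have := congrArg Fin.val e
          simp only [outerPos, Fin.lt_def] at this
          split_ifs at this <;> omega
        · simp only [outerPos, Fin.lt_def]
          split_ifs at * <;> omega
  snd p := by
    have hab' : (b : ℕ) ≠ a := fun e => hab (Fin.ext e)
    have hp := p.2; have hb := b.2; have ha := a.2
    refine outer_eq_some h₂ (fun e => ?_) ?_
    · have := congrArg Fin.val e
      simp only [outerPos, inner, Fin.lt_def] at this
      split_ifs at this <;> omega
    · simp only [outerPos, inner, Fin.lt_def]
      split_ifs at * <;> omega
  trd p := by
    have hab' : (b : ℕ) ≠ a := fun e => hab (Fin.ext e)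
    have hp := p.2; have hb := b.2; have ha := a.2
    refine outer_eq_some h₄ (fun e => ?_) ?_
    · have := congrArg Fin.val e
      simp only [outerPos, inner, Fin.lt_def] at this
      split_ifs at this <;> omega
    · simp only [outerPos, inner, Fin.lt_def]
      split_ifs at * <;> omega

theorem eqvIndices {n m l : ℕ} (h : n + m = l + 1) (i : Fin n) (σ : Equiv.Perm (Fin n))
    (τ : Equiv.Perm (Fin m)) :
    EqvIndices σ τ (permInsert h i σ τ) (outer h i) (inner h i) (outer h (σ i))
      (inner h (σ i)) where
  fst p := by
    by_cases hp : p = i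
    · subst hp
      rw [outer_self, outer_self]; rfl
    · rw [outer_of_ne h hp, outer_of_ne h (fun e => hp (σ.injective e))]
      exact congrArg some (permInsert_outerPos h i σ τ p hp).symm
  snd q := (permInsert_inner h i σ τ q).symm

theorem rightUnitIndices {n : ℕ} (h : n + 1 = n + 1) (i : Fin n) :
    RightUnitIndices (outer h i) (inner h i) := fun p => by
  by_cases hp : p = i
  · subst hp
    exact Or.inl ⟨outer_self h p, rfl⟩
  · refine Or.inr (outer_eq_some h hp ?_)
    split_ifs <;> omega

theorem leftUnitIndices {m : ℕ} (h : 1 + m = m + 1) :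
    LeftUnitIndices (outer h 0) (inner h (0 : Fin 1)) where
  fst := outer_self h 0
  snd q := Fin.ext (by simp [inner])

end FinIndices

end Tensor

section CategoricalOperads

universe v₁ u₁

/-- The structure of a categorical operad: categories `O(n)`, on which the symmetric groups act from
the left up to isomorphism, composition functors `⊙ᵢ : O(n) × O(m) ⥤ O(n + m - 1)`, and natural
isomorphisms for their associativity and equivariance. The coherence equations between these
isomorphisms are not recorded, as they do not enter the definition of an internal operad. -/
structure CategoricalOperadData where
  Obj : ℕ → Type u₁
  cat (n : ℕ) : Category.{v₁} (Obj n)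
  /-- `X ↦ σ(X)` -/
  act {n : ℕ} (σ : Equiv.Perm (Fin n)) : Obj n ⥤ Obj n
  /-- `σ(τ(X)) ≅ (στ)(X)` -/
  actMul {n : ℕ} (σ τ : Equiv.Perm (Fin n)) : act τ ⋙ act σ ≅ act (σ * τ)
  /-- `1(X) ≅ X` -/
  actOne (n : ℕ) : act (1 : Equiv.Perm (Fin n)) ≅ 𝟭 (Obj n)
  /-- `(X, Y) ↦ X ⊙ᵢ Y` -/
  comp {n m l : ℕ} (h : n + m = l + 1) (i : Fin n) : Obj n × Obj m ⥤ Obj l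
  /-- `(X ⊙_j Y) ⊙_i Z ≅ X ⊙_j (Y ⊙_q Z)`, where the `i`-th input of `X ⊙_j Y` is the `q`-th input
  of `Y`. -/
  seq {n m k l l' r : ℕ} (h₁ : n + m = l + 1) (h₂ : l + k = r + 1) (h₃ : m + k = l' + 1)
    (h₄ : n + l' = r + 1) (j : Fin n) (q : Fin m) (X : Obj n) (Y : Obj m) (Z : Obj k) :
    (comp h₂ (inner h₁ j q)).obj ((comp h₁ j).obj (X, Y), Z) ≅
      (comp h₄ j).obj (X, (comp h₃ q).obj (Y, Z))
  seq_natural {n m k l l' r : ℕ} (h₁ : n + m = l + 1) (h₂ : l + k = r + 1) (h₃ : m + k = l' + 1)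
    (h₄ : n + l' = r + 1) (j : Fin n) (q : Fin m) {X X' : Obj n} {Y Y' : Obj m} {Z Z' : Obj k}
    (α : X ⟶ X') (β : Y ⟶ Y') (γ : Z ⟶ Z') :
    (comp h₂ (inner h₁ j q)).map ((comp h₁ j).map (α ×ₘ β) ×ₘ γ) ≫
        (seq h₁ h₂ h₃ h₄ j q X' Y' Z').hom =
      (seq h₁ h₂ h₃ h₄ j q X Y Z).hom ≫ (comp h₄ j).map (α ×ₘ (comp h₃ q).map (β ×ₘ γ))
  /-- `(X ⊙_a Y) ⊙_{b'} Z ≅ (X ⊙_b Z) ⊙_{a'} Y` for two inputs `a ≠ b` of `X`, where `b'` is the place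
  of the input `b` in `X ⊙_a Y` and `a'` that of `a` in `X ⊙_b Z`. -/
  par {n m k l l' r : ℕ} (h₁ : n + m = l + 1) (h₂ : l + k = r + 1) (h₃ : n + k = l' + 1)
    (h₄ : l' + m = r + 1) (a b : Fin n) (hab : b ≠ a) (X : Obj n) (Y : Obj m) (Z : Obj k) :
    (comp h₂ (outerPos h₁ a b hab)).obj ((comp h₁ a).obj (X, Y), Z) ≅
      (comp h₄ (outerPos h₃ b a hab.symm)).obj ((comp h₃ b).obj (X, Z), Y)
  par_natural {n m k l l' r : ℕ} (h₁ : n + m = l + 1) (h₂ : l + k = r + 1) (h₃ : n + k = l' + 1)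
    (h₄ : l' + m = r + 1) (a b : Fin n) (hab : b ≠ a) {X X' : Obj n} {Y Y' : Obj m}
    {Z Z' : Obj k} (α : X ⟶ X') (β : Y ⟶ Y') (γ : Z ⟶ Z') :
    (comp h₂ (outerPos h₁ a b hab)).map ((comp h₁ a).map (α ×ₘ β) ×ₘ γ) ≫
        (par h₁ h₂ h₃ h₄ a b hab X' Y' Z').hom =
      (par h₁ h₂ h₃ h₄ a b hab X Y Z).hom ≫
        (comp h₄ (outerPos h₃ b a hab.symm)).map ((comp h₃ b).map (α ×ₘ γ) ×ₘ β)
  /-- `σ(X) ⊙_{σ(i)} τ(Y) ≅ (σ ∘ᵢ τ)(X ⊙ᵢ Y)` -/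
  eqv {n m l : ℕ} (h : n + m = l + 1) (i : Fin n) (σ : Equiv.Perm (Fin n))
    (τ : Equiv.Perm (Fin m)) (X : Obj n) (Y : Obj m) :
    (comp h (σ i)).obj ((act σ).obj X, (act τ).obj Y) ≅
      (act (permInsert h i σ τ)).obj ((comp h i).obj (X, Y))
  eqv_natural {n m l : ℕ} (h : n + m = l + 1) (i : Fin n) (σ : Equiv.Perm (Fin n))
    (τ : Equiv.Perm (Fin m)) {X X' : Obj n} {Y Y' : Obj m} (α : X ⟶ X') (β : Y ⟶ Y') :
    (comp h (σ i)).map ((act σ).map α ×ₘ (act τ).map β) ≫ (eqv h i σ τ X' Y').hom =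
      (eqv h i σ τ X Y).hom ≫ (act (permInsert h i σ τ)).map ((comp h i).map (α ×ₘ β))

attribute [instance] CategoricalOperadData.cat

/-- The structure of a unital categorical operad. -/
structure UnitalCategoricalOperadData extends CategoricalOperadData.{v₁, u₁} where
  unit : Obj 1
  leftUnit {m : ℕ} (h : 1 + m = m + 1) (Y : Obj m) : (comp h 0).obj (unit, Y) ≅ Y
  leftUnit_natural {m : ℕ} (h : 1 + m = m + 1) {Y Y' : Obj m} (β : Y ⟶ Y') :
    (comp h 0).map (𝟙 unit ×ₘ β) ≫ (leftUnit h Y').hom = (leftUnit h Y).hom ≫ β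
  rightUnit {n : ℕ} (h : n + 1 = n + 1) (i : Fin n) (X : Obj n) : (comp h i).obj (X, unit) ≅ X
  rightUnit_natural {n : ℕ} (h : n + 1 = n + 1) (i : Fin n) {X X' : Obj n} (α : X ⟶ X') :
    (comp h i).map (α ×ₘ 𝟙 unit) ≫ (rightUnit h i X').hom = (rightUnit h i X).hom ≫ α

/-- A (non-unital) internal operad in a categorical operad `O`: objects `A_n` of `O(n)` with structure
maps `σ̄ : σ(A_n) ⟶ A_n` and `•ᵢ : A_n ⊙ᵢ A_m ⟶ A_{n + m - 1}`. -/
structure InternalOperad (O : CategoricalOperadData.{v₁, u₁}) where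
  obj (n : ℕ) : O.Obj n
  act {n : ℕ} (σ : Equiv.Perm (Fin n)) : (O.act σ).obj (obj n) ⟶ obj n
  act_mul {n : ℕ} (σ τ : Equiv.Perm (Fin n)) :
    (O.act σ).map (act τ) ≫ act σ = (O.actMul σ τ).hom.app (obj n) ≫ act (σ * τ)
  act_one (n : ℕ) : act (1 : Equiv.Perm (Fin n)) = (O.actOne n).hom.app (obj n)
  comp {n m l : ℕ} (h : n + m = l + 1) (i : Fin n) : (O.comp h i).obj (obj n, obj m) ⟶ obj l
  assoc_seq {n m k l l' r : ℕ} (h₁ : n + m = l + 1) (h₂ : l + k = r + 1) (h₃ : m + k = l' + 1)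
    (h₄ : n + l' = r + 1) (j : Fin n) (q : Fin m) :
    (O.comp h₂ (inner h₁ j q)).map (comp h₁ j ×ₘ 𝟙 (obj k)) ≫ comp h₂ (inner h₁ j q) =
      (O.seq h₁ h₂ h₃ h₄ j q (obj n) (obj m) (obj k)).hom ≫
        (O.comp h₄ j).map (𝟙 (obj n) ×ₘ comp h₃ q) ≫ comp h₄ j
  assoc_par {n m k l l' r : ℕ} (h₁ : n + m = l + 1) (h₂ : l + k = r + 1) (h₃ : n + k = l' + 1)
    (h₄ : l' + m = r + 1) (a b : Fin n) (hab : b ≠ a) :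
    (O.comp h₂ (outerPos h₁ a b hab)).map (comp h₁ a ×ₘ 𝟙 (obj k)) ≫
        comp h₂ (outerPos h₁ a b hab) =
      (O.par h₁ h₂ h₃ h₄ a b hab (obj n) (obj m) (obj k)).hom ≫
        (O.comp h₄ (outerPos h₃ b a hab.symm)).map (comp h₃ b ×ₘ 𝟙 (obj m)) ≫
          comp h₄ (outerPos h₃ b a hab.symm)
  equivariance {n m l : ℕ} (h : n + m = l + 1) (i : Fin n) (σ : Equiv.Perm (Fin n))
    (τ : Equiv.Perm (Fin m)) :
    (O.comp h (σ i)).map (act σ ×ₘ act τ) ≫ comp h (σ i) =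
      (O.eqv h i σ τ (obj n) (obj m)).hom ≫
        (O.act (permInsert h i σ τ)).map (comp h i) ≫ act (permInsert h i σ τ)

namespace InternalOperad

variable {O : CategoricalOperadData.{v₁, u₁}}

/-- Morphisms `A_n ⟶ B_n` that commute with the structure maps. -/
@[ext]
structure Hom (A B : InternalOperad O) where
  app (n : ℕ) : A.obj n ⟶ B.obj n
  act_app {n : ℕ} (σ : Equiv.Perm (Fin n)) :
    A.act σ ≫ app n = (O.act σ).map (app n) ≫ B.act σ
  comp_app {n m l : ℕ} (h : n + m = l + 1) (i : Fin n) :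
    A.comp h i ≫ app l = (O.comp h i).map (app n ×ₘ app m) ≫ B.comp h i

instance : Category (InternalOperad O) where
  Hom := Hom
  id A :=
    { app := fun n => 𝟙 (A.obj n)
      act_app := fun σ => by rw [CategoryTheory.Functor.map_id, Category.id_comp, Category.comp_id]
      comp_app := fun h i => by
        rw [prod_id_eq, CategoryTheory.Functor.map_id, Category.id_comp, Category.comp_id] }
  comp f g :=
    { app := fun n => f.app n ≫ g.app n
      act_app := fun σ => by
        rw [← Category.assoc, f.act_app, Category.assoc, g.act_app,
          CategoryTheory.Functor.map_comp, Category.assoc]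
      comp_app := fun h i => by
        rw [← Category.assoc, f.comp_app, Category.assoc, g.comp_app, ← Category.assoc,
          ← CategoryTheory.Functor.map_comp, prod_comp] }
  id_comp f := Hom.ext (funext fun n => Category.id_comp _)
  comp_id f := Hom.ext (funext fun n => Category.comp_id _)
  assoc f g k := Hom.ext (funext fun n => Category.assoc _ _ _)

variable (O) in
/-- The underlying collection of objects of an internal operad. -/
def collection : InternalOperad O ⥤ ∀ n, O.Obj n where
  obj A := A.obj
  map f := f.app

end InternalOperad

/-- A unital internal operad: an internal operad with a morphism `U ⟶ A_1` that satisfies the unit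
axioms. -/
structure UnitalInternalOperad (O : UnitalCategoricalOperadData.{v₁, u₁}) extends
    InternalOperad O.toCategoricalOperadData where
  unit : O.unit ⟶ obj 1
  left_unit {m : ℕ} (h : 1 + m = m + 1) :
    (O.comp h 0).map (unit ×ₘ 𝟙 (obj m)) ≫ comp h 0 = (O.leftUnit h (obj m)).hom
  right_unit {n : ℕ} (h : n + 1 = n + 1) (i : Fin n) :
    (O.comp h i).map (𝟙 (obj n) ×ₘ unit) ≫ comp h i = (O.rightUnit h i (obj n)).hom

namespace UnitalInternalOperad

variable {O : UnitalCategoricalOperadData.{v₁, u₁}}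

/-- Morphisms of internal operads that commute with the units. -/
@[ext]
structure Hom (A B : UnitalInternalOperad O) extends
    InternalOperad.Hom A.toInternalOperad B.toInternalOperad where
  unit_app : A.unit ≫ app 1 = B.unit

/-- The identity morphism. -/
def Hom.id (A : UnitalInternalOperad O) : Hom A A where
  toHom := 𝟙 A.toInternalOperad
  unit_app := Category.comp_id _

/-- The composite of two morphisms. -/
def Hom.comp {A B D : UnitalInternalOperad O} (f : Hom A B) (g : Hom B D) : Hom A D where
  toHom := CategoryStruct.comp (obj := InternalOperad O.toCategoricalOperadData) f.toHom g.toHom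
  unit_app := (Category.assoc _ _ _).symm.trans
    ((congrArg (· ≫ g.app 1) f.unit_app).trans g.unit_app)

instance : Category (UnitalInternalOperad O) where
  Hom := Hom
  id := Hom.id
  comp := Hom.comp
  id_comp {A B} f := Hom.ext (funext fun n => Category.id_comp ((Hom.toHom f).app n))
  comp_id {A B} f := Hom.ext (funext fun n => Category.comp_id ((Hom.toHom f).app n))
  assoc f g k := Hom.ext (funext fun n => Category.assoc ((Hom.toHom f).app n) ((Hom.toHom g).app n) ((Hom.toHom k).app n))

variable (O) in
/-- The underlying collection of objects of a unital internal operad. -/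
def collection : UnitalInternalOperad O ⥤ ∀ n, O.Obj n where
  obj A := A.obj
  map f := (Hom.toHom f).app

end UnitalInternalOperad

end CategoricalOperads

section CV

variable (C : Type w) [SmallCategory C] (V : Type u) [Category.{v} V] [MonoidalCategory V]
  [SymmetricCategory V] [MonoidalClosed V] [HasColimitsOfSize.{w, w} V]

variable {C V} in
/-- The operation `X ⊗ᵢ Y = ∫^c Xⁱ_c ⊗ ᶜY`, with values
`∫^c X(x₁ … x_{i-1} c x_{i+1} … xₙ; x) ⊗ Y(y₁ … y_m; c)` at
`(x₁ … x_{i-1} y₁ … y_m x_{i+1} … xₙ; x)`. -/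
noncomputable def partialTensor {n m l : ℕ} (h : n + m = l + 1) (i : Fin n) :
    Coll C V (Fin n) × Coll C V (Fin m) ⥤ Coll C V (Fin l) :=
  tensorAlong (outer h i) (inner h i)

/-- The unital categorical operad `C_V`, with `C_V(n)` the category of functors `(Cᵒᵖ)ⁿ × C ⥤ V`. -/
noncomputable def CV : UnitalCategoricalOperadData.{max w v, max u v w} where
  Obj n := Coll C V (Fin n)
  cat n := inferInstance
  act σ := actAlong σ
  actMul σ τ := NatIso.ofComponents (fun X => NatIso.ofComponents
    (fun z => Iso.refl (X.obj (fun p => z.1 (σ (τ p)), z.2)))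
    (fun f => (Category.comp_id _).trans (Category.id_comp _).symm))
    (fun α => NatTrans.ext (funext fun z =>
      (Category.comp_id _).trans (Category.id_comp _).symm))
  actOne n := NatIso.ofComponents (fun X => NatIso.ofComponents (fun z => Iso.refl (X.obj z))
    (fun f => (Category.comp_id _).trans (Category.id_comp _).symm))
    (fun α => NatTrans.ext (funext fun z =>
      (Category.comp_id _).trans (Category.id_comp _).symm))
  comp h i := partialTensor h i
  seq h₁ h₂ h₃ h₄ j q X Y Z := seqIso (seqIndices h₁ h₂ h₃ h₄ j q) X Y Z
  seq_natural h₁ h₂ h₃ h₄ j q _ _ _ _ _ _ α β γ :=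
    seqIso_natural (seqIndices h₁ h₂ h₃ h₄ j q) α β γ
  par h₁ h₂ h₃ h₄ a b hab X Y Z := parIso (parIndices h₁ h₂ h₃ h₄ a b hab) X Y Z
  par_natural h₁ h₂ h₃ h₄ a b hab _ _ _ _ _ _ α β γ :=
    parIso_natural (parIndices h₁ h₂ h₃ h₄ a b hab) α β γ
  eqv h i σ τ X Y := eqvIso (eqvIndices h i σ τ) X Y
  eqv_natural h i σ τ _ _ _ _ α β := eqvIso_natural (eqvIndices h i σ τ) α β
  unit := unitColl C V
  leftUnit h Y := leftUnitIso (leftUnitIndices h) Y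
  leftUnit_natural h _ _ β := leftUnitIso_natural (leftUnitIndices h) β
  rightUnit h i X := rightUnitIso (rightUnitIndices h i) X
  rightUnit_natural h i _ _ α := rightUnitIso_natural (rightUnitIndices h i) α

end CV

section COperads

/-- The objects of the free symmetric monoidal category on `C`: finite lists of objects of `C`. -/
structure SymList (C : Type w) where
  len : ℕ
  obj : Fin len → C

namespace SymList

variable {C : Type w} [SmallCategory C]

/-- A morphism `(c₁ … cₙ) ⟶ (d₁ … dₙ)`: a permutation `σ` and morphisms `c_i ⟶ d_{σ(i)}`. (There
are none between lists of different lengths.) -/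
@[ext]
structure Hom (c d : SymList C) where
  perm : Fin c.len ≃ Fin d.len
  map (i : Fin c.len) : c.obj i ⟶ d.obj (perm i)

instance : Category.{w} (SymList C) where
  Hom := Hom
  id c := ⟨Equiv.refl _, fun i => 𝟙 (c.obj i)⟩
  comp f g := ⟨f.perm.trans g.perm, fun i => f.map i ≫ g.map (f.perm i)⟩
  id_comp f := Hom.ext rfl (heq_of_eq (funext fun i => Category.id_comp _))
  comp_id f := Hom.ext rfl (heq_of_eq (funext fun i => Category.comp_id _))
  assoc f g k := Hom.ext rfl (heq_of_eq (funext fun i => Category.assoc _ _ _))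

end SymList

variable (C : Type w) [SmallCategory C] (V : Type u) [Category.{v} V]

/-- The category of `C`-collections in `V`. -/
abbrev SymColl := (SymList C)ᵒᵖ × C ⥤ V

variable {C V}

/-- `(x₁ … xₙ; y)` as an object of the source of a `C`-collection. -/
def profToList (n : ℕ) : Prof C (Fin n) ⥤ (SymList C)ᵒᵖ × C where
  obj z := (op ⟨n, fun p => (z.1 p).unop⟩, z.2)
  map {z z'} f := (Quiver.Hom.op (X := (⟨n, fun p => (z'.1 p).unop⟩ : SymList C))
    (Y := ⟨n, fun p => (z.1 p).unop⟩) ⟨Equiv.refl _, fun p => (f.1 p).unop⟩, f.2)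

namespace SymColl

/-- The functor `P_n : (Cᵒᵖ)ⁿ × C ⥤ V` underlying a `C`-collection `P`. -/
def restr (P : SymColl C V) (n : ℕ) : Coll C V (Fin n) :=
  profToList n ⋙ P

/-- The action `(-)σ : P_n(c₁ … cₙ; c) ⟶ P_n(c_{σ(1)} … c_{σ(n)}; c)`. -/
def permute (P : SymColl C V) {n : ℕ} (σ : Equiv.Perm (Fin n)) :
    P.restr n ⟶ (actAlong σ).obj (P.restr n) where
  app z := P.map (Y := (op ⟨n, fun p => (z.1 (σ p)).unop⟩, z.2))
    (Quiver.Hom.op (X := (⟨n, fun p => (z.1 (σ p)).unop⟩ : SymList C))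
      (Y := ⟨n, fun p => (z.1 p).unop⟩) ⟨σ, fun p => 𝟙 _⟩, 𝟙 z.2)
  naturality z z' f := by
    refine (P.map_comp _ _).symm.trans (Eq.trans ?_ (P.map_comp _ _))
    refine congrArg P.map (Prod.ext (Quiver.Hom.unop_inj (SymList.Hom.ext rfl (heq_of_eq
      (funext fun p => ?_)))) ?_)
    · exact (Category.id_comp _).trans (Category.comp_id _).symm
    · exact (Category.comp_id _).trans (Category.id_comp _).symm

/-- The components of a morphism of `C`-collections in arity `n`. -/
def restrMap {P Q : SymColl C V} (f : P ⟶ Q) (n : ℕ) : P.restr n ⟶ Q.restr n :=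
  Functor.whiskerLeft (profToList n) f

variable [MonoidalCategory V] [HasColimitsOfSize.{w, w} V]

/-- The morphism `(-)σ ⊗ (-)τ` from `P_n ⊗_{σ(i)} P_m` at `(x; y)` to `P_n ⊗_i P_m` at
`(x ∘ (σ ∘ᵢ τ); y)`. On the summand `c` it is the tensor product of the actions of `σ` and `τ`. -/
noncomputable def permuteTensor [SymmetricCategory V] [MonoidalClosed V] (P : SymColl C V)
    {n m l : ℕ} (h : n + m = l + 1) (i : Fin n) (σ : Equiv.Perm (Fin n))
    (τ : Equiv.Perm (Fin m)) :
    (partialTensor h (σ i)).obj (P.restr n, P.restr m) ⟶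
      (actAlong (permInsert h i σ τ)).obj ((partialTensor h i).obj (P.restr n, P.restr m)) :=
  (partialTensor h (σ i)).map (P.permute σ ×ₘ P.permute τ) ≫
    (eqvIso (eqvIndices h i σ τ) (P.restr n) (P.restr m)).hom

end SymColl

variable (C V) [MonoidalCategory V] [SymmetricCategory V] [MonoidalClosed V]
  [HasColimitsOfSize.{w, w} V]

/-- A (non-unital) `C`-operad in `V`. -/
structure COperad where
  coll : SymColl C V
  comp {n m l : ℕ} (h : n + m = l + 1) (i : Fin n) :
    (partialTensor h i).obj (coll.restr n, coll.restr m) ⟶ coll.restr l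
  equivariance {n m l : ℕ} (h : n + m = l + 1) (i : Fin n) (σ : Equiv.Perm (Fin n))
    (τ : Equiv.Perm (Fin m)) :
    coll.permuteTensor h i σ τ ≫ (actAlong (permInsert h i σ τ)).map (comp h i) =
      comp h (σ i) ≫ coll.permute (permInsert h i σ τ)
  assoc_seq {n m k l l' r : ℕ} (h₁ : n + m = l + 1) (h₂ : l + k = r + 1) (h₃ : m + k = l' + 1)
    (h₄ : n + l' = r + 1) (j : Fin n) (q : Fin m) :
    (partialTensor h₂ (inner h₁ j q)).map (comp h₁ j ×ₘ 𝟙 (coll.restr k)) ≫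
        comp h₂ (inner h₁ j q) =
      (seqIso (seqIndices h₁ h₂ h₃ h₄ j q) (coll.restr n) (coll.restr m) (coll.restr k)).hom ≫
        (partialTensor h₄ j).map (𝟙 (coll.restr n) ×ₘ comp h₃ q) ≫ comp h₄ j
  assoc_par {n m k l l' r : ℕ} (h₁ : n + m = l + 1) (h₂ : l + k = r + 1) (h₃ : n + k = l' + 1)
    (h₄ : l' + m = r + 1) (a b : Fin n) (hab : b ≠ a) :
    (partialTensor h₂ (outerPos h₁ a b hab)).map (comp h₁ a ×ₘ 𝟙 (coll.restr k)) ≫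
        comp h₂ (outerPos h₁ a b hab) =
      (parIso (parIndices h₁ h₂ h₃ h₄ a b hab) (coll.restr n) (coll.restr m)
        (coll.restr k)).hom ≫
        (partialTensor h₄ (outerPos h₃ b a hab.symm)).map (comp h₃ b ×ₘ 𝟙 (coll.restr m)) ≫
          comp h₄ (outerPos h₃ b a hab.symm)

namespace COperad

variable {C V}

/-- Morphisms of `C`-collections that commute with the composition maps. -/
@[ext]
structure Hom (P Q : COperad C V) where
  hom : P.coll ⟶ Q.coll
  comp_hom {n m l : ℕ} (h : n + m = l + 1) (i : Fin n) :
    P.comp h i ≫ SymColl.restrMap hom l =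
      (partialTensor h i).map (SymColl.restrMap hom n ×ₘ SymColl.restrMap hom m) ≫ Q.comp h i

instance : Category (COperad C V) where
  Hom := Hom
  id P :=
    { hom := 𝟙 P.coll
      comp_hom := fun {n m l} h i => by
        have e : ∀ k, SymColl.restrMap (𝟙 P.coll) k = 𝟙 (P.coll.restr k) := fun k => rfl
        rw [e, e, e, prod_id_eq, CategoryTheory.Functor.map_id, Category.id_comp, Category.comp_id] }
  comp {P Q R} f g :=
    { hom := f.hom ≫ g.hom
      comp_hom := fun {n m l} h i => by
        have e : ∀ k, SymColl.restrMap (f.hom ≫ g.hom) k =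
          SymColl.restrMap f.hom k ≫ SymColl.restrMap g.hom k := fun k => rfl
        rw [e, e, e, ← Category.assoc, f.comp_hom, Category.assoc, g.comp_hom, ← Category.assoc,
          ← CategoryTheory.Functor.map_comp, prod_comp] }
  id_comp f := Hom.ext (Category.id_comp _)
  comp_id f := Hom.ext (Category.comp_id _)
  assoc f g k := Hom.ext (Category.assoc _ _ _)

variable (C V) in
/-- The underlying functors `P_n` of a `C`-operad. -/
def collection : COperad C V ⥤ ∀ n, Coll C V (Fin n) where
  obj P n := P.coll.restr n
  map f n := SymColl.restrMap f.hom n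

end COperad

variable {C} in
/-- The profile `(a; b)` with one input. -/
abbrev arityOne (a b : C) : Prof C (Fin 1) := (fun _ => op a, b)

/-- A unital `C`-operad: a `C`-operad `P` with maps `u_f : I ⟶ P(a; b)` for `f : a ⟶ b`, such that
`P(f; k) u_g = u_{kgf}`, `∘₁ (u_f ⊗ 𝟙) = P(𝟙 … 𝟙; f)` and `∘ᵢ (𝟙 ⊗ u_f) = P(𝟙 … f … 𝟙; 𝟙)`. -/
structure UnitalCOperad extends COperad C V where
  unit {a b : C} (f : a ⟶ b) : 𝟙_ V ⟶ (coll.restr 1).obj (arityOne a b)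
  unit_natural {a b c d : C} (f : a ⟶ b) (g : b ⟶ c) (k : c ⟶ d) :
    unit g ≫ (coll.restr 1).map
      ((fun _ => f.op, k) : arityOne b c ⟶ arityOne a d) =
      unit (f ≫ g ≫ k)
  /-- On the summand `c = a` of `P_1 ⊗₁ P_m` at `(x; b)`. -/
  left_unit {m : ℕ} (h : 1 + m = m + 1) (x : Fin m → Cᵒᵖ) {a b : C} (f : a ⟶ b) :
    (λ_ ((coll.restr m).obj (x, a))).inv ≫
        ((unit f ≫ (coll.restr 1).map
            (profIso (a := arityOne a b) (b := (plug (outer h 0)).obj (op a, (x, b)))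
              (fun p => by
                rw [Subsingleton.elim p 0]
                exact ((leftUnitIndices h).slot_eq (op a) x).symm) rfl).hom) ⊗ₘ
          (coll.restr m).map (profIso (a := (x, a)) (b := (select (inner h (0 : Fin 1))).obj (a, (x, b)))
            (fun q => congrArg x ((leftUnitIndices h).snd q).symm) rfl).hom) ≫
        injApp (outer h 0) (inner h 0) (coll.restr 1, coll.restr m) a (x, b) ≫
          (comp h 0).app (x, b) =
      (coll.restr m).map (Prod.mkHom (𝟙 x) f)
  /-- On the summand `c = b` of `P_n ⊗ᵢ P_1` at `z`, for `f : z_i ⟶ b`. -/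
  right_unit {n : ℕ} (h : n + 1 = n + 1) (i : Fin n) (z : Prof C (Fin n)) {b : C}
    (f : (z.1 i).unop ⟶ b) :
    (ρ_ ((coll.restr n).obj ((plug (outer h i)).obj (op b, z)))).inv ≫
        ((coll.restr n).obj ((plug (outer h i)).obj (op b, z)) ◁
          (unit f ≫ (coll.restr 1).map
            (profIso (a := arityOne (z.1 i).unop b) (b := (select (inner h i)).obj (b, z))
              (fun p => by rw [Subsingleton.elim p 0]; rfl) rfl).hom)) ≫
        injApp (outer h i) (inner h i) (coll.restr n, coll.restr 1) b z ≫ (comp h i).app z =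
      (coll.restr n).map (rightFill (rightUnitIndices h i) (b := op b) f.op)

namespace UnitalCOperad

variable {C V}

/-- Morphisms of `C`-operads that commute with the units. -/
@[ext]
structure Hom (P Q : UnitalCOperad C V) extends COperad.Hom P.toCOperad Q.toCOperad where
  unit_hom {a b : C} (f : a ⟶ b) :
    P.unit f ≫ (SymColl.restrMap hom 1).app (arityOne a b) = Q.unit f

/-- The identity morphism. -/
def Hom.id (P : UnitalCOperad C V) : Hom P P where
  toHom := 𝟙 P.toCOperad
  unit_hom f := Category.comp_id _

/-- The composite of two morphisms. -/
def Hom.comp {P Q R : UnitalCOperad C V} (f : Hom P Q) (g : Hom Q R) : Hom P R where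
  toHom := CategoryStruct.comp (obj := COperad C V) f.toHom g.toHom
  unit_hom {a b} k := (Category.assoc _ _ _).symm.trans
    ((congrArg (· ≫ (SymColl.restrMap g.hom 1).app (arityOne a b)) (f.unit_hom k)).trans
      (g.unit_hom k))

instance : Category (UnitalCOperad C V) where
  Hom := Hom
  id := Hom.id
  comp := Hom.comp
  id_comp {P Q} f := Hom.ext (Category.id_comp (Hom.toHom f).hom)
  comp_id {P Q} f := Hom.ext (Category.comp_id (Hom.toHom f).hom)
  assoc f g k :=
    Hom.ext (Category.assoc (Hom.toHom f).hom (Hom.toHom g).hom (Hom.toHom k).hom)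

variable (C V) in
/-- The underlying functors `P_n` of a unital `C`-operad. -/
def collection : UnitalCOperad C V ⥤ ∀ n, Coll C V (Fin n) where
  obj P n := P.coll.restr n
  map f n := SymColl.restrMap (Hom.toHom f).hom n

end UnitalCOperad

end COperads

end CatOperad

open CatOperad

namespace CatOperad

/-! ### Collections on the free symmetric monoidal category as families with symmetric group actions
-/

section SymmetricFamilies

/-! A morphism of lists exists only between lists of equal length, and it is a list of morphisms of
`C` followed by a permutation with identity components. A functor on `(SymList C)ᵒᵖ × C` is
therefore determined by its restrictions `P_n` and the maps `(-)σ`, and conversely any family of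
functors `A_n` with compatible actions of the symmetric groups comes from such a functor
(`SymFamily.toSymColl_ofSymColl`, `SymFamily.ofSymColl_toSymColl`).

The two definitions of an operad let `σ` act in opposite directions: `(-)σ` goes from `P_n` to
`σ(P_n)`, and `σ̄` from `σ(A_n)` to `A_n`. The laws for products and for `1` make both kinds of maps
invertible, and the translation is `σ̄ = ((-)σ)⁻¹`. Inversion reverses the order of composition, so
the law `(-)τ · (-)σ = (-)(στ)` becomes `σ̄ · σ(τ̄) = (στ)‾`, with the same product on both sides.
Compositions and associativity axioms are literally the same on both sides. The two equivariance
axioms differ only by invertible permutation maps that move across the equation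
(`equivariance_iff`).

For units, `U(a; b)` is a coproduct of copies of `I` indexed by `C(a, b)`, so that a morphism `U ⟶
A_1` is a natural family of maps `u_f : I ⟶ A_1(a; b)`. Since `V` is closed, tensoring preserves
these coproducts, and two morphisms out of `A_n ⊗ᵢ U` or `U ⊗₁ A_m` agree as soon as they agree on
each copy of `I` in each summand of the coend. There the canonical isomorphisms are `A_n(𝟙 … f … 𝟙;
𝟙)` and `A_m(𝟙 … 𝟙; f)`, so the internal unit axioms become the axioms on the `u_f`
(`right_unit_iff`, `left_unit_iff`).

The resulting functors from `C`-operads to internal operads are full, faithful and bijective on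
objects, hence strictly invertible. They leave the functors `P_n` unchanged, so their inverses do so
too. -/

theorem isIso_of_eq {D : Type*} [Category* D] {a b : D} {f g : a ⟶ b} (h : f = g) (hg : IsIso g) :
    IsIso f := by
  rwa [h]

theorem inv_eq_of_eq {D : Type*} [Category* D] {a b : D} {f : a ⟶ b} {g : b ⟶ a} {hf : IsIso f}
    {hg : IsIso g} (h : f = inv g) : inv f = g := by
  subst h; simp

theorem inv_comp_inv_eq {D : Type*} [Category* D] {a b c : D} {f : a ⟶ b} {g : b ⟶ c} {k : a ⟶ c}
    {hf : IsIso f} {hg : IsIso g} {hk : IsIso k} (h : f ≫ g = k) : inv g ≫ inv f = inv k := by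
  subst h; simp

/-- The first composite makes `f` a split mono, the second makes it epi. The two outer maps need not
be known to agree, which spares an identification of the objects `c` and `d` in the applications to
group actions. -/
theorem isIso_of_isIso_comp {D : Type*} [Category* D] {a b c d : D} (f : a ⟶ b) (g : b ⟶ c)
    (g' : d ⟶ a) (h : IsIso (f ≫ g)) (h' : IsIso (g' ≫ f)) : IsIso f := by
  have : IsSplitMono f := ⟨⟨g ≫ inv (f ≫ g), by rw [← Category.assoc, IsIso.hom_inv_id]⟩⟩
  have : Epi f := epi_of_epi g' f
  exact isIso_of_epi_of_isSplitMono f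

/-- For comparing actions on families whose functors are equal but not definitionally so: the
equality can be tested on components, where source and target do agree by definition. -/
theorem heq_natTrans {A B : Type*} [Category* A] [Category* B] {F F' G G' : A ⥤ B} (hF : F = F')
    (hG : G = G') (α : F ⟶ G) (β : F' ⟶ G') (h : ∀ a, α.app a ≍ β.app a) : α ≍ β := by
  subst hF hG
  exact heq_of_eq (NatTrans.ext (funext fun a => eq_of_heq (h a)))

variable {C : Type w} [SmallCategory C] {V : Type u} [Category.{v} V]

/-- Lets an arbitrary profile appear as the second argument in the product law of an action, that
is, as a reindexed one. -/
theorem exists_reindex {n : ℕ} (σ : Equiv.Perm (Fin n)) (z : Prof C (Fin n)) :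
    ∃ z', (reindex σ).obj z' = z :=
  ⟨(fun p => z.1 (σ⁻¹ p), z.2), Prod.ext (funext fun p => by simp [reindex]) rfl⟩

/-- Functoriality of `P`. The two morphisms of lists have identity components, and in the
contravariant variable their composite is `τ` first and then `σ`, which is the permutation `σ * τ`.
Hence `(-)σ` is a right action. -/
theorem SymColl.permute_mul (P : SymColl C V) {n : ℕ} (σ τ : Equiv.Perm (Fin n))
    (z : Prof C (Fin n)) :
    (P.permute σ).app z ≫ (P.permute τ).app ((reindex σ).obj z) = (P.permute (σ * τ)).app z := by
  refine (P.map_comp _ _).symm.trans (congrArg P.map (Prod.ext (Quiver.Hom.unop_inj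
    (SymList.Hom.ext rfl (heq_of_eq (funext fun p => ?_)))) ?_))
  · exact Category.comp_id _
  · exact Category.comp_id _

theorem SymColl.permute_one (P : SymColl C V) {n : ℕ} (z : Prof C (Fin n)) :
    (P.permute 1).app z = 𝟙 _ :=
  P.map_id (op ⟨n, fun p => (z.1 p).unop⟩, z.2)

/-- The factorisation behind the whole comparison: a morphism `d ⟶ c` over `e` passes through the
list `c ∘ e`, first by the components `g` over the identity permutation, then by `e` with identity
components. In the opposite category the permutation comes first. -/
theorem SymColl.map_eq_permute_comp (P : SymColl C V) {n : ℕ} (c d : Fin n → C) (e : Fin n ≃ Fin n)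
    (g : ∀ i, d i ⟶ c (e i)) {x y : C} (k : x ⟶ y) :
    P.map (X := (op ⟨n, c⟩, x)) (Y := (op ⟨n, d⟩, y))
      (Quiver.Hom.op (X := (⟨n, d⟩ : SymList C)) (Y := ⟨n, c⟩) ⟨e, g⟩, k) =
      (P.permute e).app (fun p => op (c p), x) ≫
        (P.restr n).map (X := (fun p => op (c (e p)), x)) (Y := (fun p => op (d p), y))
          (fun p => (g p).op, k) := by
  refine Eq.trans ?_ (P.map_comp (X := (op ⟨n, c⟩, x)) (Y := (op ⟨n, fun p => c (e p)⟩, x))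
    (Z := (op ⟨n, d⟩, y))
    (Quiver.Hom.op (X := (⟨n, fun p => c (e p)⟩ : SymList C)) (Y := ⟨n, c⟩)
      ⟨e, fun p => 𝟙 _⟩, 𝟙 x)
    (Quiver.Hom.op (X := (⟨n, d⟩ : SymList C)) (Y := ⟨n, fun p => c (e p)⟩)
      ⟨Equiv.refl _, g⟩, k))
  refine congrArg P.map (Prod.ext (Quiver.Hom.unop_inj
    (SymList.Hom.ext rfl (heq_of_eq (funext fun p => ?_)))) ?_)
  · exact (Category.comp_id _).symm
  · exact (Category.id_comp _).symm

/-- The actions of `σ` and `σ⁻¹` compose in either order to the action of `1`, which is the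
identity. -/
instance SymColl.isIso_permute_app (P : SymColl C V) {n : ℕ} (σ : Equiv.Perm (Fin n))
    (z : Prof C (Fin n)) : IsIso ((P.permute σ).app z) := by
  have key (σ τ : Equiv.Perm (Fin n)) (h : σ * τ = 1) (z : Prof C (Fin n)) :
      IsIso ((P.permute σ).app z ≫ (P.permute τ).app ((reindex σ).obj z)) := by
    refine isIso_of_eq (P.permute_mul σ τ z) ?_
    exact (congrArg (fun ρ => IsIso ((P.permute ρ).app z)) h).mpr
      (isIso_of_eq (P.permute_one z) (IsIso.id _))
  -- Now the component of `σ` is the first factor of one such composite and the second factor of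
  -- another, the latter taken at the new `z`.
  obtain ⟨z, rfl⟩ := exists_reindex σ⁻¹ z
  exact isIso_of_isIso_comp _ _ _ (key σ σ⁻¹ (mul_inv_cancel σ) _)
    (key σ⁻¹ σ (inv_mul_cancel σ) z)

instance SymColl.isIso_permute (P : SymColl C V) {n : ℕ} (σ : Equiv.Perm (Fin n)) :
    IsIso (P.permute σ) :=
  NatIso.isIso_of_isIso_app _

variable (C V) in
/-- A family of functors `A_n : (Cᵒᵖ)ⁿ × C ⥤ V` with actions `σ(A_n) ⟶ A_n` of the symmetric
groups. -/
@[ext]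
structure SymFamily where
  obj (n : ℕ) : Coll C V (Fin n)
  act {n : ℕ} (σ : Equiv.Perm (Fin n)) : (actAlong σ).obj (obj n) ⟶ obj n
  act_mul {n : ℕ} (σ τ : Equiv.Perm (Fin n)) (z : Prof C (Fin n)) :
    (act τ).app ((reindex σ).obj z) ≫ (act σ).app z = (act (σ * τ)).app z
  act_one {n : ℕ} (z : Prof C (Fin n)) : (act (1 : Equiv.Perm (Fin n))).app z = 𝟙 _

namespace SymFamily

/-- The family of the functors `P_n`, on which `σ` acts by the inverse of `(-)σ`. -/
noncomputable def ofSymColl (P : SymColl C V) : SymFamily C V where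
  obj n := P.restr n
  act σ := inv (P.permute σ)
  act_mul σ τ z := by
    rw [NatIso.isIso_inv_app, NatIso.isIso_inv_app, NatIso.isIso_inv_app]
    -- Inverting reverses the composite, which turns the right action into the law for `σ̄` without
    -- changing the product `σ * τ`.
    exact inv_comp_inv_eq (P.permute_mul σ τ z)
  act_one z := by
    rw [NatIso.isIso_inv_app]
    refine @inv_eq_of_eq _ _ _ _ _ _ _ (IsIso.id _) ((P.permute_one z).trans IsIso.inv_id.symm)

variable (S : SymFamily C V)

/-- Invertibility is not part of the data of a family; it follows from the laws for products and for
`1`, as it does for `(-)σ`. This is what allows `(-)e` to be defined as the inverse of the action of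
`e`. -/
instance isIso_act_app {n : ℕ} (σ : Equiv.Perm (Fin n)) (z : Prof C (Fin n)) :
    IsIso ((S.act σ).app z) := by
  have key (σ τ : Equiv.Perm (Fin n)) (h : σ * τ = 1) (z : Prof C (Fin n)) :
      IsIso ((S.act τ).app ((reindex σ).obj z) ≫ (S.act σ).app z) := by
    refine isIso_of_eq (S.act_mul σ τ z) ?_
    exact (congrArg (fun ρ => IsIso ((S.act ρ).app z)) h).mpr
      (isIso_of_eq (S.act_one z) (IsIso.id _))
  obtain ⟨z, rfl⟩ := exists_reindex σ⁻¹ z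
  exact isIso_of_isIso_comp _ _ _ (key σ⁻¹ σ (inv_mul_cancel σ) z)
    (key σ σ⁻¹ (mul_inv_cancel σ) _)

/-- The map `A_n(c₁ … cₙ; x) ⟶ A_m(d₁ … d_m; y)` induced by a morphism of lists and a morphism
`x ⟶ y`. -/
noncomputable def mapList {n m : ℕ} (c : Fin n → C) (d : Fin m → C) (e : Fin m ≃ Fin n)
    (g : ∀ i, d i ⟶ c (e i)) {x y : C} (k : x ⟶ y) :
    (S.obj n).obj (fun p => op (c p), x) ⟶ (S.obj m).obj (fun p => op (d p), y) := by
  -- A bijection between the index sets forces the lengths to be equal, so `e` becomes a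
  -- permutation.
  obtain rfl : m = n := by simpa using Fintype.card_congr e
  -- The factorisation of `SymColl.map_eq_permute_comp`, with the inverse of the action of `e` in
  -- the role of `(-)e`.
  exact inv ((S.act e).app (fun p => op (c p), x)) ≫
    (S.obj m).map (X := (fun p => op (c (e p)), x)) (fun p => (g p).op, k)

/-- When both lengths are the same variable, the transport in `mapList` runs along a proof of `n =
n` and disappears by computation. -/
theorem mapList_perm {n : ℕ} (c d : Fin n → C) (e : Fin n ≃ Fin n)
    (g : ∀ i, d i ⟶ c (e i)) {x y : C} (k : x ⟶ y) :
    S.mapList c d e g k = inv ((S.act e).app (fun p => op (c p), x)) ≫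
      (S.obj n).map (X := (fun p => op (c (e p)), x)) (Y := (fun p => op (d p), y))
        (fun p => (g p).op, k) :=
  rfl

theorem mapList_id {n : ℕ} (c : Fin n → C) (x : C) :
    S.mapList c c (Equiv.refl _) (fun i => 𝟙 (c i)) (𝟙 x) = 𝟙 _ := by
  refine (S.mapList_perm c c (Equiv.refl _) (fun i => 𝟙 (c i)) (𝟙 x)).trans
    ((IsIso.inv_comp_eq _).2 ?_)
  exact ((S.obj n).map_id _).trans ((S.act_one _).symm.trans (Category.comp_id _).symm)

/-- The composite on the right alternates permutations and morphisms of `C`. Naturality of the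
action of `e'` moves its inverse past the morphisms induced by `g` and `f`; the product law then
merges the two permutations, and functoriality of `A_k` the two lists of morphisms. -/
theorem mapList_comp {n m k : ℕ} (c : Fin n → C) (d : Fin m → C) (b : Fin k → C)
    (e : Fin m ≃ Fin n) (g : ∀ i, d i ⟶ c (e i)) (e' : Fin k ≃ Fin m)
    (g' : ∀ i, b i ⟶ d (e' i)) {x y z : C} (f : x ⟶ y) (f' : y ⟶ z) :
    S.mapList c b (e'.trans e) (fun i => g' i ≫ g (e' i)) (f ≫ f') =
      S.mapList c d e g f ≫ S.mapList d b e' g' f' := by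
  obtain rfl : m = n := by simpa using Fintype.card_congr e
  obtain rfl : k = m := by simpa using Fintype.card_congr e'
  have h2 := (S.act e').naturality
    (X := (fun p => op (c (e p)), x)) (Y := (fun p => op (d p), y)) (fun p => (g p).op, f)
  refine (S.mapList_perm c b (e'.trans e) (fun i => g' i ≫ g (e' i)) (f ≫ f')).trans
    ((IsIso.inv_comp_eq _).2 ?_)
  refine ((S.obj k).map_comp (X := (fun p => op (c (e (e' p))), x))
    (Y := (fun p => op (d (e' p)), y)) (Z := (fun p => op (b p), z))
    (fun p => (g (e' p)).op, f) (fun p => (g' p).op, f')).trans ?_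
  -- The action of the composite permutation is split by the product law, with `e` acting last, so
  -- that its inverse in the first `mapList` can cancel against it.
  refine Eq.trans ?_ (congrArg₂ (· ≫ ·) (S.act_mul e e' (fun p => op (c p), x))
    (congrArg₂ (· ≫ ·) (S.mapList_perm c d e g f) (S.mapList_perm d b e' g' f')).symm)
  -- The remaining diagram chase, for abstract morphisms: `q` and `q'` stand for the actions of `e`
  -- and `e'`, `r` for the action of `e'` on the reindexed profile, and `h` is the naturality square
  -- `h2`.
  have key {D : Type u} [Category.{v} D] {a₀ a₁ a₂ a₃ a₄ a₅ : D} (q : a₀ ⟶ a₁) {_ : IsIso q}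
      (r : a₂ ⟶ a₀) (m : a₀ ⟶ a₃) (q' : a₄ ⟶ a₃) {_ : IsIso q'} (m' : a₄ ⟶ a₅) (m'' : a₂ ⟶ a₄)
      (h : m'' ≫ q' = r ≫ m) : m'' ≫ m' = (r ≫ q) ≫ (inv q ≫ m) ≫ inv q' ≫ m' := by
    simp only [Category.assoc, IsIso.hom_inv_id_assoc]
    rw [← Category.assoc r, ← h]
    simp
  exact key _ _ _ _ _ _ h2

/-- The `C`-collection with restrictions `A_n`. -/
noncomputable def toSymColl : SymColl C V where
  obj a := (S.obj a.1.unop.len).obj (fun p => op (a.1.unop.obj p), a.2)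
  map f := S.mapList _ _ f.1.unop.perm f.1.unop.map f.2
  map_id a := S.mapList_id _ _
  map_comp f g := S.mapList_comp _ _ _ _ _ _ _ _ _

/-- Both functors have the same objects by definition. On a morphism, the factorisation of
`SymColl.map_eq_permute_comp` is reproduced, since the action is inverted twice. -/
theorem toSymColl_ofSymColl (P : SymColl C V) : (ofSymColl P).toSymColl = P := by
  refine CategoryTheory.Functor.hext (fun _ => rfl) ?_
  rintro ⟨⟨n, c⟩, x⟩ ⟨⟨m, d⟩, y⟩ ⟨⟨e, g⟩, k⟩
  obtain rfl : m = n := by simpa using Fintype.card_congr e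
  refine heq_of_eq (Eq.trans ?_ (SymColl.map_eq_permute_comp P c d e g k).symm)
  refine ((ofSymColl P).mapList_perm c d e g k).trans (congrArg (· ≫ _) ?_)
  exact inv_eq_of_eq (NatIso.isIso_inv_app (P.permute e) _)

/-- The restriction uses only morphisms over the identity permutation, for which the permutation
factor of `mapList` is the inverse of the action of `1`. -/
theorem restr_toSymColl (n : ℕ) : S.toSymColl.restr n = S.obj n := by
  refine CategoryTheory.Functor.hext (fun _ => rfl) fun z z' f => heq_of_eq ?_
  refine (S.mapList_perm (fun p => (z.1 p).unop) (fun p => (z'.1 p).unop) (Equiv.refl _)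
    (fun p => (f.1 p).unop) f.2).trans ((IsIso.inv_comp_eq _).2 ?_)
  exact ((Category.id_comp _).symm.trans (congrArg (· ≫ (S.obj n).map f) (S.act_one z).symm))

/-- Here the other factor of `mapList` is trivial: `A_n` is applied to identities. -/
theorem permute_toSymColl_app {n : ℕ} (σ : Equiv.Perm (Fin n)) (z : Prof C (Fin n)) :
    (S.toSymColl.permute σ).app z = inv ((S.act σ).app z) := by
  refine (S.mapList_perm (fun p => (z.1 p).unop) (fun p => (z.1 (σ p)).unop) σ
    (fun p => 𝟙 _) (𝟙 z.2)).trans ?_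
  refine (congrArg (_ ≫ ·) ((S.obj n).map_id _)).trans (Category.comp_id _)

/-- The functors agree only by the equality `restr_toSymColl`, so the actions have to be compared as
heterogeneous equals. Their components have the same source and target by definition, and there the
claim is again that inverting twice does nothing. -/
theorem ofSymColl_toSymColl : ofSymColl S.toSymColl = S := by
  have h : (ofSymColl S.toSymColl).obj = S.obj := funext S.restr_toSymColl
  refine SymFamily.ext h ?_
  refine Function.hfunext rfl fun n n' hn => ?_
  obtain rfl := eq_of_heq hn
  refine Function.hfunext rfl fun σ σ' hσ => ?_
  obtain rfl := eq_of_heq hσ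
  refine heq_natTrans (congrArg _ (S.restr_toSymColl n)) (S.restr_toSymColl n) _ _ fun z => ?_
  refine heq_of_eq ?_
  exact (NatIso.isIso_inv_app _ _).trans (inv_eq_of_eq (S.permute_toSymColl_app σ z))

end SymFamily

end SymmetricFamilies

/-! ### Strict inverses of fully faithful functors that are bijective on objects -/

/-- On objects the inverse is the inverse bijection; on morphisms it is the preimage under `G` of
the morphism conjugated by the identifications `G (g x) = x`. As `G` is faithful, functoriality and
the equation for `G ⋙ F` may be checked after applying `G`. -/
theorem exists_strict_inverse {D : Type*} [Category* D] {E : Type*} [Category* E] (G : D ⥤ E)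
    [G.Full] [G.Faithful] (hG : Function.Bijective G.obj) :
    ∃ F : E ⥤ D, F ⋙ G = 𝟭 _ ∧ G ⋙ F = 𝟭 _ := by
  obtain ⟨g, hl, hr⟩ := Function.bijective_iff_has_inverse.1 hG
  let F : E ⥤ D :=
    { obj := g
      map := fun {x y} f => G.preimage (eqToHom (hr x) ≫ f ≫ eqToHom (hr y).symm)
      map_id := fun x => G.map_injective (by simp)
      map_comp := fun f f' => G.map_injective (by simp) }
  refine ⟨F, CategoryTheory.Functor.ext hr fun x y f => G.map_preimage _,
    CategoryTheory.Functor.ext hl fun x y f => G.map_injective ?_⟩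
  refine (G.map_preimage _).trans ?_
  simp [eqToHom_map]

/-! ### The comparison of non-unital operads -/

section Comparison

variable {C : Type w} [SmallCategory C] {V : Type u} [Category.{v} V]

/-- The formal part of the passage between the two equivariance axioms: `m` and `p` are the
permutation maps before and after the compositions, and each is moved to the other side by its
inverse. The inverse of `m` is an explicit `m'`, because it arises as the image of a pair of
inverses under a functor. -/
theorem comp_inv_iff {D : Type*} [Category* D] {a b c d e : D} {m : a ⟶ b} {m' : b ⟶ a}
    (h : m ≫ m' = 𝟙 a) (h' : m' ≫ m = 𝟙 b) {s : b ⟶ c} {t : c ⟶ d} {k : a ⟶ e} {p : e ⟶ d}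
    {_ : IsIso p} : (m ≫ s) ≫ t = k ≫ p ↔ m' ≫ k = s ≫ t ≫ inv p := by
  constructor
  · intro H
    rw [← Category.assoc s, IsIso.eq_comp_inv, Category.assoc, ← H]
    simp only [← Category.assoc, h', Category.id_comp]
  · intro H
    rw [← Category.assoc s, IsIso.eq_comp_inv, Category.assoc] at H
    rw [Category.assoc, ← H, ← Category.assoc, h, Category.id_comp]

/-- A family of morphisms that commutes with the actions of permutations is a morphism of
`C`-collections. -/
def SymColl.homMk {P Q : SymColl C V} (f : ∀ n, P.restr n ⟶ Q.restr n)
    (hf : ∀ {n : ℕ} (σ : Equiv.Perm (Fin n)) (z : Prof C (Fin n)),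
      (P.permute σ).app z ≫ (f n).app ((reindex σ).obj z) =
        (f n).app z ≫ (Q.permute σ).app z) : P ⟶ Q where
  app a := (f a.1.unop.len).app (fun p => op (a.1.unop.obj p), a.2)
  naturality := by
    rintro ⟨⟨n, c⟩, x⟩ ⟨⟨m, d⟩, y⟩ ⟨⟨e, g⟩, k⟩
    obtain rfl : m = n := by simpa using Fintype.card_congr e
    -- Naturality is tested on the two factors of a morphism of lists: for morphisms of `C` it is
    -- naturality of `f m`, for the permutation it is the hypothesis `hf`.
    refine (congrArg (· ≫ _) (SymColl.map_eq_permute_comp P c d e g k)).trans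
      (Eq.trans ?_ (congrArg (_ ≫ ·) (SymColl.map_eq_permute_comp Q c d e g k)).symm)
    have h := (f m).naturality (X := (fun p => op (c (e p)), x)) (Y := (fun p => op (d p), y))
      (fun p => (g p).op, k)
    refine (Category.assoc _ _ _).trans ((congrArg (_ ≫ ·) h).trans ?_)
    refine (Category.assoc _ _ _).symm.trans ((congrArg (· ≫ _) (hf e _)).trans ?_)
    exact Category.assoc _ _ _

variable [MonoidalCategory V] [SymmetricCategory V] [MonoidalClosed V]
  [HasColimitsOfSize.{w, w} V]

/-- `permuteTensor` is the tensor product of `(-)σ` and `(-)τ` followed by the canonical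
isomorphism. Inverting that tensor product and the permutation after `c'` turns the axiom of a
`C`-operad, for `c` at `i` and `c'` at `σ i`, into the axiom of an internal operad for the inverse
actions. -/
theorem equivariance_iff (P : SymColl C V) {n m l : ℕ} (h : n + m = l + 1) (i : Fin n)
    (σ : Equiv.Perm (Fin n)) (τ : Equiv.Perm (Fin m))
    (c : (partialTensor h i).obj (P.restr n, P.restr m) ⟶ P.restr l)
    (c' : (partialTensor h (σ i)).obj (P.restr n, P.restr m) ⟶ P.restr l) :
    P.permuteTensor h i σ τ ≫ (actAlong (permInsert h i σ τ)).map c =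
        c' ≫ P.permute (permInsert h i σ τ) ↔
      (partialTensor h (σ i)).map (inv (P.permute σ) ×ₘ inv (P.permute τ)) ≫ c' =
        (eqvIso (eqvIndices h i σ τ) (P.restr n) (P.restr m)).hom ≫
          (actAlong (permInsert h i σ τ)).map c ≫ inv (P.permute (permInsert h i σ τ)) := by
  refine comp_inv_iff (m := (partialTensor h (σ i)).map (P.permute σ ×ₘ P.permute τ)) ?_ ?_
  · rw [← CategoryTheory.Functor.map_comp, prod_comp, IsIso.hom_inv_id, IsIso.hom_inv_id]
    exact CategoryTheory.Functor.map_id _ _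
  · rw [← CategoryTheory.Functor.map_comp, prod_comp, IsIso.inv_hom_id, IsIso.inv_hom_id]
    exact CategoryTheory.Functor.map_id _ _

/-- The internal operad with the objects `P_n` and the same compositions, on which `σ` acts by the
inverse of `(-)σ`. -/
noncomputable def COperad.toInternal (P : COperad C V) :
    InternalOperad (CV C V).toCategoricalOperadData where
  obj n := P.coll.restr n
  act σ := (SymFamily.ofSymColl P.coll).act σ
  -- The isomorphisms `actMul` and `actOne` of `CV` have identity components, so these axioms are
  -- the laws of a symmetric family up to composition with an identity.
  act_mul {n} σ τ := NatTrans.ext (funext fun (z : Prof C (Fin n)) =>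
    ((SymFamily.ofSymColl P.coll).act_mul σ τ z).trans (Category.id_comp _).symm)
  act_one n := NatTrans.ext (funext fun (z : Prof C (Fin n)) =>
    (SymFamily.ofSymColl P.coll).act_one z)
  comp h i := P.comp h i
  -- The compositions are unchanged and the canonical isomorphisms in `CV` are the ones used for
  -- `C`-operads, so the associativity axioms agree by definition.
  assoc_seq h₁ h₂ h₃ h₄ j q := P.assoc_seq h₁ h₂ h₃ h₄ j q
  assoc_par h₁ h₂ h₃ h₄ a b hab := P.assoc_par h₁ h₂ h₃ h₄ a b hab
  equivariance h i σ τ := (equivariance_iff P.coll h i σ τ _ _).1 (P.equivariance h i σ τ)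

/-- Naturality of `f` at the morphism of lists given by `σ` with identity components. -/
theorem SymColl.restrMap_permute {P Q : SymColl C V} (f : P ⟶ Q) {n : ℕ}
    (σ : Equiv.Perm (Fin n)) :
    P.permute σ ≫ (actAlong σ).map (restrMap f n) = restrMap f n ≫ Q.permute σ :=
  NatTrans.ext (funext fun z => f.naturality _)

theorem inv_comp_eq_comp_inv_iff {D : Type*} [Category* D] {a b c d : D} {p : a ⟶ b}
    {q : c ⟶ d} {f : a ⟶ c} {g : b ⟶ d} {hp : IsIso p} {hq : IsIso q} :
    inv p ≫ f = g ≫ inv q ↔ p ≫ g = f ≫ q := by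
  rw [IsIso.inv_comp_eq, ← Category.assoc, IsIso.eq_comp_inv, eq_comm]

/-- This is the condition on a morphism of internal operads to respect `σ̄`. A natural
transformation of collections satisfies it automatically, which is why morphisms of `C`-operads
carry no separate condition on permutations. -/
theorem SymColl.inv_permute_restrMap {P Q : SymColl C V} (f : P ⟶ Q) {n : ℕ}
    (σ : Equiv.Perm (Fin n)) :
    inv (P.permute σ) ≫ restrMap f n = (actAlong σ).map (restrMap f n) ≫ inv (Q.permute σ) :=
  inv_comp_eq_comp_inv_iff.2 (restrMap_permute f σ)

variable (C V) in
/-- The comparison functor from `C`-operads to internal operads. -/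
noncomputable def comparison : COperad C V ⥤ InternalOperad (CV C V).toCategoricalOperadData where
  obj P := P.toInternal
  map {P Q} f :=
    { app := fun n => SymColl.restrMap f.hom n
      act_app := fun {n} σ => SymColl.inv_permute_restrMap f.hom σ
      comp_app := fun h i => f.comp_hom h i }
  map_id P := rfl
  map_comp f g := rfl

/-- Each object of `(SymList C)ᵒᵖ × C` is a profile of some length, so the components in the
separate arities are all the components. -/
instance : (comparison C V).Faithful where
  map_injective {P Q} f g h := COperad.Hom.ext (NatTrans.ext (funext fun a => by
    have h' : ∀ n, SymColl.restrMap f.hom n = SymColl.restrMap g.hom n :=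
      fun n => congrFun (congrArg InternalOperad.Hom.app h) n
    exact congrArg (fun t => NatTrans.app t
      ((fun p => op (a.1.unop.obj p), a.2) : Prof C (Fin a.1.unop.len))) (h' _)))

/-- Compatibility with the actions `σ̄` is inverted to compatibility with `(-)σ`; together with
naturality in each arity this is naturality on all of `(SymList C)ᵒᵖ × C`, by `SymColl.homMk`. -/
instance : (comparison C V).Full where
  map_surjective {P Q} f := by
    let t (n : ℕ) : P.coll.restr n ⟶ Q.coll.restr n := InternalOperad.Hom.app f n
    have ht {n : ℕ} (σ : Equiv.Perm (Fin n)) :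
        P.coll.permute σ ≫ (actAlong σ).map (t n) = t n ≫ Q.coll.permute σ :=
      (inv_comp_eq_comp_inv_iff (hp := P.coll.isIso_permute σ)
        (hq := Q.coll.isIso_permute σ)).1 (InternalOperad.Hom.act_app f σ)
    exact ⟨⟨SymColl.homMk t fun σ z => congrArg (fun t => NatTrans.app t z) (ht σ),
      fun h i => InternalOperad.Hom.comp_app f h i⟩, rfl⟩

/-- The objects of an internal operad in `C_V` and the actions on them. -/
def symFamily (A : InternalOperad (CV C V).toCategoricalOperadData) : SymFamily C V where
  obj := A.obj
  act := A.act
  act_mul {n} σ τ z := (congrArg (fun t => NatTrans.app t z) (A.act_mul σ τ)).trans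
    (Category.id_comp _)
  act_one {n} z := congrArg (fun t => NatTrans.app t z) (A.act_one n)

/-- The family of objects and actions of the internal operad determines the collection, and the
compositions are kept as they are. -/
theorem comparison_obj_injective : Function.Injective (comparison C V).obj := by
  intro P Q h
  have h' : SymFamily.ofSymColl P.coll = SymFamily.ofSymColl Q.coll := congrArg symFamily h
  have hc : P.coll = Q.coll := by
    rw [← SymFamily.toSymColl_ofSymColl P.coll, h', SymFamily.toSymColl_ofSymColl]
  rcases P with ⟨P, c, _, _, _⟩
  rcases Q with ⟨Q, c', _, _, _⟩
  obtain rfl : P = Q := hc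
  -- With the collections identified, both compositions have the same type, and the equality of
  -- internal operads can be read off field by field.
  obtain rfl : @c = @c' := by
    have h : COperad.toInternal ⟨P, c, _, _, _⟩ = COperad.toInternal ⟨P, c', _, _, _⟩ := h
    unfold COperad.toInternal at h
    injection h
  rfl

/-- The collection is assembled from the objects and actions of `A`; the compositions of `A` are
then compositions on its restrictions, and equivariance is inverted by `equivariance_iff`. -/
theorem comparison_obj_surjective : Function.Surjective (comparison C V).obj := by
  intro A
  -- `P` is kept opaque, known only through an equality of families. The objects and actions of `A`
  -- can then be replaced by those of `P`, so that no composition has to be transported along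
  -- `restr_toSymColl`.
  obtain ⟨P, hP⟩ : ∃ P, SymFamily.ofSymColl P = symFamily A :=
    ⟨_, (symFamily A).ofSymColl_toSymColl⟩
  rcases A with ⟨obj, act, act_mul, act_one, comp, seq, par, eqv⟩
  unfold SymFamily.ofSymColl symFamily at hP
  injection hP with h₁ h₂
  dsimp only at h₁ h₂
  subst h₁
  obtain rfl : @act = fun {n} σ => inv (P.permute σ) := (eq_of_heq h₂).symm
  exact ⟨⟨P, comp, fun h i σ τ => (equivariance_iff P h i σ τ _ _).2 (eqv h i σ τ), seq, par⟩, rfl⟩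

end Comparison

/-! ### Morphisms out of `U` as natural families of points -/

section UnitPoints

variable {C : Type w} [SmallCategory C] {V : Type u} [Category.{v} V] [MonoidalCategory V]
  [HasColimitsOfSize.{w, w} V] {X : Coll C V (Fin 1)}

/-- The component `I ⟶ X(a; b)` at `f : a ⟶ b` of a morphism `U ⟶ X`. -/
noncomputable def unitPoint (t : unitColl C V ⟶ X) {a b : C} (f : a ⟶ b) :
    𝟙_ V ⟶ X.obj (arityOne a b) :=
  Sigma.ι (fun _ : (a ⟶ b) => 𝟙_ V) f ≫ t.app (arityOne a b)

/-- Naturality of `t`: the functor `U` carries the copy of `I` with index `f` to the copy whose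
index is `f` composed with the identifications of its ends. This is needed because the profiles
produced by `plug` and `select` are equal to profiles `(a; b)` without having that form. -/
theorem ι_app_profIso (t : unitColl C V ⟶ X) {a b : C} (f : a ⟶ b) {z : Prof C (Fin 1)}
    (h : ∀ p, (arityOne a b).1 p = z.1 p) (h' : (arityOne a b).2 = z.2)
    (g : (z.1 0).unop ⟶ z.2) (hg : g = (eqToHom (h 0)).unop ≫ f ≫ eqToHom h') :
    unitPoint t f ≫ X.map (profIso h h').hom =
      Sigma.ι (fun _ : ((z.1 0).unop ⟶ z.2) => 𝟙_ V) g ≫ t.app z := by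
  subst hg
  refine (Category.assoc _ _ _).trans ((congrArg
    (Sigma.ι (fun _ : (a ⟶ b) => 𝟙_ V) f ≫ ·) (t.naturality (profIso h h').hom).symm).trans ?_)
  refine (Category.assoc _ _ _).symm.trans (congrArg (· ≫ t.app z) ?_)
  exact unitColl_ι_map (V := V) (profIso h h').hom f

/-- Again naturality of `t`, now at an arbitrary morphism of profiles with one input; it gives the
axiom `P(f; k) u_g = u_{kgf}` of a unital `C`-operad. -/
theorem unitPoint_natural (t : unitColl C V ⟶ X) {a b c d : C} (f : a ⟶ b) (g : b ⟶ c)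
    (k : c ⟶ d) :
    unitPoint t g ≫ X.map ((fun _ => f.op, k) : arityOne b c ⟶ arityOne a d) =
      unitPoint t (f ≫ g ≫ k) := by
  refine (Category.assoc _ _ _).trans ((congrArg
    (Sigma.ι (fun _ : (b ⟶ c) => 𝟙_ V) g ≫ ·) (t.naturality
      ((fun _ => f.op, k) : arityOne b c ⟶ arityOne a d)).symm).trans ?_)
  refine (Category.assoc _ _ _).symm.trans (congrArg (· ≫ t.app (arityOne a d)) ?_)
  exact unitColl_ι_map (V := V) ((fun _ => f.op, k) : arityOne b c ⟶ arityOne a d) g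

theorem unitPoint_comp {Y : Coll C V (Fin 1)} (t : unitColl C V ⟶ X) (s : X ⟶ Y) {a b : C}
    (f : a ⟶ b) : unitPoint (t ≫ s) f = unitPoint t f ≫ s.app (arityOne a b) :=
  (Category.assoc _ _ _).symm

/-- A map out of the coproduct `U(z)` is determined on the copies of `I`. A profile `z` with one
input is identified with `(z_0; y)`, at which the points are taken. -/
theorem unit_hom_ext {t t' : unitColl C V ⟶ X}
    (h : ∀ {a b : C} (f : a ⟶ b), unitPoint t f = unitPoint t' f) : t = t' := by
  refine NatTrans.ext (funext fun z => Sigma.hom_ext _ _ fun f => ?_)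
  have hz (p : Fin 1) : (arityOne (z.1 0).unop z.2).1 p = z.1 p := by
    rw [Subsingleton.elim p 0]
  have e (t : unitColl C V ⟶ X) := ι_app_profIso t f hz rfl f (by simp)
  rw [← e, ← e, h]

/-- The morphism `U ⟶ X` given by a natural family of maps `I ⟶ X(a; b)`. -/
noncomputable def unitDesc (u : ∀ {a b : C} (_ : a ⟶ b), 𝟙_ V ⟶ X.obj (arityOne a b))
    (hu : ∀ {a b c d : C} (f : a ⟶ b) (g : b ⟶ c) (k : c ⟶ d),
      u g ≫ X.map ((fun _ => f.op, k) : arityOne b c ⟶ arityOne a d) = u (f ≫ g ≫ k)) :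
    unitColl C V ⟶ X where
  app z := Sigma.desc fun f : ((z.1 0).unop ⟶ z.2) => u f ≫
    X.map (profIso (a := arityOne (z.1 0).unop z.2) (b := z)
      (fun p => by rw [Subsingleton.elim p 0]) rfl).hom
  naturality z z' r := by
    refine Sigma.hom_ext _ _ fun f => ?_
    refine (Category.assoc _ _ _).symm.trans ((congrArg (· ≫ _) (unitColl_ι_map r f)).trans ?_)
    refine (Sigma.ι_desc _ _).trans ?_
    refine Eq.trans ?_ ((congrArg (· ≫ X.map r) (Sigma.ι_desc (fun f : ((z.1 0).unop ⟶ z.2) =>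
      u f ≫ X.map (profIso (a := arityOne (z.1 0).unop z.2) (b := z)
        (fun p => by rw [Subsingleton.elim p 0]) rfl).hom) f).symm).trans (Category.assoc _ _ _))
    -- The hypothesis `hu` splits the point at the composite index into the point at `f` and a map
    -- between profiles of the form `(a; b)`; what is left is an equality of two morphisms of
    -- profiles.
    rw [← hu, Category.assoc, Category.assoc, ← CategoryTheory.Functor.map_comp,
      ← CategoryTheory.Functor.map_comp]
    refine congrArg (fun t => u f ≫ X.map t) (Prod.ext (funext fun p => ?_) ?_)
    · rw [Subsingleton.elim p 0]
      exact (Category.comp_id (r.1 0)).trans (Category.id_comp (r.1 0)).symm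
    · exact (Category.comp_id r.2).trans (Category.id_comp r.2).symm

/-- At a profile of the form `(a; b)` the identification inserted in `unitDesc` is the identity. -/
theorem unitPoint_unitDesc (u : ∀ {a b : C} (_ : a ⟶ b), 𝟙_ V ⟶ X.obj (arityOne a b))
    (hu : ∀ {a b c d : C} (f : a ⟶ b) (g : b ⟶ c) (k : c ⟶ d),
      u g ≫ X.map ((fun _ => f.op, k) : arityOne b c ⟶ arityOne a d) = u (f ≫ g ≫ k))
    {a b : C} (f : a ⟶ b) : unitPoint (unitDesc u hu) f = u f :=
  (Sigma.ι_desc (β := (a ⟶ b)) _ f).trans ((congrArg (u f ≫ ·) (X.map_id _)).trans (Category.comp_id _))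

end UnitPoints

/-! ### The unit axioms, tested on points -/

section UnitAxioms

variable {C : Type w} [SmallCategory C] {V : Type u} [Category.{v} V] [MonoidalCategory V]
  [SymmetricCategory V] [MonoidalClosed V] [HasColimitsOfSize.{w, w} V] {X : Coll C V (Fin 1)}
  {L : Type}

section Right

variable {φ : L → Option L} {ψ : Fin 1 → L}

/-- The restriction of `• · (𝟙 ⊗ᵢ t)` to the copy of `I` with index `f` in the summand `b`. The
coend injection is natural in its second factor, so `t` moves inside the summand and meets the
injection of the copy, where it becomes the point at `f`. -/
theorem rightPoint_inj_map (Y : Coll C V L) (t : unitColl C V ⟶ X)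
    (k : (tensorAlong φ ψ).obj (Y, X) ⟶ Y) (z : Prof C L) {b : C}
    (f : (z.1 (ψ 0)).unop ⟶ b) :
    rightPoint φ ψ Y (op b) b z f ≫ injApp φ ψ (Y, unitColl C V) b z ≫
        ((tensorAlong φ ψ).map (𝟙 Y ×ₘ t) ≫ k).app z =
      (ρ_ (Y.obj ((plug φ).obj (op b, z)))).inv ≫
        (Y.obj ((plug φ).obj (op b, z)) ◁
          (unitPoint t f ≫ X.map
            (profIso (a := arityOne (z.1 (ψ 0)).unop b) (b := (select ψ).obj (b, z))
              (fun p => by rw [Subsingleton.elim p 0]; rfl) rfl).hom)) ≫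
        injApp φ ψ (Y, X) b z ≫ k.app z := by
  have e : unitPoint t f ≫ X.map
      (profIso (a := arityOne (z.1 (ψ 0)).unop b) (b := (select ψ).obj (b, z))
        (fun p => by rw [Subsingleton.elim p 0]; rfl) rfl).hom =
      Sigma.ι (fun _ : ((z.1 (ψ 0)).unop ⟶ b) => 𝟙_ V) f ≫
        t.app ((select ψ).obj (b, z)) :=
    ι_app_profIso (z := (select ψ).obj (b, z)) t f _ rfl f
      ((Category.id_comp (f ≫ 𝟙 b)).trans (Category.comp_id f)).symm
  rw [e]
  -- With identities in all other variables, the map induced on a summand is a whiskering of `t`.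
  have e' : summandMap φ ψ (XY := (Y, unitColl C V)) (XY' := (Y, X)) (𝟙 Y ×ₘ t) (𝟙 (op b)) (𝟙 b)
      (𝟙 z) = Y.obj ((plug φ).obj (op b, z)) ◁ t.app ((select ψ).obj (b, z)) := by
    have h1 : (plug φ).map (Prod.mkHom (𝟙 (op b)) (𝟙 z)) = 𝟙 _ := (plug φ).map_id (op b, z)
    have h2 : (select ψ).map (Prod.mkHom (𝟙 b) (𝟙 z)) = 𝟙 _ := (select ψ).map_id (b, z)
    rw [summandMap, h1, h2, CategoryTheory.Functor.map_id, CategoryTheory.Functor.map_id,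
      Category.id_comp]
    exact (congrArg (fun s => 𝟙 (Y.obj ((plug φ).obj (op b, z))) ⊗ₘ s)
      (Category.id_comp _)).trans (id_tensorHom _ _)
  have e'' := injApp_map φ ψ (XY := (Y, unitColl C V)) (XY' := (Y, X)) (𝟙 Y ×ₘ t) b z
  rw [e'] at e''
  refine (congrArg (_ ≫ ·) ((Category.assoc _ _ _).symm.trans
    (congrArg (· ≫ k.app z) e''))).trans ?_
  have key {A B B' T T' : V} (i : 𝟙_ V ⟶ B) (s : B ⟶ B') (r : A ⊗ B' ⟶ T) (r' : T ⟶ T') :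
      ((ρ_ A).inv ≫ A ◁ i) ≫ (A ◁ s ≫ r) ≫ r' = (ρ_ A).inv ≫ A ◁ (i ≫ s) ≫ r ≫ r' := by
    simp
  exact key _ _ _ _

/-- The coend injections, followed by the copies of `I` in the second factor, are jointly
epimorphic, the latter because tensoring with an object of the closed category `V` preserves
coproducts. On each copy `rightPoint_inj_map` computes one side, and the canonical isomorphism is
`Y(𝟙 … f … 𝟙; 𝟙)` there by construction. -/
theorem right_unit_iff (H : RightUnitIndices φ ψ) (Y : Coll C V L) (t : unitColl C V ⟶ X)
    (k : (tensorAlong φ ψ).obj (Y, X) ⟶ Y) :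
    (tensorAlong φ ψ).map (𝟙 Y ×ₘ t) ≫ k = (rightUnitIso H Y).hom ↔
      ∀ (z : Prof C L) {b : C} (f : (z.1 (ψ 0)).unop ⟶ b),
        (ρ_ (Y.obj ((plug φ).obj (op b, z)))).inv ≫
          (Y.obj ((plug φ).obj (op b, z)) ◁
            (unitPoint t f ≫ X.map
              (profIso (a := arityOne (z.1 (ψ 0)).unop b) (b := (select ψ).obj (b, z))
                (fun p => by rw [Subsingleton.elim p 0]; rfl) rfl).hom)) ≫
          injApp φ ψ (Y, X) b z ≫ k.app z = Y.map (rightFill H (b := op b) f.op) := by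
  have e (z : Prof C L) {b : C} (f : (z.1 (ψ 0)).unop ⟶ b) :
      rightPoint φ ψ Y (op b) b z f ≫ injApp φ ψ (Y, unitColl C V) b z ≫
        (rightUnitIso H Y).hom.app z = Y.map (rightFill H (b := op b) f.op) :=
    (congrArg (_ ≫ ·) (inj_rightUnitHom H Y b z)).trans (rightPoint_unit H Y b z f)
  constructor
  · intro h z b f
    rw [← rightPoint_inj_map, h, e]
  · intro h
    refine NatTrans.ext (funext fun z => tensor_app_hom_ext φ ψ fun b =>
      rightPoint_hom_ext fun f => ?_)
    exact (rightPoint_inj_map Y t k z f).trans ((h z f).trans (e z f).symm)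

end Right

section Left

variable {φ : Fin 1 → Option L} {ψ : L → L}

/-- The counterpart of `rightPoint_inj_map` for `• · (t ⊗₁ 𝟙)`. Since `ψ` is the identity only
pointwise, `leftPoint` starts at the profile `(x ∘ ψ; a)`; the identification in front makes both
sides start at `(x; a)`, as in the axiom for `u_f`. -/
theorem leftPoint_inj_map (H : LeftUnitIndices φ ψ) (Y : Coll C V L) (t : unitColl C V ⟶ X)
    (k : (tensorAlong φ ψ).obj (X, Y) ⟶ Y) (x : L → Cᵒᵖ) {a b : C} (f : a ⟶ b) :
    Y.map (profIso (a := (x, a)) (b := (select ψ).obj (a, (x, b)))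
        (fun q => congrArg x (H.snd q).symm) rfl).hom ≫
      leftPoint H Y (op a) a (x, b) f ≫ injApp φ ψ (unitColl C V, Y) a (x, b) ≫
        ((tensorAlong φ ψ).map (t ×ₘ 𝟙 Y) ≫ k).app (x, b) =
      (λ_ (Y.obj (x, a))).inv ≫
        ((unitPoint t f ≫ X.map
            (profIso (a := arityOne a b) (b := (plug φ).obj (op a, (x, b)))
              (fun p => by
                rw [Subsingleton.elim p 0]
                exact (H.slot_eq (op a) x).symm) rfl).hom) ⊗ₘ
          Y.map (profIso (a := (x, a)) (b := (select ψ).obj (a, (x, b)))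
            (fun q => congrArg x (H.snd q).symm) rfl).hom) ≫
        injApp φ ψ (X, Y) a (x, b) ≫ k.app (x, b) := by
  have e : unitPoint t f ≫ X.map
      (profIso (a := arityOne a b) (b := (plug φ).obj (op a, (x, b)))
        (fun p => by
          rw [Subsingleton.elim p 0]
          exact (H.slot_eq (op a) x).symm) rfl).hom =
      Sigma.ι (fun _ : ((slot (op a) x (φ 0)).unop ⟶ b) => 𝟙_ V)
        ((eqToHom (H.slot_eq (op a) x).symm).unop ≫ f) ≫
          t.app ((plug φ).obj (op a, (x, b))) :=
    ι_app_profIso (z := (plug φ).obj (op a, (x, b))) t f _ rfl _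
      (congrArg ((eqToHom (H.slot_eq (op a) x).symm).unop ≫ ·) (Category.comp_id f).symm)
  rw [e]
  have e' : summandMap φ ψ (XY := (unitColl C V, Y)) (XY' := (X, Y)) (t ×ₘ 𝟙 Y) (𝟙 (op a)) (𝟙 a)
      (𝟙 (x, b)) = t.app ((plug φ).obj (op a, (x, b))) ▷ Y.obj ((select ψ).obj (a, (x, b))) := by
    have h1 : (plug φ).map (Prod.mkHom (𝟙 (op a)) (𝟙 (x, b))) = 𝟙 _ :=
      (plug φ).map_id (op a, (x, b))
    have h2 : (select ψ).map (Prod.mkHom (𝟙 a) (𝟙 (x, b))) = 𝟙 _ := (select ψ).map_id (a, (x, b))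
    rw [summandMap, h1, h2, CategoryTheory.Functor.map_id, CategoryTheory.Functor.map_id,
      Category.id_comp]
    exact (congrArg _ (Category.id_comp _)).trans (tensorHom_id _ _)
  have e'' := injApp_map φ ψ (XY := (unitColl C V, Y)) (XY' := (X, Y)) (t ×ₘ 𝟙 Y) a (x, b)
  rw [e'] at e''
  refine (congrArg (fun s => _ ≫ _ ≫ s) ((Category.assoc _ _ _).symm.trans
    (congrArg (· ≫ k.app (x, b)) e''))).trans ?_
  -- In the axiom the point and the identification of profiles act on the two tensor factors at
  -- once; here the identification is moved past the unitor.
  have key {A A' B B' T : V} (q : A ⟶ A') (i : 𝟙_ V ⟶ B) (s : B ⟶ B') (r : B' ⊗ A' ⟶ T) :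
      q ≫ ((λ_ A').inv ≫ i ▷ A') ≫ s ▷ A' ≫ r = (λ_ A).inv ≫ ((i ≫ s) ⊗ₘ q) ≫ r := by
    simp [MonoidalCategory.tensorHom_def']
  exact (congrArg (fun s => _ ≫ _ ≫ s) (Category.assoc _ _ _)).trans (key _ _ _ _)

/-- The same test as in `right_unit_iff`, on the copies of `I` in the first factor of each summand.
There the canonical isomorphism restricts to `Y(𝟙 … 𝟙; f)`. -/
theorem left_unit_iff (H : LeftUnitIndices φ ψ) (Y : Coll C V L) (t : unitColl C V ⟶ X)
    (k : (tensorAlong φ ψ).obj (X, Y) ⟶ Y) :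
    (tensorAlong φ ψ).map (t ×ₘ 𝟙 Y) ≫ k = (leftUnitIso H Y).hom ↔
      ∀ (x : L → Cᵒᵖ) {a b : C} (f : a ⟶ b),
        (λ_ (Y.obj (x, a))).inv ≫
          ((unitPoint t f ≫ X.map
              (profIso (a := arityOne a b) (b := (plug φ).obj (op a, (x, b)))
                (fun p => by
                  rw [Subsingleton.elim p 0]
                  exact (H.slot_eq (op a) x).symm) rfl).hom) ⊗ₘ
            Y.map (profIso (a := (x, a)) (b := (select ψ).obj (a, (x, b)))
              (fun q => congrArg x (H.snd q).symm) rfl).hom) ≫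
          injApp φ ψ (X, Y) a (x, b) ≫ k.app (x, b) = Y.map (Prod.mkHom (𝟙 x) f) := by
  have e (x : L → Cᵒᵖ) {a b : C} (f : a ⟶ b) :
      leftPoint H Y (op a) a (x, b) f ≫ injApp φ ψ (unitColl C V, Y) a (x, b) ≫
        (leftUnitIso H Y).hom.app (x, b) = Y.map (leftFill H (z := (x, b)) f) :=
    (congrArg (_ ≫ ·) (inj_leftUnitHom H Y a (x, b))).trans (leftPoint_unit H Y a (x, b) f)
  -- The identification of `x` with `x ∘ ψ` cancels against the inverse identification inside
  -- `leftFill`, and only `f` remains.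
  have e' (x : L → Cᵒᵖ) {a b : C} (f : a ⟶ b) :
      Y.map (profIso (a := (x, a)) (b := (select ψ).obj (a, (x, b)))
        (fun q => congrArg x (H.snd q).symm) rfl).hom ≫ Y.map (leftFill H (z := (x, b)) f) =
      Y.map (Prod.mkHom (𝟙 x) f) := by
    rw [← CategoryTheory.Functor.map_comp]
    refine congrArg Y.map (Prod.ext (funext fun q => ?_) (Category.id_comp _))
    exact eqToHom_trans (congrArg x (H.snd q).symm) (congrArg x (H.snd q))
  constructor
  · intro h x a b f
    rw [← leftPoint_inj_map H, h, e, e']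
  · intro h
    refine NatTrans.ext (funext fun z => tensor_app_hom_ext φ ψ fun a =>
      leftPoint_hom_ext H fun f => ?_)
    obtain ⟨x, b⟩ := z
    refine Eq.trans ?_ (e x f).symm
    -- The hypothesis is about maps out of `Y(x; a)`, the goal about maps out of `Y(x ∘ ψ; a)`; the
    -- isomorphism between them may be put in front.
    rw [← cancel_epi (Y.map (profIso (a := (x, a)) (b := (select ψ).obj (a, (x, b)))
        (fun q => congrArg x (H.snd q).symm) rfl).hom)]
    exact (leftPoint_inj_map H Y t k x f).trans ((h x f).trans (e' x f).symm)

end Left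

end UnitAxioms

/-! ### The comparison of unital operads -/

section UnitalComparison

variable {C : Type w} [SmallCategory C] {V : Type u} [Category.{v} V] [MonoidalCategory V]
  [SymmetricCategory V] [MonoidalClosed V] [HasColimitsOfSize.{w, w} V]

theorem unitPoint_unit (P : UnitalCOperad C V) {a b : C} (f : a ⟶ b) :
    unitPoint (unitDesc P.unit P.unit_natural) f = P.unit f :=
  unitPoint_unitDesc P.unit P.unit_natural f

theorem left_unit_unitDesc (P : UnitalCOperad C V) {m : ℕ} (h : 1 + m = m + 1) :
    (partialTensor h 0).map (unitDesc P.unit P.unit_natural ×ₘ 𝟙 (P.coll.restr m)) ≫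
      P.comp h 0 = (leftUnitIso (leftUnitIndices h) (P.coll.restr m)).hom :=
  (left_unit_iff (leftUnitIndices h) (P.coll.restr m) (unitDesc P.unit P.unit_natural)
    (P.comp h 0)).2 fun x a b f => by
      rw [unitPoint_unit]
      exact P.left_unit h x f

theorem right_unit_unitDesc (P : UnitalCOperad C V) {n : ℕ} (h : n + 1 = n + 1) (i : Fin n) :
    (partialTensor h i).map (𝟙 (P.coll.restr n) ×ₘ unitDesc P.unit P.unit_natural) ≫
      P.comp h i = (rightUnitIso (rightUnitIndices h i) (P.coll.restr n)).hom :=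
  (right_unit_iff (rightUnitIndices h i) (P.coll.restr n) (unitDesc P.unit P.unit_natural)
    (P.comp h i)).2 fun z b f => by
      rw [unitPoint_unit]
      exact P.right_unit h i z f

/-- The unital internal operad given by a unital `C`-operad. -/
noncomputable def UnitalCOperad.toInternal (P : UnitalCOperad C V) :
    UnitalInternalOperad (CV C V) where
  toInternalOperad := P.toCOperad.toInternal
  unit := unitDesc P.unit P.unit_natural
  left_unit h := left_unit_unitDesc P h
  right_unit h i := right_unit_unitDesc P h i

/-- As a morphism out of `U` is determined by its points, respecting the unit morphism `U ⟶ A_1` is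
the same as respecting every `u_f`. This transfers the unit condition on morphisms in both
directions. -/
theorem unitDesc_comp_iff {P Q : UnitalCOperad C V} (s : P.coll.restr 1 ⟶ Q.coll.restr 1) :
    unitDesc P.unit P.unit_natural ≫ s = unitDesc Q.unit Q.unit_natural ↔
      ∀ {a b : C} (f : a ⟶ b), P.unit f ≫ s.app (arityOne a b) = Q.unit f := by
  constructor
  · intro h a b f
    rw [← unitPoint_unit P f, ← unitPoint_comp, h, unitPoint_unit]
  · intro h
    refine unit_hom_ext fun f => ?_
    rw [unitPoint_comp, unitPoint_unit, unitPoint_unit, h]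

variable (C V) in
/-- The comparison functor from unital `C`-operads to unital internal operads. -/
noncomputable def unitalComparison : UnitalCOperad C V ⥤ UnitalInternalOperad (CV C V) where
  obj P := P.toInternal
  map {P Q} f :=
    { toHom := (comparison C V).map f.toHom
      unit_app := (unitDesc_comp_iff (SymColl.restrMap f.hom 1)).2 fun k => f.unit_hom k }
  map_id P := rfl
  map_comp f g := rfl

instance : (unitalComparison C V).Faithful where
  map_injective {P Q} f g h := by
    have e : UnitalCOperad.Hom.toHom f = UnitalCOperad.Hom.toHom g :=
      (comparison C V).map_injective (congrArg UnitalInternalOperad.Hom.toHom h)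
    exact UnitalCOperad.Hom.ext (congrArg COperad.Hom.hom e)

/-- The underlying morphism lifts by fullness of `comparison`, and the lift respects the `u_f`
because its image respects the unit morphism. -/
instance : (unitalComparison C V).Full where
  map_surjective {P Q} f := by
    obtain ⟨g, hg⟩ := (comparison C V).map_surjective (UnitalInternalOperad.Hom.toHom f)
    have h := UnitalInternalOperad.Hom.unit_app f
    rw [← hg] at h
    refine ⟨⟨g, fun k => (unitDesc_comp_iff (SymColl.restrMap g.hom 1)).1 h k⟩, ?_⟩
    exact UnitalInternalOperad.Hom.ext (congrArg InternalOperad.Hom.app hg)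

theorem unitalComparison_obj_injective : Function.Injective (unitalComparison C V).obj := by
  intro P Q h
  have e : P.toCOperad = Q.toCOperad :=
    comparison_obj_injective (congrArg UnitalInternalOperad.toInternalOperad h)
  rcases P with ⟨P, u, hu, hl, hr⟩
  rcases Q with ⟨Q, u', hu', hl', hr'⟩
  obtain rfl : P = Q := e
  have h : UnitalCOperad.toInternal ⟨P, u, hu, hl, hr⟩ =
    UnitalCOperad.toInternal ⟨P, u', hu', hl', hr'⟩ := h
  unfold UnitalCOperad.toInternal at h
  injection h with h₁ h₂
  -- Both families of units are the points of one and the same morphism out of `U`.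
  obtain rfl : @u = @u' := by
    funext a b f
    rw [← unitPoint_unitDesc u hu f, ← unitPoint_unitDesc u' hu' f]
    exact congrArg (fun t => unitPoint t f) h₂
  rfl

/-- The underlying operad lifts by `comparison_obj_surjective`, and the `u_f` are the points of the
given unit morphism. The morphism that they induce is the given one, by `unit_hom_ext`. -/
theorem unitalComparison_obj_surjective : Function.Surjective (unitalComparison C V).obj := by
  rintro ⟨A, t, hl, hr⟩
  obtain ⟨P, rfl⟩ := comparison_obj_surjective A
  -- The unit morphism, with its source and target in `CV` unfolded to functors.
  let t' : unitColl C V ⟶ P.coll.restr 1 := t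
  refine ⟨⟨P, fun f => unitPoint t' f, unitPoint_natural t',
    fun {m} h x {a b} f => (left_unit_iff (leftUnitIndices h) (P.coll.restr m) t' (P.comp h 0)).1
      (hl h) x f,
    fun {n} h i z {b} f => (right_unit_iff (rightUnitIndices h i) (P.coll.restr n) t'
      (P.comp h i)).1 (hr h i) z f⟩, ?_⟩
  have e : unitDesc (fun f => unitPoint t' f) (unitPoint_natural t') = t :=
    unit_hom_ext fun f => unitPoint_unitDesc _ _ f
  unfold unitalComparison UnitalCOperad.toInternal
  dsimp only
  congr

/-- Compatibility with the projections passes from `G` to its inverse: `F ⋙ p = F ⋙ G ⋙ q = q`. -/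
theorem exists_strict_inverse_over {D : Type*} [Category* D] {E : Type*} [Category* E]
    {B : Type*} [Category* B] (G : D ⥤ E) [G.Full] [G.Faithful]
    (hG : Function.Bijective G.obj) (p : D ⥤ B) (q : E ⥤ B) (h : G ⋙ q = p) :
    ∃ (F : E ⥤ D) (G : D ⥤ E), F ⋙ G = 𝟭 _ ∧ G ⋙ F = 𝟭 _ ∧ F ⋙ p = q := by
  obtain ⟨F, h₁, h₂⟩ := exists_strict_inverse G hG
  refine ⟨F, G, h₁, h₂, ?_⟩
  rw [← h, ← CategoryTheory.Functor.assoc, h₁, CategoryTheory.Functor.id_comp]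

end UnitalComparison

end CatOperad

/-! ### The isomorphisms of categories -/

theorem theoremA (C : Type w) [SmallCategory C] (V : Type u) [Category.{v} V]
    [MonoidalCategory V] [SymmetricCategory V] [MonoidalClosed V] [HasColimitsOfSize.{w, w} V] :
    (∃ (F : InternalOperad (CV C V).toCategoricalOperadData ⥤ COperad C V)
        (G : COperad C V ⥤ InternalOperad (CV C V).toCategoricalOperadData),
      F ⋙ G = 𝟭 _ ∧ G ⋙ F = 𝟭 _ ∧
        F ⋙ COperad.collection C V =
          InternalOperad.collection (CV C V).toCategoricalOperadData) ∧
    (∃ (F : UnitalInternalOperad (CV C V) ⥤ UnitalCOperad C V)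
        (G : UnitalCOperad C V ⥤ UnitalInternalOperad (CV C V)),
      F ⋙ G = 𝟭 _ ∧ G ⋙ F = 𝟭 _ ∧
        F ⋙ UnitalCOperad.collection C V = UnitalInternalOperad.collection (CV C V)) := by
  -- The two equalities proved by `rfl` say that the comparison functors leave the functors `P_n`,
  -- and the morphisms between them, as they are.
  exact ⟨exists_strict_inverse_over (comparison C V)
      ⟨comparison_obj_injective, comparison_obj_surjective⟩ _ _ rfl,
    exists_strict_inverse_over (unitalComparison C V)
      ⟨unitalComparison_obj_injective, unitalComparison_obj_surjective⟩ _ _ rfl⟩
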